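/- Let $k$ be an algebraically closed field of characteristic $0$, and let $\mathcal A$ be a tensor category over $k$: a small $k$-linear abelian category with a $k$-bilinear, biexact symmetric monoidal structure $(\otimes,\mathbf 1)$ which is rigid (every object has a dual) and satisfies $\mathrm{End}(\mathbf 1)=k$. Assume that $\mathcal A$ contains an object $\bar{\mathbf 1}$ such that $\bar{\mathbf 1}\otimes\bar{\mathbf 1}\cong\mathbf 1$ and the commutativity morphism $\bar{\mathbf 1}\otimes\bar{\mathbf 1}\to\bar{\mathbf 1}\otimes\bar{\mathbf 1}$ is multiplication by $-1$. An algebra in $\mathcal A$ is a nonzero associative commutative unital algebra $A$ in the category of ind-objects of $\mathcal A$ (with the tensor product extended from $\mathcal A$). Two objects $X,Y\in\mathcal A$ are locally isomorphic if there is an algebra $A$ in $\mathcal A$ such that $X\otimes A\cong Y\otimes A$ as $A$-modules. For a partition $\lambda$ of $n$ let $V_\lambda$ be the corresponding irreducible representation of the symmetric group $S_n$ over $k$, and let the Schur functor $S_\lambda$ be $S_\lambda(X)=\mathrm{Im}\big(\sum_{g\in S_n} g \text{ on } V_\lambda\otimes X^{\otimes n}\big)$, where $S_n$ acts diagonally,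 and acts on $X^{\otimes n}$ by the commutativity isomorphisms. Proposition. For an object $X\in\mathcal A$ the following conditions are equivalent: (i) there exist integers $p,q\ge 0$ such that $X$ is locally isomorphic to $\mathbf 1^p\oplus\bar{\mathbf 1}^q$; (ii) there exists a partition $\lambda$ (of some $n\ge 0$) such that $S_\lambda(X)=0$. -/

import Mathlib

open CategoryTheory MonoidalCategory Limits Opposite

universe u w

namespace LocalStructure

noncomputable section

/-! ## The action of the symmetric group on tensor powers -/

section TensorPower

universe v' u'

variable {C : Type u'} [Category.{v'} C] [MonoidalCategory C]

/-- The tensor power `X ⊗ (X ⊗ (⋯ ⊗ (X ⊗ 𝟙)))` with `n` factors `X`, numbered `0, …, n - 1`. -/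
def tensorPow (X : C) : ℕ → C
  | 0 => 𝟙_ C
  | n + 1 => X ⊗ tensorPow X n

/-- The morphism `𝟙_X ⊗ f` on `X ⊗ X^{⊗ n}`. -/
def tailMap (X : C) {n : ℕ} (f : tensorPow X n ⟶ tensorPow X n) :
    tensorPow X (n + 1) ⟶ tensorPow X (n + 1) :=
  X ◁ f

lemma tailMap_comp (X : C) {n : ℕ} (f g : tensorPow X n ⟶ tensorPow X n) :
    tailMap X (f ≫ g) = tailMap X f ≫ tailMap X g :=
  MonoidalCategory.whiskerLeft_comp _ _ _

lemma tailMap_id (X : C) (n : ℕ) : tailMap X (𝟙 (tensorPow X n)) = 𝟙 _ :=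
  MonoidalCategory.whiskerLeft_id _ _

variable [SymmetricCategory C]

/-- The exchange of the first two factors of `X ⊗ (X ⊗ X^{⊗ n})` by the commutativity
constraint. -/
def swapTop (X : C) (n : ℕ) : tensorPow X (n + 2) ⟶ tensorPow X (n + 2) :=
  (α_ X X (tensorPow X n)).inv ≫ (β_ X X).hom ▷ tensorPow X n ≫ (α_ X X (tensorPow X n)).hom

/-- The exchange of the factors number `i` and `i + 1` of the tensor power
(the identity if there are no such factors). -/
def adjSwap (X : C) : (n i : ℕ) → (tensorPow X n ⟶ tensorPow X n)
  | 0, _ => 𝟙 _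
  | 1, _ => 𝟙 _
  | n + 2, 0 => swapTop X n
  | n + 2, i + 1 => tailMap X (adjSwap X (n + 1) i)

/-- The morphism that moves the factor number `0` to the position `p` and keeps the order of the
other factors (for `p < n`). -/
def moveTop (X : C) : (n p : ℕ) → (tensorPow X n ⟶ tensorPow X n)
  | _, 0 => 𝟙 _
  | 0, _ + 1 => 𝟙 _
  | 1, _ + 1 => 𝟙 _
  | n + 2, p + 1 => swapTop X n ≫ tailMap X (moveTop X (n + 1) p)

/-- Every permutation `g` of `{0, …, n}` is, in a unique way, a permutation `h` of `{1, …, n}`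
followed by the cycle that moves `0` to `g 0` and keeps the order of the other numbers.
This is `h`, as a permutation of `{0, …, n - 1}`. -/
def permTail {n : ℕ} (g : Equiv.Perm (Fin (n + 1))) : Equiv.Perm (Fin n) :=
  (Equiv.Perm.decomposeFin ((g 0).cycleRange * g)).2

/-- The morphism by which the permutation `g` permutes the factors of the tensor power: the factor
number `i` is moved to the position `g i`. -/
def permMap (X : C) : (n : ℕ) → Equiv.Perm (Fin n) → (tensorPow X n ⟶ tensorPow X n)
  | 0, _ => 𝟙 _
  | n + 1, g => tailMap X (permMap X n (permTail g)) ≫ moveTop X (n + 1) (g 0)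

section Facts

variable (X : C)

lemma swapTop_naturality {n : ℕ} (f : tensorPow X n ⟶ tensorPow X n) :
    tailMap X (tailMap X f) ≫ swapTop X n = swapTop X n ≫ tailMap X (tailMap X f) := by
  have : ∀ {T : C} (f : T ⟶ T),
      X ◁ X ◁ f ≫ (α_ X X T).inv ≫ (β_ X X).hom ▷ T ≫ (α_ X X T).hom =
      ((α_ X X T).inv ≫ (β_ X X).hom ▷ T ≫ (α_ X X T).hom) ≫ X ◁ X ◁ f := by
    intro T f
    rw [associator_inv_naturality_right_assoc, whisker_exchange_assoc,
      Category.assoc, Category.assoc, associator_naturality_right]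
  exact this f

lemma swapTop_naturality_assoc {n : ℕ} (f : tensorPow X n ⟶ tensorPow X n) {Z : C}
    (h : tensorPow X (n + 2) ⟶ Z) :
    tailMap X (tailMap X f) ≫ swapTop X n ≫ h =
      swapTop X n ≫ tailMap X (tailMap X f) ≫ h := by
  rw [← Category.assoc, swapTop_naturality, Category.assoc]

lemma swapTop_swapTop (n : ℕ) : swapTop X n ≫ swapTop X n = 𝟙 _ := by
  have : ∀ (T : C), ((α_ X X T).inv ≫ (β_ X X).hom ▷ T ≫ (α_ X X T).hom) ≫
      ((α_ X X T).inv ≫ (β_ X X).hom ▷ T ≫ (α_ X X T).hom) = 𝟙 _ := by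
    intro T
    simp [← comp_whiskerRight_assoc]
  exact this _

lemma swapTop_braid (n : ℕ) :
    tailMap X (swapTop X n) ≫ swapTop X (n + 1) ≫ tailMap X (swapTop X n) =
      swapTop X (n + 1) ≫ tailMap X (swapTop X n) ≫ swapTop X (n + 1) := by
  have key : ∀ (T : C),
      X ◁ ((α_ X X T).inv ≫ (β_ X X).hom ▷ T ≫ (α_ X X T).hom) ≫
      ((α_ X X (X ⊗ T)).inv ≫ (β_ X X).hom ▷ (X ⊗ T) ≫ (α_ X X (X ⊗ T)).hom) ≫
      X ◁ ((α_ X X T).inv ≫ (β_ X X).hom ▷ T ≫ (α_ X X T).hom) =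
      ((α_ X X (X ⊗ T)).inv ≫ (β_ X X).hom ▷ (X ⊗ T) ≫ (α_ X X (X ⊗ T)).hom) ≫
      X ◁ ((α_ X X T).inv ≫ (β_ X X).hom ▷ T ≫ (α_ X X T).hom) ≫
      ((α_ X X (X ⊗ T)).inv ≫ (β_ X X).hom ▷ (X ⊗ T) ≫ (α_ X X (X ⊗ T)).hom) := by
    intro T
    have h := congrArg (fun f => (α_ X X (X ⊗ T)).inv ≫ (α_ (X ⊗ X) X T).inv ≫
      (α_ X X X).hom ▷ T ≫ f ▷ T ≫ (α_ X (X ⊗ X) T).hom ≫ X ◁ (α_ X X T).hom)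
      (BraidedCategory.yang_baxter X X X)
    refine Eq.trans ?_ (h.symm.trans ?_)
    · monoidal
    · monoidal
  exact key _

lemma swapTop_braid_assoc (n : ℕ) {Z : C} (h : tensorPow X (n + 3) ⟶ Z) :
    tailMap X (swapTop X n) ≫ swapTop X (n + 1) ≫ tailMap X (swapTop X n) ≫ h =
      swapTop X (n + 1) ≫ tailMap X (swapTop X n) ≫ swapTop X (n + 1) ≫ h := by
  have := congrArg (· ≫ h) (swapTop_braid X n)
  simpa only [Category.assoc] using this

lemma adjSwap_succ (n i : ℕ) : adjSwap X (n + 1) (i + 1) = tailMap X (adjSwap X n i) := by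
  cases n with
  | zero => exact (tailMap_id X 0).symm
  | succ n => rfl

lemma adjSwap_zero (n : ℕ) : adjSwap X (n + 2) 0 = swapTop X n := rfl

lemma moveTop_zero (n : ℕ) : moveTop X n 0 = 𝟙 _ := by
  cases n <;> simp [moveTop]

lemma moveTop_succ (n p : ℕ) :
    moveTop X (n + 2) (p + 1) = swapTop X n ≫ tailMap X (moveTop X (n + 1) p) := rfl

lemma adjSwap_adjSwap (n i : ℕ) : adjSwap X n i ≫ adjSwap X n i = 𝟙 _ := by
  induction n generalizing i with
  | zero => simp [adjSwap]
  | succ n ih =>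
    cases i with
    | zero =>
      cases n with
      | zero => simp [adjSwap]
      | succ n => exact swapTop_swapTop X _
    | succ i => rw [adjSwap_succ, ← tailMap_comp, ih, tailMap_id]

lemma moveTop_adjSwap (n i : ℕ) (h : i + 1 < n) :
    moveTop X n i ≫ adjSwap X n i = moveTop X n (i + 1) := by
  induction n generalizing i with
  | zero => omega
  | succ n ih =>
    obtain ⟨n, rfl⟩ : ∃ m, n = m + 1 := ⟨n - 1, by omega⟩
    cases i with
    | zero =>
      rw [moveTop_succ, moveTop_zero, moveTop_zero, tailMap_id, adjSwap_zero, Category.id_comp,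
        Category.comp_id]
    | succ i =>
      rw [moveTop_succ, adjSwap_succ, Category.assoc, ← tailMap_comp, ih i (by omega),
        moveTop_succ]

lemma adjSwap_moveTop_of_lt (n j p : ℕ) (hj : j + 1 < p) (hp : p < n + 1) :
    tailMap X (adjSwap X n j) ≫ moveTop X (n + 1) p =
      moveTop X (n + 1) p ≫ adjSwap X (n + 1) j := by
  induction n generalizing j p with
  | zero => omega
  | succ n ih =>
    obtain ⟨n, rfl⟩ : ∃ m, n = m + 1 := ⟨n - 1, by omega⟩
    obtain ⟨p, rfl⟩ : ∃ m, p = m + 2 := ⟨p - 2, by omega⟩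
    rw [moveTop_succ]
    cases j with
    | zero =>
      rw [moveTop_succ, adjSwap_zero, adjSwap_zero, tailMap_comp]
      simp only [Category.assoc]
      rw [swapTop_naturality, swapTop_braid_assoc]
    | succ j =>
      rw [adjSwap_succ, swapTop_naturality_assoc, ← tailMap_comp, ih j (p + 1) (by omega) (by omega),
        tailMap_comp, adjSwap_succ, Category.assoc]

lemma adjSwap_moveTop_of_le (n j p : ℕ) (hj : p ≤ j) (hp : j + 1 < n) :
    tailMap X (adjSwap X n j) ≫ moveTop X (n + 1) p =
      moveTop X (n + 1) p ≫ adjSwap X (n + 1) (j + 1) := by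
  induction n generalizing j p with
  | zero => omega
  | succ n ih =>
    cases p with
    | zero => rw [moveTop_zero, Category.comp_id, Category.id_comp, adjSwap_succ]
    | succ p =>
      obtain ⟨j, rfl⟩ : ∃ m, j = m + 1 := ⟨j - 1, by omega⟩
      rw [moveTop_succ, adjSwap_succ, adjSwap_succ, swapTop_naturality_assoc, ← tailMap_comp,
        ih j p (by omega) (by omega), tailMap_comp, Category.assoc]

lemma perm_eq_mul {n : ℕ} (g : Equiv.Perm (Fin (n + 1))) :
    g = (g 0).cycleRange.symm * Equiv.Perm.decomposeFin.symm (0, permTail g) := by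
  have h : Equiv.Perm.decomposeFin.symm (0, permTail g) = (g 0).cycleRange * g := by
    rw [Equiv.symm_apply_eq]
    refine Prod.ext ?_ rfl
    have : Equiv.Perm.decomposeFin.symm
      (Equiv.Perm.decomposeFin ((g 0).cycleRange * g)) 0 = ((g 0).cycleRange * g) 0 := by
      rw [Equiv.symm_apply_apply]
    rw [← Prod.mk.eta (p := Equiv.Perm.decomposeFin ((g 0).cycleRange * g)),
      Equiv.Perm.decomposeFin_symm_apply_zero] at this
    rw [this]
    simp
  rw [h, ← mul_assoc]
  ext; simp

lemma permMap_mul_eq {n : ℕ} (p : Fin (n + 1)) (h : Equiv.Perm (Fin n)) :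
    permMap X (n + 1) (p.cycleRange.symm * Equiv.Perm.decomposeFin.symm (0, h)) =
      tailMap X (permMap X n h) ≫ moveTop X (n + 1) p := by
  have h0 : (p.cycleRange.symm * Equiv.Perm.decomposeFin.symm (0, h)) 0 = p := by
    simp
  have h1 : permTail (p.cycleRange.symm * Equiv.Perm.decomposeFin.symm (0, h)) = h := by
    rw [permTail, h0, ← mul_assoc]
    have : p.cycleRange * p.cycleRange.symm = 1 := by ext; simp
    rw [this, one_mul, Equiv.apply_symm_apply]
  change tailMap X (permMap X n (permTail _)) ≫ moveTop X (n + 1) _ = _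
  rw [h0, h1]

lemma permMap_one (n : ℕ) : permMap X n 1 = 𝟙 _ := by
  induction n with
  | zero => rfl
  | succ n ih =>
    have h : (1 : Equiv.Perm (Fin (n + 1))) =
        (0 : Fin (n + 1)).cycleRange.symm * Equiv.Perm.decomposeFin.symm (0, 1) := by
      rw [Equiv.Perm.decomposeFin_symm_of_one, Fin.cycleRange_zero]
      ext x
      simp [Equiv.Perm.one_def]
    rw [h, permMap_mul_eq, ih, tailMap_id, Category.id_comp]
    exact moveTop_zero X _

lemma swap_mul_cycle {n : ℕ} (p : Fin (n + 1)) (h : Equiv.Perm (Fin n)) (a b : Fin n) :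
    Equiv.swap (p.succAbove a) (p.succAbove b) *
      (p.cycleRange.symm * Equiv.Perm.decomposeFin.symm (0, h)) =
    p.cycleRange.symm * Equiv.Perm.decomposeFin.symm (0, Equiv.swap a b * h) := by
  ext x
  induction x using Fin.cases with
  | zero =>
    simp [Equiv.swap_apply_of_ne_of_ne (Fin.ne_succAbove p a) (Fin.ne_succAbove p b)]
  | succ x =>
    simp [Equiv.Perm.decomposeFin_symm_apply_succ, Fin.cycleRange_symm_succ]
    rw [(Fin.succAbove_right_injective (p := p)).swap_apply]

lemma permMap_swap_mul {n : ℕ} (i : Fin n) (g : Equiv.Perm (Fin (n + 1))) :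
    permMap X (n + 1) (Equiv.swap i.castSucc i.succ * g) =
      permMap X (n + 1) g ≫ adjSwap X (n + 1) i := by
  induction n with
  | zero => exact i.elim0
  | succ n ih =>
    obtain ⟨p, h, rfl⟩ : ∃ (p : Fin (n + 2)) (h : Equiv.Perm (Fin (n + 1))),
        g = p.cycleRange.symm * Equiv.Perm.decomposeFin.symm (0, h) :=
      ⟨_, _, perm_eq_mul g⟩
    have up : Equiv.swap i.castSucc i.succ *
        (i.castSucc.cycleRange.symm * Equiv.Perm.decomposeFin.symm (0, h)) =
        i.succ.cycleRange.symm * Equiv.Perm.decomposeFin.symm (0, h) := by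
      rw [← mul_assoc]
      congr 1
      ext x
      induction x using Fin.cases with
      | zero => simp
      | succ x =>
        simp only [Equiv.Perm.coe_mul, Function.comp_apply, Fin.cycleRange_symm_succ]
        rcases lt_trichotomy x i with hx | rfl | hx
        · rw [Fin.succAbove_of_castSucc_lt _ _ (by simpa using hx),
            Fin.succAbove_of_castSucc_lt _ _ (by rw [Fin.lt_def] at *; simp; omega),
            Equiv.swap_apply_of_ne_of_ne]
          · simpa [Fin.ext_iff] using hx.ne
          · rw [Fin.lt_def] at hx
            simp [Fin.ext_iff]; omega
        · simp
        · rw [Fin.succAbove_of_le_castSucc _ _ (by simpa using hx.le),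
            Fin.succAbove_of_le_castSucc _ _ (by rw [Fin.le_def, Fin.lt_def] at *; simp; omega),
            Equiv.swap_apply_of_ne_of_ne]
          · rw [Fin.lt_def] at hx
            simp [Fin.ext_iff]; omega
          · simpa [Fin.ext_iff] using hx.ne'
    by_cases h1 : p = i.castSucc
    · subst h1
      rw [up, permMap_mul_eq, permMap_mul_eq, Category.assoc]
      congr 1
      exact (moveTop_adjSwap X (n + 2) i (by omega)).symm
    by_cases h2 : p = i.succ
    · subst h2
      rw [← up, ← mul_assoc, Equiv.swap_mul_self, one_mul, up, permMap_mul_eq, permMap_mul_eq,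
        Category.assoc]
      congr 1
      have := moveTop_adjSwap X (n + 2) i (by omega)
      rw [Fin.val_succ, ← this, Category.assoc, adjSwap_adjSwap, Category.comp_id]
      rfl
    have h1' : (p : ℕ) ≠ i := fun e => h1 (Fin.ext e)
    have h2' : (p : ℕ) ≠ i + 1 := fun e => h2 (Fin.ext e)
    have hi := i.isLt
    have hp := p.isLt
    rcases lt_or_gt_of_ne h2' with hlt | hgt
    · obtain ⟨j, hj⟩ : ∃ j : Fin n, i = j.succ :=
        ⟨⟨i - 1, by omega⟩, Fin.ext (by simp; omega)⟩
      have e1 : i.castSucc = p.succAbove j.castSucc := by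
        rw [Fin.succAbove_of_le_castSucc _ _ (by
          rw [Fin.le_def]; subst hj; simp at *; omega)]
        subst hj; simp
      have e2 : i.succ = p.succAbove j.succ := by
        rw [Fin.succAbove_of_le_castSucc _ _ (by
          rw [Fin.le_def]; subst hj; simp at *; omega)]
        subst hj; simp
      rw [e1, e2, swap_mul_cycle, permMap_mul_eq, permMap_mul_eq, ih, tailMap_comp,
        Category.assoc, Category.assoc, adjSwap_moveTop_of_le X (n + 1) j p
          (by subst hj; simp at *; omega) (by simp)]
      subst hj; rfl
    · obtain ⟨j, hj⟩ : ∃ j : Fin n, i = j.castSucc :=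
        ⟨⟨i, by omega⟩, Fin.ext (by simp)⟩
      have e1 : i.castSucc = p.succAbove j.castSucc := by
        rw [Fin.succAbove_of_castSucc_lt _ _ (by
          rw [Fin.lt_def]; subst hj; simp at *; omega)]
        subst hj; simp
      have e2 : i.succ = p.succAbove j.succ := by
        rw [Fin.succAbove_of_castSucc_lt _ _ (by
          rw [Fin.lt_def]; subst hj; simp at *; omega)]
        subst hj; simp
      rw [e1, e2, swap_mul_cycle, permMap_mul_eq, permMap_mul_eq, ih, tailMap_comp,
        Category.assoc, Category.assoc, adjSwap_moveTop_of_lt X (n + 1) j p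
          (by subst hj; simp at *; omega) (by omega)]
      subst hj; rfl

lemma permMap_mul (n : ℕ) (g h : Equiv.Perm (Fin n)) :
    permMap X n (g * h) = permMap X n h ≫ permMap X n g := by
  cases n with
  | zero => exact (Category.id_comp _).symm
  | succ n =>
    have hg : g ∈ Submonoid.closure
        (Set.range fun i : Fin n => Equiv.swap i.castSucc i.succ) := by
      rw [Equiv.Perm.mclosure_swap_castSucc_succ]; trivial
    induction hg using Submonoid.closure_induction generalizing h with
    | mem g hg =>
      obtain ⟨i, rfl⟩ := hg
      have := permMap_swap_mul X i 1
      rw [mul_one, permMap_one, Category.id_comp] at this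
      rw [permMap_swap_mul, this]
    | one => rw [one_mul, permMap_one, Category.comp_id]
    | mul a b _ _ ha hb => rw [mul_assoc, ha, hb, ha, Category.assoc]

end Facts

/-- The action of the symmetric group `S_n` on `X^{⊗ n}`. -/
def permAction (X : C) (n : ℕ) : Equiv.Perm (Fin n) →* End (tensorPow X n) where
  toFun := permMap X n
  map_one' := permMap_one X n
  map_mul' g h := permMap_mul X n g h

/-- The simple transposition `(i, i + 1)` acts by the commutativity constraint. -/
lemma permAction_swap (X : C) {n : ℕ} (i : Fin n) :
    permAction X (n + 1) (Equiv.swap i.castSucc i.succ) = adjSwap X (n + 1) i := by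
  have := permMap_swap_mul X i 1
  rwa [mul_one, permMap_one, Category.id_comp] at this

end TensorPower

/-! ## Irreducible representations of symmetric groups -/

section Specht

variable (k : Type w) [Field k]

/-- A numbering of the boxes of the Young diagram `μ`. -/
def boxNumbering (μ : YoungDiagram) : Fin μ.card ≃ μ.cells :=
  μ.cells.equivFin.symm

/-- The row of the box number `i`. -/
def boxRow (μ : YoungDiagram) (i : Fin μ.card) : ℕ := (boxNumbering μ i).1.1

/-- The column of the box number `i`. -/
def boxCol (μ : YoungDiagram) (i : Fin μ.card) : ℕ := (boxNumbering μ i).1.2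

open Classical in
/-- The sum of the permutations that preserve every row. -/
def rowSymmetrizer (μ : YoungDiagram) : MonoidAlgebra k (Equiv.Perm (Fin μ.card)) :=
  ∑ g : Equiv.Perm (Fin μ.card) with ∀ i, boxRow μ (g i) = boxRow μ i, MonoidAlgebra.single g 1

open Classical in
/-- The signed sum of the permutations that preserve every column. -/
def colAntisymmetrizer (μ : YoungDiagram) : MonoidAlgebra k (Equiv.Perm (Fin μ.card)) :=
  ∑ g : Equiv.Perm (Fin μ.card) with ∀ i, boxCol μ (g i) = boxCol μ i,
    MonoidAlgebra.single g ((Equiv.Perm.sign g : ℤ) : k)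

/-- The Young symmetrizer. -/
def youngSymmetrizer (μ : YoungDiagram) : MonoidAlgebra k (Equiv.Perm (Fin μ.card)) :=
  rowSymmetrizer k μ * colAntisymmetrizer k μ

/-- The irreducible representation `V_μ` of the symmetric group attached to the partition `μ`
of `n = μ.card`: the left ideal of the group algebra generated by the Young symmetrizer
(the Specht module). -/
abbrev SpechtModule (μ : YoungDiagram) : Type w :=
  Submodule.span (MonoidAlgebra k (Equiv.Perm (Fin μ.card))) {youngSymmetrizer k μ}

/-- The action of the symmetric group on `V_μ`. -/
def spechtRep (μ : YoungDiagram) :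
    Representation k (Equiv.Perm (Fin μ.card)) (SpechtModule k μ) :=
  Representation.ofModule' (SpechtModule k μ)

instance spechtModule_finite (μ : YoungDiagram) : Module.Finite k (SpechtModule k μ) :=
  inferInstance

end Specht

/-! ## The objects `𝟙^p ⊕ L^q` -/

section Sums

attribute [local instance] Abelian.hasFiniteBiproducts

/-- The object `𝟙^p ⊕ L^q`. -/
def unitSum {C : Type*} [Category* C] [MonoidalCategory C] [Abelian C] (L : C) (p q : ℕ) : C :=
  (⨁ fun _ : Fin p => 𝟙_ C) ⊞ (⨁ fun _ : Fin q => L)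

end Sums

/-! ## Schur functors -/

section Schur

universe v' u'

attribute [local instance] Abelian.hasFiniteBiproducts

variable (k : Type w) [Field k] {C : Type u'} [Category.{v'} C] [MonoidalCategory C]
  [SymmetricCategory C] [Abelian C] [Linear k C]

/-- The object `V ⊗ T` for a finite-dimensional vector space `V` and an object `T`: the direct sum
of copies of `T` indexed by a basis of `V`. -/
def vecTensor (V : Type w) [AddCommGroup V] [Module k V] [Module.Finite k V] (T : C) : C :=
  ⨁ fun _ : Fin (Module.finrank k V) => T

/-- The morphism `a ⊗ f : V ⊗ T ⟶ V ⊗ T` for a linear map `a : V → V` and a morphism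
`f : T ⟶ T`: its component from the copy of `T` number `i` to the copy number `j` is the matrix
entry `a_{j i}` times `f`. -/
def vecTensorMap {V : Type w} [AddCommGroup V] [Module k V] [Module.Finite k V] {T : C}
    (a : V →ₗ[k] V) (f : T ⟶ T) : vecTensor k V T ⟶ vecTensor k V T :=
  biproduct.matrix fun i j =>
    LinearMap.toMatrix (Module.finBasis k V) (Module.finBasis k V) a j i • f

/-- The Schur functor `S_μ`: the image of the sum of all `g ∈ S_n` acting diagonally
on `V_μ ⊗ X^{⊗ n}`, with `n = μ.card`. -/
def schurFunctor (μ : YoungDiagram) (X : C) : C :=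
  Limits.image (∑ g : Equiv.Perm (Fin μ.card),
    vecTensorMap k (spechtRep k μ g) (permAction X μ.card g))

end Schur

/-! ## Algebras and modules in the category of ind-objects -/

section Ind

/-! An ind-object of the small category `C` is a presheaf of sets on `C` that is a filtered colimit
of representable presheaves (`IsIndObject`), and morphisms of ind-objects are the morphisms of
presheaves. The tensor product of ind-objects, which extends the one of `C` and commutes with
filtered colimits in each variable, is the Day convolution of presheaves: a morphism
`F ⊗ G ⟶ H` is a family of maps `F(U) × G(V) → H(U ⊗ V)` natural in `U` and `V`. So we work in the
monoidal category `DayFunctor Cᵒᵖ (Type u)` of presheaves with Day convolution. (For abelian `C`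
with bilinear `⊗`, ind-objects are left exact presheaves, and all these maps are automatically
additive.) -/

open MonoidalCategory.LawfulDayConvolutionMonoidalCategoryStruct in
/-- The commutativity constraint on presheaves induced by the one of `C`. -/
instance dayBraided (C : Type u) [SmallCategory C] [MonoidalCategory C] [BraidedCategory C] :
    BraidedCategory (DayFunctor Cᵒᵖ (Type u)) := by
  letI inst (F G : DayFunctor Cᵒᵖ (Type u)) :
    DayConvolution F.functor G.functor := convolution Cᵒᵖ (Type u) _ F G
  letI inst2 (F G H : DayFunctor Cᵒᵖ (Type u)) :
    DayConvolution F.functor (DayConvolution.convolution G.functor H.functor) :=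
      convolution Cᵒᵖ (Type u) _ F (G ⊗ H)
  letI inst3 (F G H : DayFunctor Cᵒᵖ (Type u)) :
    DayConvolution (DayConvolution.convolution F.functor G.functor) H.functor  :=
      convolution Cᵒᵖ (Type u) _ (F ⊗ G) H
  have hα (F G H : DayFunctor Cᵒᵖ (Type u)) : (α_ F G H).hom.natTrans =
    (DayConvolution.associator F.functor G.functor H.functor).hom :=
     ι_map_associator_hom_eq_associator_hom Cᵒᵖ (Type u) _ F G H
  have hα' (F G H : DayFunctor Cᵒᵖ (Type u)) : (α_ F G H).inv.natTrans =
      (DayConvolution.associator F.functor G.functor H.functor).inv :=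
    congrArg Iso.inv (Iso.ext (hα F G H) :
      (DayFunctor.equiv Cᵒᵖ (Type u)).functor.mapIso (α_ F G H) =
        DayConvolution.associator F.functor G.functor H.functor)
  have hr {F G : DayFunctor Cᵒᵖ (Type u)} (f : F ⟶ G) (H : DayFunctor Cᵒᵖ (Type u)) :
      (f ▷ H).natTrans = DayConvolution.map f.natTrans (𝟙 H.functor) := by
    rw [← tensorHom_id]
    exact ι_map_tensorHom_hom_eq_tensorHom Cᵒᵖ (Type u) _ f (𝟙 H)
  have hl {F G : DayFunctor Cᵒᵖ (Type u)} (f : F ⟶ G) (H : DayFunctor Cᵒᵖ (Type u)) :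
      (H ◁ f).natTrans = DayConvolution.map (𝟙 H.functor) f.natTrans := by
    rw [← id_tensorHom]
    exact ι_map_tensorHom_hom_eq_tensorHom Cᵒᵖ (Type u) _ (𝟙 H) f
  exact {
    braiding F G :=
      { hom := ⟨(DayConvolution.braiding F.functor G.functor).hom⟩
        inv := ⟨(DayConvolution.braiding F.functor G.functor).inv⟩
        hom_inv_id := by
          apply DayFunctor.hom_ext
          exact (DayConvolution.braiding F.functor G.functor).hom_inv_id
        inv_hom_id := by
          apply DayFunctor.hom_ext
          exact (DayConvolution.braiding F.functor G.functor).inv_hom_id }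
    braiding_naturality_right F G H f := by
      apply DayFunctor.hom_ext
      have := DayConvolution.braiding_naturality_right (F.functor) (f.natTrans)
      simp only [DayFunctor.comp_natTrans, hl, hr]
      exact this
    braiding_naturality_left f H := by
      apply DayFunctor.hom_ext
      have := DayConvolution.braiding_naturality_left  (f.natTrans) (H.functor)
      simp only [DayFunctor.comp_natTrans, hl, hr]
      exact this
    hexagon_forward F G H := by
      apply DayFunctor.hom_ext
      simp only [DayFunctor.comp_natTrans, hl, hr, hα]
      exact DayConvolution.hexagon_forward F.functor G.functor H.functor
    hexagon_reverse F G H := by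
      apply DayFunctor.hom_ext
      simp only [DayFunctor.comp_natTrans, hl, hr, hα']
      exact DayConvolution.hexagon_reverse F.functor G.functor H.functor }

variable {C : Type u} [SmallCategory C] [MonoidalCategory C]

/-- An object of `C`, regarded as an ind-object of `C` (a representable presheaf). -/
def toInd (X : C) : DayFunctor Cᵒᵖ (Type u) := ⟨yoneda.obj X⟩

section ExtendScalars

variable {D : Type*} [Category* D] [MonoidalCategory D]

/-- The object `A ⊗ Y` as an `A`-module, with `A` acting by multiplication on the first factor. -/
def freeModule (A : D) [MonObj A] (Y : D) : Mod D A :=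
  letI : ModObj A (A ⊗ Y) :=
    { smul := (α_ A A Y).inv ≫ MonObj.mul ▷ Y
      one_smul := by
        change MonObj.one ▷ (A ⊗ Y) ≫ (α_ A A Y).inv ≫ MonObj.mul ▷ Y = (λ_ (A ⊗ Y)).hom
        rw [associator_inv_naturality_left_assoc, ← comp_whiskerRight, MonObj.one_mul]
        monoidal
      mul_smul := by
        change MonObj.mul ▷ (A ⊗ Y) ≫ (α_ A A Y).inv ≫ MonObj.mul ▷ Y =
          (α_ A A (A ⊗ Y)).hom ≫ A ◁ ((α_ A A Y).inv ≫ MonObj.mul ▷ Y) ≫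
            (α_ A A Y).inv ≫ MonObj.mul ▷ Y
        rw [associator_inv_naturality_left_assoc, ← comp_whiskerRight, MonObj.mul_assoc]
        monoidal }
  ⟨A ⊗ Y⟩

end ExtendScalars

open ZeroObject

/-- An algebra in `C`: a nonzero associative commutative unital algebra in the category of
ind-objects. -/
structure IndAlgebra (C : Type u) [SmallCategory C] [MonoidalCategory C] [SymmetricCategory C]
    [HasZeroObject C] extends CommMon (DayFunctor Cᵒᵖ (Type u)) where
  /-- The underlying presheaf is an ind-object. -/
  isIndObject : IsIndObject X.functor
  /-- The underlying ind-object is not the zero object. -/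
  nonzero : IsEmpty (X.functor ≅ yoneda.obj (0 : C))

variable [SymmetricCategory C] [HasZeroObject C]

/-- The extension of scalars `X_A` of an object `X` of `C`: the ind-object `A ⊗ X` as an
`A`-module. -/
def extendScalars (A : IndAlgebra C) (X : C) : Mod (DayFunctor Cᵒᵖ (Type u)) A.X :=
  freeModule A.X (toInd X)

/-- Two objects of `C` are locally isomorphic if they become isomorphic after some extension
of scalars, to a (nonzero) algebra. -/
def LocallyIsomorphic (X Y : C) : Prop :=
  ∃ A : IndAlgebra C, Nonempty (extendScalars A X ≅ extendScalars A Y)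

end Ind

end

end LocalStructure

/-!
Vanishing of a Schur functor means that a Young symmetrizer acts by zero on a tensor power
(`isZero_schurFunctor_iff`): the Specht module is generated by the symmetrizer, and the matrix
coefficients of a left ideal translate into the action of its generator. A Young symmetrizer is a
row symmetrizer followed by a column antisymmetrizer, hence an integral combination of permutations
in which the identity has the coefficient `1` (`exists_coeff_colorSym_colorAnti`). Only such
relations between permutations are used.

From local isomorphism to a vanishing Schur functor: take the rectangle with `2p + 1` rows and
`2q + 1` columns. The tensor power of `𝟙^p ⊕ L^q` splits into summands, one for each way to put
summands `𝟙` and `L` into the boxes. There are too many boxes for all rows to contain each `L` at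
most once and all columns to contain each `𝟙` at most once, so the row symmetrizer or the column
antisymmetrizer kills the summand (`colorSym_colorAnti_eq_zero`). Relations between permutations are
transported by isomorphisms of free modules, and they descend from free modules because extension of
scalars to a nonzero algebra is faithful (`IndAlgebra.eq_zero_of_free_map_eq_zero`). The latter
holds since the unit is simple and ind-objects are left exact presheaves.

From a relation to local isomorphism: units are split off one by one, after extensions of scalars.
Suppose that `F` is a tensor functor from `C` to a category of free modules and that `F(X)` is the
sum of `F(U)`, with `U ≅ 𝟙^a ⊕ L^b`, and the image of an idempotent `e`, such that the permutations
of the `n`-th tensor power of this image satisfy a relation in which the identity has the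
coefficient `1` (`PartialSplitting`). If `e = 0`, then `F(X) ≅ F(U)`. If `e ≠ 0`, then all
symmetrized powers of `e`, or all those of `e ⊗ L`, are nonzero (`powMap_symSum_ne_zero`): a
vanishing symmetrized power would make the trace of `e` a root of a polynomial with roots
`0, -1, -2, …`, or `0, 1, 2, …` for `e ⊗ L`, so both together would give trace zero, and for trace
zero the partial trace of a vanishing symmetrized power shows that the next lower one vanishes too,
down to `e` itself.

An object `Y` with an idempotent whose symmetrized powers are all nonzero acquires a unit summand
inside the image of the idempotent in three steps (`exists_splitting_of_powMap_symSum_ne_zero`).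
Over the symmetric algebra of `Y` there is a tautological functional on `Y`, which composed with the
idempotent has no vanishing power. Over the symmetric algebra of the dual of `Y` there is a
tautological point of `Y`, and the value of the functional at this point is not nilpotent. Inverting
this value makes the functional split. Splitting off a summand that is invertible under `⊗` lowers
the degree `n` of the relation (`PartialSplitting.step`), because the projection to the summand
kills the complement in all terms that move the first factor; and a relation of degree zero is
absurd, so the procedure ends.

All the algebras are presheaves of algebras (`LaxAlg`), and the extension of scalars is the functor
`LaxAlg.Free.free` to the category `LaxAlg.Free` of free modules. This category is again symmetric
monoidal with duals, so that extensions can be iterated without leaving such categories; it need not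
be abelian, and exactness is replaced by the condition that cokernels in `C` are respected
(`PreservesCokernels`). The iterated extension of scalars `F` that ends the procedure gives the
presheaf `V ↦ Hom(F(V), 𝟙)` on `C`. It is left exact, hence an ind-object, and it is a commutative
algebra over which `X` and `U` become isomorphic (`locallyIsomorphic_of_iso`), as the free module on
`X` over it is `V ↦ Hom(F(V), F(X))`.
-/

-- unification has to see through the recursion that defines tensor powers
attribute [reducible] LocalStructure.tensorPow

open CategoryTheory MonoidalCategory Limits Opposite

namespace LocalStructure

noncomputable section

/-! ### The category of free modules over a commutative algebra -/

/-- A commutative algebra in the category of presheaves of abelian groups on `D`: a contravariant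
lax symmetric monoidal functor from `D` to abelian groups. It is presented by its values
`A(V) = Hom(V, A)`, its pullback maps and its external multiplication `A(V) × A(W) → A(V ⊗ W)`. -/
structure LaxAlg (D : Type u) [SmallCategory D] [MonoidalCategory D] [SymmetricCategory D]
    [Preadditive D] where
  /-- The group of `V`-points. -/
  obj : D → Type u
  /-- The group structure on the `V`-points. -/
  grp : ∀ V, AddCommGroup (obj V)
  /-- Pullback of points. -/
  map : ∀ {V W : D}, (V ⟶ W) → (obj W →+ obj V)
  map_id : ∀ {V : D} (a : obj V), map (𝟙 V) a = a
  map_map : ∀ {V W Z : D} (f : V ⟶ W) (g : W ⟶ Z) (a : obj Z), map f (map g a) = map (f ≫ g) a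
  map_add' : ∀ {V W : D} (f g : V ⟶ W) (a : obj W), map (f + g) a = map f a + map g a
  /-- The unit. -/
  one : obj (𝟙_ D)
  /-- The external multiplication. -/
  mul : ∀ {V W : D}, obj V →+ obj W →+ obj (V ⊗ W)
  mul_map_left : ∀ {V V' W : D} (f : V ⟶ V') (a : obj V') (b : obj W),
    mul (map f a) b = map (f ▷ W) (mul a b)
  mul_map_right : ∀ {V W W' : D} (f : W ⟶ W') (a : obj V) (b : obj W'),
    mul a (map f b) = map (V ◁ f) (mul a b)
  one_mul : ∀ {V : D} (a : obj V), mul one a = map (λ_ V).hom a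
  mul_assoc : ∀ {V W Z : D} (a : obj V) (b : obj W) (c : obj Z),
    mul (mul a b) c = map (α_ V W Z).hom (mul a (mul b c))
  mul_comm : ∀ {V W : D} (a : obj V) (b : obj W), mul a b = map (β_ V W).hom (mul b a)

attribute [instance] LaxAlg.grp

namespace LaxAlg

variable {D : Type u} [SmallCategory D] [MonoidalCategory D] [SymmetricCategory D]
    [Preadditive D] (A : LaxAlg D)

/-- The morphisms `V ⟶ W` of free modules: as `A(W ⊗ T)` is the group of `A`-linear maps
`W ⊗ T ⊗ A ⟶ A`, a morphism acts by precomposition on these groups. It is identified with the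
resulting family of maps `A(W ⊗ T) → A(V ⊗ T)`, natural in `T` and `A`-linear. -/
def homSubgroup (V W : D) : AddSubgroup (∀ T : D, A.obj (W ⊗ T) →+ A.obj (V ⊗ T)) where
  carrier := {φ | (∀ (T T' : D) (t : T ⟶ T') (a : A.obj (W ⊗ T')),
      φ T (A.map (W ◁ t) a) = A.map (V ◁ t) (φ T' a)) ∧
    ∀ (T S : D) (a : A.obj (W ⊗ T)) (b : A.obj S),
      φ (T ⊗ S) (A.map (α_ W T S).inv (A.mul a b)) = A.map (α_ V T S).inv (A.mul (φ T a) b)}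
  add_mem' {φ ψ} hφ hψ := ⟨fun T T' t a => by simp [hφ.1, hψ.1],
    fun T S a b => by simp [hφ.2, hψ.2]⟩
  zero_mem' := ⟨fun T T' t a => by simp, fun T S a b => by simp⟩
  neg_mem' {φ} hφ := ⟨fun T T' t a => by simp [hφ.1], fun T S a b => by simp [hφ.2]⟩

/-- The category of free modules `V ⊗ B` over `B`. -/
structure Free (B : LaxAlg D) where
  /-- The module `V ⊗ B`. -/
  of ::
  /-- The object `V`. -/
  val : D

namespace Free

variable {A}

instance : SmallCategory A.Free where
  Hom X Y := A.homSubgroup X.val Y.val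
  id X := ⟨fun _ => AddMonoidHom.id _, fun _ _ _ _ => rfl, fun _ _ _ _ => rfl⟩
  comp f g := ⟨fun T => (f.1 T).comp (g.1 T),
    fun T T' t a => by simp [f.2.1, g.2.1], fun T S a b => by simp [f.2.2, g.2.2]⟩

/-- The action of a morphism on points. -/
def act {V W : D} (f : (⟨V⟩ : A.Free) ⟶ ⟨W⟩) (T : D) : A.obj (W ⊗ T) →+ A.obj (V ⊗ T) := f.1 T

section

variable {V W Y : D}

lemma act_nat (f : (⟨V⟩ : A.Free) ⟶ ⟨W⟩) {T T' : D} (t : T ⟶ T') (a : A.obj (W ⊗ T')) :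
    act f T (A.map (W ◁ t) a) = A.map (V ◁ t) (act f T' a) := f.2.1 T T' t a

lemma act_lin (f : (⟨V⟩ : A.Free) ⟶ ⟨W⟩) {T S : D} (a : A.obj (W ⊗ T)) (b : A.obj S) :
    act f (T ⊗ S) (A.map (α_ W T S).inv (A.mul a b)) =
      A.map (α_ V T S).inv (A.mul (act f T a) b) := f.2.2 T S a b

lemma hom_ext {f g : (⟨V⟩ : A.Free) ⟶ ⟨W⟩} (h : ∀ T a, act f T a = act g T a) : f = g :=
  Subtype.ext (funext fun T => AddMonoidHom.ext (h T))

@[simp] lemma act_id (T : D) (a) : act (𝟙 (⟨V⟩ : A.Free)) T a = a := rfl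

@[simp] lemma act_comp (f : (⟨V⟩ : A.Free) ⟶ ⟨W⟩) (g : (⟨W⟩ : A.Free) ⟶ ⟨Y⟩) (T : D) (a) :
    act (f ≫ g) T a = act f T (act g T a) := rfl

instance : Preadditive A.Free where
  homGroup X Y := inferInstanceAs (AddCommGroup (A.homSubgroup X.val Y.val))
  add_comp _ _ _ _ _ _ := hom_ext fun _ _ => rfl
  comp_add _ _ _ f _ _ := hom_ext fun T _ => (f.1 T).map_add _ _

@[simp] lemma act_add (f g : (⟨V⟩ : A.Free) ⟶ ⟨W⟩) (T : D) (a) :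
    act (f + g) T a = act f T a + act g T a := rfl

@[simp] lemma act_zero (T : D) (a) : act (0 : (⟨V⟩ : A.Free) ⟶ ⟨W⟩) T a = 0 := rfl

variable (A) in
/-- The morphism `f ⊗ A` of free modules. -/
def fr (f : V ⟶ W) : (⟨V⟩ : A.Free) ⟶ ⟨W⟩ :=
  ⟨fun T => A.map (f ▷ T),
    fun T T' t a => by rw [A.map_map, A.map_map, whisker_exchange],
    fun T S a b => by rw [A.mul_map_left, A.map_map, A.map_map, associator_inv_naturality_left]⟩

@[simp] lemma act_fr (f : V ⟶ W) (T : D) (a) : act (fr A f) T a = A.map (f ▷ T) a := rfl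

lemma fr_id : fr A (𝟙 V) = 𝟙 _ := hom_ext fun T a => by
  rw [act_fr, id_whiskerRight, A.map_id, act_id]

lemma fr_comp (f : V ⟶ W) (g : W ⟶ Y) : fr A (f ≫ g) = fr A f ≫ fr A g := hom_ext fun T a => by
  rw [act_comp, act_fr, act_fr, act_fr, A.map_map, comp_whiskerRight]

lemma fr_comp_assoc (f : V ⟶ W) (g : W ⟶ Y) {U : A.Free} (h : (⟨Y⟩ : A.Free) ⟶ U) :
    fr A (f ≫ g) ≫ h = fr A f ≫ fr A g ≫ h := by
  rw [fr_comp, Category.assoc]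

lemma fr_fr (f : V ⟶ W) (g : W ⟶ Y) : fr A f ≫ fr A g = fr A (f ≫ g) := (fr_comp f g).symm

lemma fr_fr_assoc (f : V ⟶ W) (g : W ⟶ Y) {U : A.Free} (h : (⟨Y⟩ : A.Free) ⟶ U) :
    fr A f ≫ fr A g ≫ h = fr A (f ≫ g) ≫ h :=
  (fr_comp_assoc f g h).symm

/-- Tensoring a morphism with an object on the right. -/
def wr (f : (⟨V⟩ : A.Free) ⟶ ⟨W⟩) (Z : D) : (⟨V ⊗ Z⟩ : A.Free) ⟶ ⟨W ⊗ Z⟩ :=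
  ⟨fun T => ((A.map (α_ V Z T).hom).comp (act f (Z ⊗ T))).comp (A.map (α_ W Z T).inv),
    fun T T' t a => by
      simp only [AddMonoidHom.comp_apply, A.map_map]
      rw [← associator_inv_naturality_right, ← A.map_map, act_nat, A.map_map,
        associator_naturality_right],
    fun T S a b => by
      simp only [AddMonoidHom.comp_apply, A.map_map]
      have h1 : (α_ W Z (T ⊗ S)).inv ≫ (α_ (W ⊗ Z) T S).inv =
          W ◁ (α_ Z T S).inv ≫ (α_ W (Z ⊗ T) S).inv ≫ (α_ W Z T).inv ▷ S := by
        monoidal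
      rw [h1, ← A.map_map, act_nat, ← A.map_map, ← A.mul_map_left, act_lin, A.mul_map_left,
        A.map_map, A.map_map, A.map_map]
      congr 2
      monoidal⟩

lemma act_wr (f : (⟨V⟩ : A.Free) ⟶ ⟨W⟩) (Z T : D) (a) :
    act (wr f Z) T a = A.map (α_ V Z T).hom (act f (Z ⊗ T) (A.map (α_ W Z T).inv a)) := rfl

lemma wr_id (Z : D) : wr (𝟙 (⟨V⟩ : A.Free)) Z = 𝟙 _ := hom_ext fun T a => by
  rw [act_wr, act_id, A.map_map, Iso.hom_inv_id, A.map_id]; rfl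

lemma wr_comp (f : (⟨V⟩ : A.Free) ⟶ ⟨W⟩) (g : (⟨W⟩ : A.Free) ⟶ ⟨Y⟩) (Z : D) :
    wr (f ≫ g) Z = wr f Z ≫ wr g Z := hom_ext fun T a => by
  rw [act_comp, act_wr, act_wr, act_wr, act_comp, A.map_map, Iso.inv_hom_id, A.map_id]

lemma wr_fr (f : V ⟶ W) (Z : D) : wr (fr A f) Z = fr A (f ▷ Z) := hom_ext fun T a => by
  rw [act_wr, act_fr, act_fr, A.map_map, A.map_map]
  congr 2
  simp

lemma wr_add (f g : (⟨V⟩ : A.Free) ⟶ ⟨W⟩) (Z : D) : wr (f + g) Z = wr f Z + wr g Z :=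
  hom_ext fun T a => by rw [act_add, act_wr, act_wr, act_wr, act_add, map_add]

lemma wr_wr (f : (⟨V⟩ : A.Free) ⟶ ⟨W⟩) (Z Z' : D) :
    wr (wr f Z) Z' ≫ fr A (α_ W Z Z').hom = fr A (α_ V Z Z').hom ≫ wr f (Z ⊗ Z') :=
  hom_ext fun T a => by
  simp only [act_comp, act_wr, act_fr, A.map_map]
  have h1 : (α_ W Z (Z' ⊗ T)).inv ≫ (α_ (W ⊗ Z) Z' T).inv ≫ (α_ W Z Z').hom ▷ T =
      W ◁ (α_ Z Z' T).inv ≫ (α_ W (Z ⊗ Z') T).inv := by monoidal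
  rw [h1, ← A.map_map (W ◁ _), act_nat, A.map_map]
  congr 2
  monoidal

lemma wr_wr_assoc (f : (⟨V⟩ : A.Free) ⟶ ⟨W⟩) (Z Z' : D) {U : A.Free}
    (h : (⟨W ⊗ (Z ⊗ Z')⟩ : A.Free) ⟶ U) :
    wr (wr f Z) Z' ≫ fr A (α_ W Z Z').hom ≫ h =
      fr A (α_ V Z Z').hom ≫ wr f (Z ⊗ Z') ≫ h := by
  rw [← Category.assoc, wr_wr, Category.assoc]

lemma wr_unit (f : (⟨V⟩ : A.Free) ⟶ ⟨W⟩) :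
    wr f (𝟙_ D) ≫ fr A (ρ_ W).hom = fr A (ρ_ V).hom ≫ f :=
  hom_ext fun T a => by
  simp only [act_comp, act_wr, act_fr, A.map_map]
  have h1 : (α_ W (𝟙_ D) T).inv ≫ (ρ_ W).hom ▷ T = W ◁ (λ_ T).hom := by monoidal
  rw [h1, act_nat, A.map_map]
  congr 2
  monoidal

lemma wr_exchange (f : (⟨V⟩ : A.Free) ⟶ ⟨W⟩) {Z Z' : D} (g : Z ⟶ Z') :
    wr f Z ≫ fr A (W ◁ g) = fr A (V ◁ g) ≫ wr f Z' :=
  hom_ext fun T a => by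
  simp only [act_comp, act_wr, act_fr, A.map_map]
  have h1 : (α_ W Z T).inv ≫ (W ◁ g) ▷ T = W ◁ (g ▷ T) ≫ (α_ W Z' T).inv := by
    monoidal
  rw [h1, ← A.map_map (W ◁ _), act_nat, A.map_map]
  congr 2
  monoidal

lemma wr_exchange_assoc (f : (⟨V⟩ : A.Free) ⟶ ⟨W⟩) {Z Z' : D} (g : Z ⟶ Z') {U : A.Free}
    (h : (⟨W ⊗ Z'⟩ : A.Free) ⟶ U) :
    wr f Z ≫ fr A (W ◁ g) ≫ h = fr A (V ◁ g) ≫ wr f Z' ≫ h := by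
  rw [← Category.assoc, wr_exchange, Category.assoc]

/-- Tensoring a morphism with an object on the left. -/
def wl (Z : D) (f : (⟨V⟩ : A.Free) ⟶ ⟨W⟩) : (⟨Z ⊗ V⟩ : A.Free) ⟶ ⟨Z ⊗ W⟩ :=
  fr A (β_ Z V).hom ≫ wr f Z ≫ fr A (β_ W Z).hom

lemma wl_id (Z : D) : wl Z (𝟙 (⟨V⟩ : A.Free)) = 𝟙 _ := by
  rw [wl, wr_id, Category.id_comp, fr_fr, SymmetricCategory.symmetry, fr_id]

lemma wl_comp (f : (⟨V⟩ : A.Free) ⟶ ⟨W⟩) (g : (⟨W⟩ : A.Free) ⟶ ⟨Y⟩) (Z : D) :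
    wl Z (f ≫ g) = wl Z f ≫ wl Z g := by
  simp only [wl, wr_comp, Category.assoc, fr_fr_assoc, SymmetricCategory.symmetry, fr_id,
    Category.id_comp]

lemma wl_fr (f : V ⟶ W) (Z : D) : wl Z (fr A f) = fr A (Z ◁ f) := by
  rw [wl, wr_fr, fr_fr, fr_fr, BraidedCategory.braiding_naturality_left,
    SymmetricCategory.symmetry_assoc]

lemma wl_add (f g : (⟨V⟩ : A.Free) ⟶ ⟨W⟩) (Z : D) : wl Z (f + g) = wl Z f + wl Z g := by
  simp only [wl, wr_add, Preadditive.add_comp, Preadditive.comp_add]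

lemma wl_wl (f : (⟨V⟩ : A.Free) ⟶ ⟨W⟩) (Z Z' : D) :
    wl (Z ⊗ Z') f ≫ fr A (α_ Z Z' W).hom = fr A (α_ Z Z' V).hom ≫ wl Z (wl Z' f) := by
  have hf : wr (wr f Z') Z = fr A (α_ V Z' Z).hom ≫ fr A (V ◁ (β_ Z' Z).hom) ≫ wr f (Z ⊗ Z') ≫
      fr A (W ◁ (β_ Z Z').hom) ≫ fr A (α_ W Z' Z).inv := by
    rw [← wr_exchange_assoc, ← wr_wr_assoc]
    simp only [fr_fr, ← whiskerLeft_comp_assoc, SymmetricCategory.symmetry]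
    simp [fr_id]
  have e1 : (α_ Z Z' V).hom ≫ (β_ Z (Z' ⊗ V)).hom ≫ (β_ Z' V).hom ▷ Z ≫ (α_ V Z' Z).hom ≫
      V ◁ (β_ Z' Z).hom = (β_ (Z ⊗ Z') V).hom := by
    rw [← BraidedCategory.braiding_naturality_right_assoc]
    simp [← whiskerLeft_comp]
  have e2 : W ◁ (β_ Z Z').hom ≫ (α_ W Z' Z).inv ≫ (β_ W Z').hom ▷ Z ≫ (β_ (Z' ⊗ W) Z).hom =
      (β_ W (Z ⊗ Z')).hom ≫ (α_ Z Z' W).hom := by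
    rw [BraidedCategory.braiding_naturality_left]
    simp [← whiskerLeft_comp_assoc]
  simp only [wl, wr_comp, wr_fr, Category.assoc, hf, fr_fr, fr_fr_assoc, e1, e2]

lemma wl_wl_assoc (f : (⟨V⟩ : A.Free) ⟶ ⟨W⟩) (Z Z' : D) {U : A.Free}
    (h : (⟨Z ⊗ (Z' ⊗ W)⟩ : A.Free) ⟶ U) :
    wl (Z ⊗ Z') f ≫ fr A (α_ Z Z' W).hom ≫ h =
      fr A (α_ Z Z' V).hom ≫ wl Z (wl Z' f) ≫ h := by
  rw [← Category.assoc, wl_wl, Category.assoc]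

/-- Tensoring on the left is conjugate to tensoring on the right by the symmetry, so this
compatibility follows from the one for two tensorings on the right. -/
lemma wl_wr (f : (⟨V⟩ : A.Free) ⟶ ⟨W⟩) (Z Z' : D) :
    wr (wl Z f) Z' ≫ fr A (α_ Z W Z').hom = fr A (α_ Z V Z').hom ≫ wl Z (wr f Z') := by
  have hf : wr (wr f Z') Z = fr A (α_ V Z' Z).hom ≫ fr A (V ◁ (β_ Z' Z).hom) ≫ wr f (Z ⊗ Z') ≫
      fr A (W ◁ (β_ Z Z').hom) ≫ fr A (α_ W Z' Z).inv := by
    rw [← wr_exchange_assoc, ← wr_wr_assoc]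
    simp only [fr_fr, ← whiskerLeft_comp_assoc, SymmetricCategory.symmetry]
    simp [fr_id]
  have hf' : wr (wr f Z) Z' = fr A (α_ V Z Z').hom ≫ wr f (Z ⊗ Z') ≫ fr A (α_ W Z Z').inv := by
    rw [← wr_wr_assoc, fr_fr]
    simp [fr_id]
  have e1 : (α_ Z V Z').hom ≫ (β_ Z (V ⊗ Z')).hom ≫ (α_ V Z' Z).hom ≫ V ◁ (β_ Z' Z).hom =
      (β_ Z V).hom ▷ Z' ≫ (α_ V Z Z').hom := by
    simp [← whiskerLeft_comp]
  have e2 : W ◁ (β_ Z Z').hom ≫ (α_ W Z' Z).inv ≫ (β_ (W ⊗ Z') Z).hom =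
      (α_ W Z Z').inv ≫ (β_ W Z).hom ▷ Z' ≫ (α_ Z W Z').hom := by
    simp [← whiskerLeft_comp_assoc]
  simp only [wl, wr_comp, wr_fr, Category.assoc, hf, hf', fr_fr, fr_fr_assoc, e1, e2]

lemma wl_wr_assoc (f : (⟨V⟩ : A.Free) ⟶ ⟨W⟩) (Z Z' : D) {U : A.Free}
    (h : (⟨Z ⊗ (W ⊗ Z')⟩ : A.Free) ⟶ U) :
    wr (wl Z f) Z' ≫ fr A (α_ Z W Z').hom ≫ h =
      fr A (α_ Z V Z').hom ≫ wl Z (wr f Z') ≫ h := by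
  rw [← Category.assoc, wl_wr, Category.assoc]

lemma wl_unit (f : (⟨V⟩ : A.Free) ⟶ ⟨W⟩) :
    wl (𝟙_ D) f ≫ fr A (λ_ W).hom = fr A (λ_ V).hom ≫ f := by
  rw [wl, Category.assoc, Category.assoc, fr_fr, braiding_leftUnitor, wr_unit, fr_fr_assoc,
    braiding_rightUnitor]

/-- The functional on a free module given by a point of `A`, through multiplication. -/
def ofPoint (c : A.obj V) : (⟨V⟩ : A.Free) ⟶ ⟨𝟙_ D⟩ :=
  ⟨fun T => (A.mul c).comp (A.map (λ_ T).inv),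
    fun T T' t a => by
      simp only [AddMonoidHom.comp_apply, A.map_map, ← A.mul_map_right]
      rw [leftUnitor_inv_naturality],
    fun T S a b => by
      simp only [AddMonoidHom.comp_apply, A.map_map]
      have h : (λ_ (T ⊗ S)).inv ≫ (α_ (𝟙_ D) T S).inv = (λ_ T).inv ▷ S := by monoidal
      rw [h, ← A.mul_map_left, A.mul_assoc, A.map_map, Iso.inv_hom_id, A.map_id]⟩

lemma act_ofPoint (c : A.obj V) (T : D) (a) :
    act (ofPoint c) T a = A.mul c (A.map (λ_ T).inv a) := rfl

lemma fr_ofPoint (f : V ⟶ W) (c : A.obj W) : fr A f ≫ ofPoint c = ofPoint (A.map f c) :=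
  hom_ext fun T a => by rw [act_comp, act_fr, act_ofPoint, act_ofPoint, A.mul_map_left]

lemma ofPoint_one : ofPoint A.one = 𝟙 _ := hom_ext fun T a => by
  rw [act_ofPoint, A.one_mul, A.map_map, Iso.hom_inv_id, A.map_id, act_id]

/-- The `V`-point of `A` given by a functional on the free module on `V`. -/
def toPoint (f : (⟨V⟩ : A.Free) ⟶ ⟨𝟙_ D⟩) : A.obj V :=
  A.map (ρ_ V).inv (act f (𝟙_ D) (A.map (λ_ (𝟙_ D)).hom A.one))

lemma mul_one' (A : LaxAlg D) {V : D} (a : A.obj V) : A.mul a A.one = A.map (ρ_ V).hom a := by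
  rw [A.mul_comm, A.one_mul, A.map_map, braiding_leftUnitor]

lemma toPoint_ofPoint (c : A.obj V) : toPoint (ofPoint c) = c := by
  rw [toPoint, act_ofPoint, A.map_map, Iso.inv_hom_id, A.map_id, mul_one', A.map_map,
    Iso.inv_hom_id, A.map_id]

lemma ofPoint_toPoint (f : (⟨V⟩ : A.Free) ⟶ ⟨𝟙_ D⟩) : ofPoint (toPoint f) = f :=
  hom_ext fun T a => by
  have h := act_lin f (A.map (λ_ (𝟙_ D)).hom A.one) (A.map (λ_ T).inv a)
  rw [A.mul_map_left, A.one_mul, A.map_map, A.map_map, A.map_map] at h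
  have e : (α_ (𝟙_ D) (𝟙_ D) T).inv ≫ (λ_ (𝟙_ D)).hom ▷ T ≫ (λ_ T).hom ≫ (λ_ T).inv =
      𝟙_ D ◁ (λ_ T).hom := by monoidal
  simp only [Category.assoc] at h
  rw [e, act_nat] at h
  have h2 := congrArg (A.map (V ◁ (λ_ T).inv)) h
  rw [A.map_map, ← whiskerLeft_comp, Iso.inv_hom_id, whiskerLeft_id, A.map_id, A.map_map] at h2
  rw [act_ofPoint, toPoint, A.mul_map_left, h2]
  congr 2
  monoidal

lemma ofPoint_injective : Function.Injective (ofPoint : A.obj V → _) :=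
  Function.LeftInverse.injective toPoint_ofPoint

lemma ofPoint_zero : ofPoint (0 : A.obj V) = 0 :=
  hom_ext fun T a => by simp [act_ofPoint]

lemma wr_ofPoint (c : A.obj V) (d : A.obj W) :
    wr (ofPoint c) W ≫ fr A (λ_ W).hom ≫ ofPoint d = ofPoint (A.mul c d) :=
  hom_ext fun T a => by
  simp only [act_comp, act_wr, act_fr, act_ofPoint, A.map_map, A.mul_assoc]
  have e : (λ_ (W ⊗ T)).inv ≫ (α_ (𝟙_ D) W T).inv ≫ (λ_ W).hom ▷ T = 𝟙 _ := by monoidal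
  rw [e, A.map_id]

/-- Multiplication by a point of `A` is central: it commutes with every morphism of free modules,
since these are `A`-linear and `A` is commutative. -/
lemma central_ofPoint (c : A.obj V) (g : (⟨W⟩ : A.Free) ⟶ ⟨Y⟩) :
    wr (ofPoint c) W ≫ fr A (λ_ W).hom ≫ g =
      wl V g ≫ wr (ofPoint c) Y ≫ fr A (λ_ Y).hom :=
  hom_ext fun T a => by
  simp only [wl, act_comp, act_wr, act_fr, act_ofPoint, A.map_map]
  have e1 : (λ_ (W ⊗ T)).inv ≫ (α_ (𝟙_ D) W T).inv ≫ (λ_ W).hom ▷ T = 𝟙 _ := by monoidal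
  have e2 : (λ_ (Y ⊗ T)).inv ≫ (α_ (𝟙_ D) Y T).inv ≫ (λ_ Y).hom ▷ T = 𝟙 _ := by monoidal
  have e3 : (α_ Y V T).inv ≫ ((β_ Y V).hom ▷ T ≫ (α_ V Y T).hom) ≫ (β_ V (Y ⊗ T)).hom =
      Y ◁ (β_ V T).hom ≫ (α_ Y T V).inv := by
    simp [← comp_whiskerRight_assoc]
  have e4 : (β_ V W).hom ▷ T ≫ (α_ W V T).hom ≫ W ◁ (β_ V T).hom ≫ (α_ W T V).inv =
      (α_ V W T).hom ≫ (β_ V (W ⊗ T)).hom := by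
    simp
  simp only [Category.assoc] at e3
  simp only [e1, e2, A.map_id, A.mul_comm c, A.map_map, Category.assoc]
  rw [e3, ← A.map_map (Y ◁ _), act_nat, act_lin, A.map_map, A.map_map, ← e4]
  simp only [Category.assoc]

/-- Every morphism `f` of free modules is obtained by tensoring from a functional, because the
target has a dual. -/
lemma eq_wr_functional [HasRightDual W] (f : (⟨V⟩ : A.Free) ⟶ ⟨W⟩) :
    ∃ (Z : D) (g : V ⟶ Z ⊗ W) (c : A.obj Z), f = fr A g ≫ wr (ofPoint c) W ≫ fr A (λ_ W).hom := by
  let _ := BraidedCategory.exactPairing_swap W Wᘁ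
  refine ⟨V ⊗ Wᘁ, (ρ_ V).inv ≫ V ◁ η_ (Wᘁ) W ≫ (α_ V (Wᘁ) W).inv,
    toPoint (wr f (Wᘁ) ≫ fr A (ε_ (Wᘁ) W)), ?_⟩
  rw [ofPoint_toPoint, wr_comp, wr_fr, fr_comp, fr_comp]
  have h1 : fr A (V ◁ η_ (Wᘁ) W) ≫ fr A (α_ V (Wᘁ) W).inv ≫ wr (wr f (Wᘁ)) W =
      wr f (𝟙_ D) ≫ fr A (W ◁ η_ (Wᘁ) W) ≫ fr A (α_ W (Wᘁ) W).inv := by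
    rw [wr_exchange_assoc]
    congr 1
    have h := fr A (α_ V (Wᘁ) W).inv ≫= wr_wr f (Wᘁ) W =≫ fr A (α_ W (Wᘁ) W).inv
    simpa [fr_fr, fr_fr_assoc, fr_id] using h
  have h2 : f = fr A (ρ_ V).inv ≫ wr f (𝟙_ D) ≫ fr A (ρ_ W).hom := by
    rw [wr_unit, fr_fr_assoc, Iso.inv_hom_id, fr_id, Category.id_comp]
  have h3 := ExactPairing.coevaluation_evaluation (Wᘁ) W
  have h4 : (ρ_ W).hom = W ◁ η_ (Wᘁ) W ≫ (α_ W (Wᘁ) W).inv ≫ ε_ (Wᘁ) W ▷ W ≫ (λ_ W).hom := by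
    rw [reassoc_of% h3, Iso.inv_hom_id, Category.comp_id]
  conv_lhs => rw [h2, h4]
  simp only [Category.assoc, fr_comp]
  rw [reassoc_of% h1]

/-- The interchange law for the tensor product of morphisms. -/
lemma interchange [HasRightDual W] {V' W' : D} (f : (⟨V⟩ : A.Free) ⟶ ⟨W⟩)
    (g : (⟨V'⟩ : A.Free) ⟶ ⟨W'⟩) : wr f V' ≫ wl W g = wl V g ≫ wr f W' := by
  obtain ⟨Z, u, c, rfl⟩ := eq_wr_functional f
  have h1 : fr A (u ▷ V') ≫ wl (Z ⊗ W) g = wl V g ≫ fr A (u ▷ W') := by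
    simp only [wl, Category.assoc, fr_fr]
    rw [fr_fr_assoc, BraidedCategory.braiding_naturality_left, fr_comp_assoc,
      ← wr_exchange_assoc, fr_fr, BraidedCategory.braiding_naturality_right]
  have h2 : ∀ U : D, wr (wr (ofPoint c) W) U ≫ fr A ((λ_ W).hom ▷ U) =
      fr A (α_ Z W U).hom ≫ wr (ofPoint c) (W ⊗ U) ≫ fr A (λ_ (W ⊗ U)).hom := by
    intro U
    rw [← wr_wr_assoc, fr_fr]
    congr 2
    monoidal
  simp only [wr_comp, wr_fr, Category.assoc]
  rw [h2, reassoc_of% (h2 V'), central_ofPoint, ← wl_wl_assoc, reassoc_of% h1]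

end

variable [RightRigidCategory D]

/-- The tensor product of free modules. The interchange law uses that all objects have duals, and
the remaining axioms are inherited from `D`. -/
instance : MonoidalCategory A.Free where
  tensorObj X Y := ⟨X.val ⊗ Y.val⟩
  tensorUnit := ⟨𝟙_ D⟩
  whiskerLeft Z _ _ f := wl Z.val f
  whiskerRight f Z := wr f Z.val
  tensorHom {_ Y _ _} f g := wr f _ ≫ wl Y.val g
  associator X Y Z := ⟨fr A (α_ X.val Y.val Z.val).hom, fr A (α_ X.val Y.val Z.val).inv,
    by rw [fr_fr, Iso.hom_inv_id, fr_id], by rw [fr_fr, Iso.inv_hom_id, fr_id]⟩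
  leftUnitor X := ⟨fr A (λ_ X.val).hom, fr A (λ_ X.val).inv,
    by rw [fr_fr, Iso.hom_inv_id, fr_id], by rw [fr_fr, Iso.inv_hom_id, fr_id]⟩
  rightUnitor X := ⟨fr A (ρ_ X.val).hom, fr A (ρ_ X.val).inv,
    by rw [fr_fr, Iso.hom_inv_id, fr_id], by rw [fr_fr, Iso.inv_hom_id, fr_id]⟩
  tensorHom_def _ _ := rfl
  id_tensorHom_id X Y := by rw [wr_id, wl_id]; exact Category.id_comp _
  tensorHom_comp_tensorHom f₁ f₂ g₁ g₂ := by
    simp only [wr_comp, wl_comp, Category.assoc]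
    rw [← reassoc_of% (interchange g₁ f₂)]
  whiskerLeft_id _ _ := wl_id _
  id_whiskerRight _ _ := wr_id _
  associator_naturality {X₁ X₂ X₃ Y₁ Y₂ Y₃} f₁ f₂ f₃ := by
    simp only [wr_comp, wl_comp, Category.assoc]
    rw [wl_wl, wl_wr_assoc, wr_wr_assoc]
  leftUnitor_naturality f := wl_unit f
  rightUnitor_naturality f := wr_unit f
  pentagon W X Y Z := by
    dsimp only
    simp only [wr_fr, wl_fr, fr_fr]
    rw [pentagon]
  triangle X Y := by
    dsimp only
    simp only [wr_fr, wl_fr, fr_fr]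
    rw [triangle]

instance : MonoidalPreadditive A.Free where
  whiskerLeft_zero {X Y Z} := by
    have h := wl_add (0 : Y ⟶ Z) 0 X.val
    rw [add_zero] at h
    exact left_eq_add.mp h
  zero_whiskerRight {X Y Z} := by
    have h := wr_add (0 : Y ⟶ Z) 0 X.val
    rw [add_zero] at h
    exact left_eq_add.mp h
  whiskerLeft_add f g := wl_add f g _
  add_whiskerRight f g := wr_add f g _

instance : SymmetricCategory A.Free where
  braiding X Y := ⟨fr A (β_ X.val Y.val).hom, fr A (β_ X.val Y.val).inv,
    by rw [fr_fr, Iso.hom_inv_id, fr_id]; rfl, by rw [fr_fr, Iso.inv_hom_id, fr_id]; rfl⟩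
  braiding_naturality_right X Y Z f := by
    change wl X.val f ≫ fr A _ = fr A _ ≫ wr f X.val
    simp only [wl, Category.assoc, fr_fr, SymmetricCategory.symmetry, fr_id]
    exact congrArg _ (Category.comp_id _)
  braiding_naturality_left f Z := by
    change wr f Z.val ≫ fr A _ = fr A _ ≫ wl Z.val f
    simp only [wl, fr_fr_assoc, SymmetricCategory.symmetry, fr_id]
    exact (Category.id_comp _).symm
  hexagon_forward X Y Z := by
    change fr A _ ≫ fr A _ ≫ fr A _ = wr (fr A _) _ ≫ fr A _ ≫ wl _ (fr A _)
    simp only [wr_fr, wl_fr, fr_fr]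
    exact congrArg (fr A) (BraidedCategory.hexagon_forward _ _ _)
  hexagon_reverse X Y Z := by
    change fr A _ ≫ fr A _ ≫ fr A _ = wl _ (fr A _) ≫ fr A _ ≫ wr (fr A _) _
    simp only [wr_fr, wl_fr, fr_fr]
    exact congrArg (fr A) (BraidedCategory.hexagon_reverse _ _ _)
  symmetry X Y := by
    change fr A _ ≫ fr A _ = _
    rw [fr_fr, SymmetricCategory.symmetry, fr_id]
    rfl

variable (A) in
/-- The functor `V ↦ V ⊗ A` of extension of scalars. -/
abbrev free : D ⥤ A.Free where
  obj V := ⟨V⟩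
  map f := fr A f
  map_id _ := fr_id
  map_comp f g := fr_comp f g

instance [MonoidalPreadditive D] : (free A).Additive where
  map_add {V W f g} := hom_ext (V := V) (W := W) fun T a => by
    change A.map ((f + g) ▷ T) a = A.map (f ▷ T) a + A.map (g ▷ T) a
    rw [MonoidalPreadditive.add_whiskerRight, A.map_add']

variable (A) in
/-- The functor of extension of scalars strictly preserves tensor products. -/
def freeCoreMonoidal : (free A).CoreMonoidal where
  εIso := Iso.refl (⟨𝟙_ D⟩ : A.Free)
  μIso X Y := Iso.refl (⟨X ⊗ Y⟩ : A.Free)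
  μIso_hom_natural_left f X :=
    (Category.comp_id (wr (fr A f) X)).trans ((wr_fr f X).trans (Category.id_comp _).symm)
  μIso_hom_natural_right X f :=
    (Category.comp_id (wl X (fr A f))).trans ((wl_fr f X).trans (Category.id_comp _).symm)
  associativity X Y Z := by
    change wr (𝟙 _) Z ≫ 𝟙 _ ≫ fr A (α_ X Y Z).hom = fr A (α_ X Y Z).hom ≫ wl X (𝟙 _) ≫ 𝟙 _
    rw [wr_id, wl_id, Category.id_comp, Category.id_comp, Category.comp_id, Category.comp_id]
  left_unitality X := by
    change fr A (λ_ X).hom = wr (𝟙 _) X ≫ 𝟙 _ ≫ fr A (λ_ X).hom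
    rw [wr_id, Category.id_comp, Category.id_comp]
  right_unitality X := by
    change fr A (ρ_ X).hom = wl X (𝟙 _) ≫ 𝟙 _ ≫ fr A (ρ_ X).hom
    rw [wl_id, Category.id_comp, Category.id_comp]

instance : (free A).Monoidal := (freeCoreMonoidal A).toMonoidal

instance : (free A).Braided where
  braided X Y :=
    (Category.id_comp (fr A (β_ X Y).hom)).trans (Category.comp_id (fr A (β_ X Y).hom)).symm

/-- The dual of a free module is the free module on the dual. -/
instance : RightRigidCategory A.Free where
  rightDual X :=
    { rightDual := ⟨X.valᘁ⟩
      exact :=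
        { coevaluation' := fr A (η_ X.val (X.valᘁ))
          evaluation' := fr A (ε_ X.val (X.valᘁ))
          coevaluation_evaluation' := by
            change wl _ (fr A _) ≫ fr A _ ≫ wr (fr A _) _ = fr A _ ≫ fr A _
            simp only [wr_fr, wl_fr, fr_fr]
            rw [ExactPairing.coevaluation_evaluation]
          evaluation_coevaluation' := by
            change wr (fr A _) _ ≫ fr A _ ≫ wl _ (fr A _) = fr A _ ≫ fr A _
            simp only [wr_fr, wl_fr, fr_fr]
            rw [ExactPairing.evaluation_coevaluation] } }

end Free
end LaxAlg

/-! ### Tensor powers -/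

section Powers

universe v₁ u₁

variable {D : Type u₁} [Category.{v₁} D] [MonoidalCategory D]

/-- The tensor power `f ⊗ ⋯ ⊗ f` of a morphism. -/
def powMap {X Y : D} (f : X ⟶ Y) : (n : ℕ) → (tensorPow X n ⟶ tensorPow Y n)
  | 0 => 𝟙 _
  | n + 1 => f ▷ tensorPow X n ≫ Y ◁ powMap f n

lemma powMap_succ {X Y : D} (f : X ⟶ Y) (n : ℕ) :
    powMap f (n + 1) = f ▷ tensorPow X n ≫ Y ◁ powMap f n := rfl

lemma powMap_id (X : D) (n : ℕ) : powMap (𝟙 X) n = 𝟙 _ := by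
  induction n with
  | zero => rfl
  | succ n ih => rw [powMap_succ, ih, id_whiskerRight, whiskerLeft_id, Category.comp_id]

lemma powMap_comp {X Y Z : D} (f : X ⟶ Y) (g : Y ⟶ Z) (n : ℕ) :
    powMap (f ≫ g) n = powMap f n ≫ powMap g n := by
  induction n with
  | zero => exact (Category.id_comp _).symm
  | succ n ih =>
    rw [powMap_succ, powMap_succ, powMap_succ, ih, comp_whiskerRight, whiskerLeft_comp]
    simp only [Category.assoc]
    rw [whisker_exchange_assoc]

/-- The canonical morphism `X^{⊗ n} ⊗ X^{⊗ m} ⟶ X^{⊗ (m + n)}`. -/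
def powJoin (X : D) : (n m : ℕ) → (tensorPow X n ⊗ tensorPow X m ⟶ tensorPow X (m + n))
  | 0, m => (λ_ (tensorPow X m)).hom
  | n + 1, m => (α_ X (tensorPow X n) (tensorPow X m)).hom ≫ X ◁ powJoin X n m

lemma powJoin_zero (X : D) (m : ℕ) : powJoin X 0 m = (λ_ (tensorPow X m)).hom := rfl

lemma powJoin_succ (X : D) (n m : ℕ) : powJoin X (n + 1) m =
    (α_ X (tensorPow X n) (tensorPow X m)).hom ≫ X ◁ powJoin X n m := rfl

/-- The identification of tensor powers with equal exponents. -/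
def powCast (X : D) {a b : ℕ} (h : a = b) : tensorPow X a ⟶ tensorPow X b :=
  eqToHom (congrArg (tensorPow X) h)

@[simp] lemma powCast_rfl (X : D) {a : ℕ} (h : a = a) : powCast X h = 𝟙 _ := rfl

@[simp]
lemma powCast_trans (X : D) {a b c : ℕ} (h : a = b) (h' : b = c) :
    powCast X h ≫ powCast X h' = powCast X (h.trans h') := by
  subst h h'; simp

lemma whiskerLeft_powCast (X : D) {a b : ℕ} (h : a = b) :
    X ◁ powCast X h = powCast X (congrArg (· + 1) h) := by
  subst h; exact whiskerLeft_id _ _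

lemma powJoin_zero_right (X : D) (n : ℕ) :
    powJoin X n 0 = (ρ_ (tensorPow X n)).hom ≫ powCast X (Nat.zero_add n).symm := by
  induction n with
  | zero =>
    rw [powJoin_zero, powCast_rfl, Category.comp_id]
    exact unitors_equal
  | succ n ih =>
    rw [powJoin_succ, ih, whiskerLeft_comp, whiskerLeft_powCast]
    rw [← Category.assoc]
    congr 1
    exact (rightUnitor_tensor_hom X (tensorPow X n)).symm

lemma powJoin_assoc (X : D) (n m l : ℕ) :
    powJoin X n m ▷ tensorPow X l ≫ powJoin X (m + n) l =
      (α_ _ _ _).hom ≫ tensorPow X n ◁ powJoin X m l ≫ powJoin X n (l + m) ≫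
        powCast X (Nat.add_assoc l m n) := by
  induction n with
  | zero =>
    rw [powCast_rfl, Category.comp_id]
    change (λ_ _).hom ▷ _ ≫ powJoin X m l = (α_ (𝟙_ D) _ _).hom ≫ 𝟙_ D ◁ _ ≫ (λ_ _).hom
    rw [leftUnitor_naturality]
    simp
  | succ n ih =>
    have e : powJoin X (n + 1) m ▷ tensorPow X l ≫ powJoin X (m + (n + 1)) l =
        (α_ X (tensorPow X n) (tensorPow X m)).hom ▷ tensorPow X l ≫ (α_ _ _ _).hom ≫
        X ◁ (powJoin X n m ▷ tensorPow X l ≫ powJoin X (m + n) l) := by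
      change ((α_ X (tensorPow X n) (tensorPow X m)).hom ≫ X ◁ powJoin X n m) ▷ tensorPow X l ≫
        (α_ X (tensorPow X (m + n)) (tensorPow X l)).hom ≫ X ◁ powJoin X (m + n) l = _
      simp
    have e' : (α_ (X ⊗ tensorPow X n) (tensorPow X m) (tensorPow X l)).hom ≫
        (X ⊗ tensorPow X n) ◁ powJoin X m l ≫
        ((α_ X (tensorPow X n) (tensorPow X (l + m))).hom ≫ X ◁ powJoin X n (l + m)) ≫
        X ◁ powCast X (Nat.add_assoc l m n) =
        (α_ X (tensorPow X n) (tensorPow X m)).hom ▷ tensorPow X l ≫ (α_ _ _ _).hom ≫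
        X ◁ ((α_ _ _ _).hom ≫ tensorPow X n ◁ powJoin X m l ≫ powJoin X n (l + m) ≫
        powCast X (Nat.add_assoc l m n)) := by
      simp
    rw [e, ih, ← e', whiskerLeft_powCast]
    rfl

end Powers

section SymSum

universe v₁ u₁

variable {D : Type u₁} [Category.{v₁} D] [MonoidalCategory D] [SymmetricCategory D]

lemma swapTop_powMap {X Y : D} (f : X ⟶ Y) (n : ℕ) :
    powMap f (n + 2) ≫ swapTop Y n = swapTop X n ≫ powMap f (n + 2) := by
  have : ∀ {T U : D} (g : T ⟶ U),
      (f ▷ (X ⊗ T) ≫ Y ◁ (f ▷ T ≫ Y ◁ g)) ≫ (α_ Y Y U).inv ≫ (β_ Y Y).hom ▷ U ≫ (α_ Y Y U).hom =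
      ((α_ X X T).inv ≫ (β_ X X).hom ▷ T ≫ (α_ X X T).hom) ≫
        (f ▷ (X ⊗ T) ≫ Y ◁ (f ▷ T ≫ Y ◁ g)) := by
    intro T U g
    have h : (f ▷ X ≫ Y ◁ f) ≫ (β_ Y Y).hom = (β_ X X).hom ≫ (f ▷ X ≫ Y ◁ f) := by
      rw [Category.assoc, BraidedCategory.braiding_naturality_right,
        BraidedCategory.braiding_naturality_left_assoc, whisker_exchange]
    have h1 : f ▷ (X ⊗ T) ≫ Y ◁ (f ▷ T ≫ Y ◁ g) =
        (α_ X X T).inv ≫ (f ▷ X ≫ Y ◁ f) ▷ T ≫ (Y ⊗ Y) ◁ g ≫ (α_ Y Y U).hom := by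
      simp
    rw [h1]
    simp only [Category.assoc, Iso.hom_inv_id_assoc]
    rw [whisker_exchange_assoc, ← comp_whiskerRight_assoc, h, comp_whiskerRight_assoc]
  exact this _

lemma moveTop_powMap {X Y : D} (f : X ⟶ Y) (n p : ℕ) :
    powMap f n ≫ moveTop Y n p = moveTop X n p ≫ powMap f n := by
  induction n generalizing p with
  | zero => cases p <;> simp [moveTop]
  | succ n ih =>
    cases p with
    | zero => rw [moveTop_zero, moveTop_zero, Category.id_comp, Category.comp_id]
    | succ p =>
      cases n with
      | zero => simp [moveTop]
      | succ n =>
        rw [moveTop_succ, moveTop_succ, ← Category.assoc, swapTop_powMap, Category.assoc,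
          Category.assoc]
        congr 1
        have := ih p
        change (f ▷ _ ≫ Y ◁ powMap f (n + 1)) ≫ Y ◁ moveTop Y (n + 1) p =
          X ◁ moveTop X (n + 1) p ≫ f ▷ _ ≫ Y ◁ powMap f (n + 1)
        rw [Category.assoc, ← whiskerLeft_comp, this, whisker_exchange_assoc, whiskerLeft_comp]

lemma permMap_powMap {X Y : D} (f : X ⟶ Y) (n : ℕ) (g : Equiv.Perm (Fin n)) :
    powMap f n ≫ permMap Y n g = permMap X n g ≫ powMap f n := by
  induction n with
  | zero => exact (Category.comp_id _).trans (Category.id_comp _).symm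
  | succ n ih =>
    change powMap f (n + 1) ≫ Y ◁ permMap Y n (permTail g) ≫ moveTop Y (n + 1) (g 0) =
      (X ◁ permMap X n (permTail g) ≫ moveTop X (n + 1) (g 0)) ≫ powMap f (n + 1)
    rw [Category.assoc, ← moveTop_powMap, ← Category.assoc, ← Category.assoc]
    congr 1
    change (f ▷ _ ≫ Y ◁ powMap f n) ≫ _ = _ ≫ f ▷ _ ≫ Y ◁ powMap f n
    rw [Category.assoc, ← whiskerLeft_comp, ih, whisker_exchange_assoc, whiskerLeft_comp]

/-- Statements about permutations of `n` letters that hold for the simple transpositions and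
pass to products. -/
lemma perm_induction {n : ℕ} {P : Equiv.Perm (Fin n) → Prop} (one : P 1)
    (mul : ∀ g h, P g → P h → P (g * h))
    (swap : ∀ (i : ℕ) (hi : i + 1 < n), P (Equiv.swap ⟨i, by omega⟩ ⟨i + 1, hi⟩)) (g) : P g := by
  cases n with
  | zero => rwa [Subsingleton.elim g 1]
  | succ n =>
    have hg : g ∈ Submonoid.closure
        (Set.range fun i : Fin n => Equiv.swap i.castSucc i.succ) := by
      rw [Equiv.Perm.mclosure_swap_castSucc_succ]; trivial
    induction hg using Submonoid.closure_induction with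
    | mem g hg =>
      obtain ⟨i, rfl⟩ := hg
      exact swap i (by omega)
    | one => exact one
    | mul a b _ _ ha hb => exact mul a b ha hb

lemma permMap_swap (X : D) {n : ℕ} (i : ℕ) (hi : i + 1 < n) :
    permMap X n (Equiv.swap ⟨i, by omega⟩ ⟨i + 1, hi⟩) = adjSwap X n i := by
  obtain ⟨n, rfl⟩ : ∃ m, n = m + 1 := ⟨n - 1, by omega⟩
  exact permAction_swap X (⟨i, by omega⟩ : Fin n)

lemma moveTop_eq_permMap (X : D) {n : ℕ} (p : Fin (n + 1)) :
    moveTop X (n + 1) p = permMap X (n + 1) p.cycleRange.symm := by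
  have h := permMap_mul_eq X p 1
  rw [permMap_one, tailMap_id, Category.id_comp, Equiv.Perm.decomposeFin_symm_of_one] at h
  rw [← h]
  simp only [Equiv.swap_self]
  rfl

lemma adjSwap_powJoin_left (X : D) (n m i : ℕ) (hi : i + 1 < n) :
    adjSwap X n i ▷ tensorPow X m ≫ powJoin X n m = powJoin X n m ≫ adjSwap X (m + n) i := by
  induction n generalizing i with
  | zero => omega
  | succ n ih =>
    obtain ⟨n, rfl⟩ : ∃ k, n = k + 1 := ⟨n - 1, by omega⟩
    cases i with
    | zero =>
      have : ∀ {T U W : D} (f : T ⊗ U ⟶ W),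
          ((α_ X X T).inv ≫ (β_ X X).hom ▷ T ≫ (α_ X X T).hom) ▷ U ≫
            (α_ X (X ⊗ T) U).hom ≫ X ◁ ((α_ X T U).hom ≫ X ◁ f) =
          ((α_ X (X ⊗ T) U).hom ≫ X ◁ ((α_ X T U).hom ≫ X ◁ f)) ≫
            ((α_ X X W).inv ≫ (β_ X X).hom ▷ W ≫ (α_ X X W).hom) := by
        intro T U W f
        have h1 : (α_ X (X ⊗ T) U).hom ≫ X ◁ ((α_ X T U).hom ≫ X ◁ f) =
            (α_ X X T).inv ▷ U ≫ (α_ (X ⊗ X) T U).hom ≫ (X ⊗ X) ◁ f ≫ (α_ X X W).hom := by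
          simp
        rw [h1]
        simp only [comp_whiskerRight, Category.assoc, hom_inv_whiskerRight_assoc,
          Iso.hom_inv_id_assoc]
        rw [whisker_exchange_assoc, associator_naturality_left_assoc]
      exact this (powJoin X n m)
    | succ i =>
      have h := ih i (by omega)
      have e : adjSwap X (m + (n + 1 + 1)) (i + 1) = X ◁ adjSwap X (m + (n + 1)) i :=
        adjSwap_succ X _ i
      rw [e, adjSwap_succ]
      change (X ◁ adjSwap X (n + 1) i) ▷ _ ≫ (α_ X _ _).hom ≫ X ◁ powJoin X (n + 1) m =
        ((α_ X _ _).hom ≫ X ◁ powJoin X (n + 1) m) ≫ _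
      rw [associator_naturality_middle_assoc, ← whiskerLeft_comp, h, whiskerLeft_comp,
        Category.assoc]

lemma tail_permMap (X : D) (n : ℕ) (g : Equiv.Perm (Fin n)) :
    X ◁ permMap X n g = permMap X (n + 1) (Equiv.Perm.decomposeFin.symm (0, g)) := by
  have h := permMap_mul_eq X 0 g
  rw [Fin.cycleRange_zero] at h
  exact ((Category.comp_id _).symm.trans
    (congrArg _ (moveTop_zero X (n + 1)).symm)).trans h.symm

/-- Moving a factor past `X^{⊗ m}`. -/
lemma powJoin_moveTop (X : D) (m n : ℕ) :
    (α_ X (tensorPow X m) (tensorPow X n)).hom ≫ X ◁ powJoin X m n ≫ moveTop X (n + m + 1) m =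
      (β_ X (tensorPow X m)).hom ▷ tensorPow X n ≫ (α_ (tensorPow X m) X (tensorPow X n)).hom ≫
        powJoin X m (n + 1) ≫ powCast X (by omega) := by
  induction m with
  | zero =>
    have : ∀ T : D, (α_ X (𝟙_ D) T).hom ≫ X ◁ (λ_ T).hom ≫ 𝟙 _ =
        (β_ X (𝟙_ D)).hom ▷ T ≫ (α_ (𝟙_ D) X T).hom ≫ (λ_ _).hom ≫ 𝟙 _ := by
      intro T
      simp
    exact this _
  | succ m ih =>
    have aux : ∀ {T U W Z : D} (J : T ⊗ U ⟶ W) (q : X ⊗ W ⟶ Z) (R : T ⊗ (X ⊗ U) ⟶ Z)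
        (_ : (α_ X T U).hom ≫ X ◁ J ≫ q = (β_ X T).hom ▷ U ≫ (α_ T X U).hom ≫ R),
        (α_ X (X ⊗ T) U).hom ≫ X ◁ ((α_ X T U).hom ≫ X ◁ J) ≫
          ((α_ X X W).inv ≫ (β_ X X).hom ▷ W ≫ (α_ X X W).hom) ≫ X ◁ q =
        (β_ X (X ⊗ T)).hom ▷ U ≫ (α_ (X ⊗ T) X U).hom ≫ ((α_ X T (X ⊗ U)).hom ≫ X ◁ R) := by
      intro T U W Z J q R h
      have h' : X ◁ J ≫ q = (α_ X T U).inv ≫ (β_ X T).hom ▷ U ≫ (α_ T X U).hom ≫ R := by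
        rw [← h, Iso.inv_hom_id_assoc]
      have e : X ◁ ((α_ X T U).hom ≫ X ◁ J) ≫
          ((α_ X X W).inv ≫ (β_ X X).hom ▷ W ≫ (α_ X X W).hom) ≫ X ◁ q =
          X ◁ (α_ X T U).hom ≫ (α_ X X (T ⊗ U)).inv ≫ (β_ X X).hom ▷ (T ⊗ U) ≫
          (α_ X X (T ⊗ U)).hom ≫ X ◁ (X ◁ J ≫ q) := by
        simp only [whiskerLeft_comp, Category.assoc]
        rw [associator_inv_naturality_right_assoc, whisker_exchange_assoc,
          associator_naturality_right_assoc]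
      rw [e, h']
      simp [BraidedCategory.braiding_tensor_right_hom]
    have h := aux (powJoin X m n) (moveTop X (n + m + 1) m)
      (powJoin X m (n + 1) ≫ powCast X (by omega)) ih
    have e : X ◁ (powJoin X m (n + 1) ≫ powCast X (by omega : n + 1 + m = n + m + 1)) =
        X ◁ powJoin X m (n + 1) ≫ powCast X (by omega : n + 1 + (m + 1) = n + (m + 1) + 1) := by
      rw [whiskerLeft_comp, whiskerLeft_powCast]
    rw [e] at h
    refine h.trans ?_
    rw [powJoin_succ, Category.assoc]

/-- The two products `X^{⊗ n} ⊗ X^{⊗ m}` and `X^{⊗ m} ⊗ X^{⊗ n}` differ by a permutation of the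
factors. Only the existence of this permutation matters, because it is absorbed by `symSum`. -/
lemma powJoin_comm_perm (X : D) (n m : ℕ) : ∃ g : Equiv.Perm (Fin (m + n)),
    powJoin X n m = (β_ _ _).hom ≫ powJoin X m n ≫ powCast X (Nat.add_comm n m) ≫
      permMap X (m + n) g := by
  induction n with
  | zero =>
    refine ⟨1, ?_⟩
    rw [permMap_one, Category.comp_id, powJoin_zero_right, powJoin_zero, Category.assoc,
      powCast_trans, powCast_rfl, Category.comp_id]
    exact (braiding_rightUnitor _).symm
  | succ n ih =>
    obtain ⟨g, hg⟩ := ih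
    let c : Fin (n + m + 1) := ⟨m, by omega⟩
    have hc := moveTop_eq_permMap X c
    have hc' : moveTop X (n + m + 1) m ≫ permMap X (n + m + 1) c.cycleRange = 𝟙 _ := by
      change moveTop X (n + m + 1) c ≫ _ = _
      rw [hc, ← permMap_mul]
      convert permMap_one X _
      ext; simp
    have h1 : X ◁ powJoin X m n = (α_ X (tensorPow X m) (tensorPow X n)).inv ≫
        (β_ X (tensorPow X m)).hom ▷ tensorPow X n ≫ (α_ (tensorPow X m) X (tensorPow X n)).hom ≫
        powJoin X m (n + 1) ≫ powCast X (by omega) ≫ permMap X (n + m + 1) c.cycleRange := by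
      have := (α_ X (tensorPow X m) (tensorPow X n)).inv ≫=
        powJoin_moveTop X m n =≫ permMap X (n + m + 1) c.cycleRange
      simp only [Category.assoc, Iso.inv_hom_id_assoc] at this
      rwa [hc', Category.comp_id] at this
    have cast : ∀ {a b : ℕ} (h : a = b) (g : Equiv.Perm (Fin a)), ∃ g' : Equiv.Perm (Fin b),
        permMap X a g ≫ powCast X h = powCast X h ≫ permMap X b g' := by
      rintro a b rfl g
      exact ⟨g, by simp⟩
    obtain ⟨g', hg'⟩ := cast (show n + m + 1 = m + (n + 1) by omega) c.cycleRange
    refine ⟨Equiv.Perm.decomposeFin.symm (0, g) * g', ?_⟩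
    rw [permMap_mul, powJoin_succ, hg]
    simp only [whiskerLeft_comp]
    rw [h1, tail_permMap, whiskerLeft_powCast]
    simp only [Category.assoc]
    rw [reassoc_of% hg', reassoc_of% (powCast_trans X (a := n + 1 + m)),
      BraidedCategory.braiding_tensor_left_hom]
    simp only [Category.assoc]
    rfl

variable [Preadditive D]

/-- A permutation `g` of `{0, …, n}` is given by `g 0` and a permutation of `{1, …, n}`. -/
def headTail (n : ℕ) : Fin (n + 1) × Equiv.Perm (Fin n) ≃ Equiv.Perm (Fin (n + 1)) where
  toFun x := x.1.cycleRange.symm * Equiv.Perm.decomposeFin.symm (0, x.2)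
  invFun g := (g 0, permTail g)
  left_inv x := by
    have h0 : (x.1.cycleRange.symm * Equiv.Perm.decomposeFin.symm (0, x.2)) 0 = x.1 := by
      simp
    refine Prod.ext h0 ?_
    change permTail _ = _
    rw [permTail, h0, ← mul_assoc]
    have : x.1.cycleRange * x.1.cycleRange.symm = 1 := by ext; simp
    rw [this, one_mul, Equiv.apply_symm_apply]
  right_inv g := (perm_eq_mul g).symm

/-- The sum of all permutations of the factors of the tensor power. -/
def symSum (X : D) (n : ℕ) : tensorPow X n ⟶ tensorPow X n :=
  ∑ g : Equiv.Perm (Fin n), permMap X n g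

@[simp]
lemma permMap_symSum (X : D) (n : ℕ) (g : Equiv.Perm (Fin n)) :
    permMap X n g ≫ symSum X n = symSum X n := by
  rw [symSum, Preadditive.comp_sum]
  simp_rw [← permMap_mul]
  exact Equiv.sum_comp (Equiv.mulRight g) (permMap X n)

@[simp]
lemma symSum_permMap (X : D) (n : ℕ) (g : Equiv.Perm (Fin n)) :
    symSum X n ≫ permMap X n g = symSum X n := by
  rw [symSum, Preadditive.sum_comp]
  simp_rw [← permMap_mul]
  exact Equiv.sum_comp (Equiv.mulLeft g) (permMap X n)

lemma symSum_symSum (X : D) (n : ℕ) : symSum X n ≫ symSum X n = n.factorial • symSum X n := by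
  conv_lhs => lhs; rw [symSum]
  rw [Preadditive.sum_comp]
  simp [Fintype.card_perm]

lemma powMap_symSum {X Y : D} (f : X ⟶ Y) (n : ℕ) :
    powMap f n ≫ symSum Y n = symSum X n ≫ powMap f n := by
  rw [symSum, symSum, Preadditive.comp_sum, Preadditive.sum_comp]
  simp_rw [permMap_powMap]

lemma powJoin_symSum_left (X : D) (n m : ℕ) (g : Equiv.Perm (Fin n)) :
    permMap X n g ▷ tensorPow X m ≫ powJoin X n m ≫ symSum X (m + n) =
      powJoin X n m ≫ symSum X (m + n) := by
  induction g using perm_induction with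
  | one => rw [permMap_one, id_whiskerRight, Category.id_comp]
  | mul g h hg hh => rw [permMap_mul, comp_whiskerRight, Category.assoc, hg, hh]
  | swap i hi =>
    rw [permMap_swap X i hi, ← Category.assoc, adjSwap_powJoin_left X n m i hi, Category.assoc,
      ← permMap_swap X (n := m + n) i (by omega), permMap_symSum]

lemma powJoin_comm (X : D) (n m : ℕ) :
    powJoin X n m ≫ symSum X (m + n) =
      (β_ _ _).hom ≫ powJoin X m n ≫ powCast X (Nat.add_comm n m) ≫ symSum X (m + n) := by
  obtain ⟨g, hg⟩ := powJoin_comm_perm X n m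
  conv_lhs => rw [hg]
  simp

variable [MonoidalPreadditive D]

lemma symSum_succ (X : D) (n : ℕ) : symSum X (n + 1) =
    X ◁ symSum X n ≫ ∑ p : Fin (n + 1), moveTop X (n + 1) p := by
  rw [symSum, ← Equiv.sum_comp (headTail n), Fintype.sum_prod_type, Finset.sum_comm,
    Preadditive.comp_sum]
  rw [symSum]
  simp_rw [whiskerLeft_sum, Preadditive.sum_comp]
  rw [Finset.sum_comm]
  refine Finset.sum_congr rfl fun p _ => Finset.sum_congr rfl fun h _ => ?_
  exact permMap_mul_eq X p h

lemma symSum_powJoin_left (X : D) (n m : ℕ) :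
    symSum X n ▷ tensorPow X m ≫ powJoin X n m ≫ symSum X (m + n) =
      n.factorial • (powJoin X n m ≫ symSum X (m + n)) := by
  rw [symSum, sum_whiskerRight, Preadditive.sum_comp]
  simp [powJoin_symSum_left, Fintype.card_perm]

end SymSum

/-! ### Powers of functionals and of points -/

section FunPow

universe v₁ u₁

variable {D : Type u₁} [Category.{v₁} D] [MonoidalCategory D]

/-- The functional `y ⊗ ⋯ ⊗ y` on a tensor power. -/
def funPow {X : D} (y : X ⟶ 𝟙_ D) : (n : ℕ) → (tensorPow X n ⟶ 𝟙_ D)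
  | 0 => 𝟙 _
  | n + 1 => y ▷ tensorPow X n ≫ (λ_ _).hom ≫ funPow y n

/-- The point `x ⊗ ⋯ ⊗ x` of a tensor power. -/
def elemPow {X : D} (x : 𝟙_ D ⟶ X) : (n : ℕ) → (𝟙_ D ⟶ tensorPow X n)
  | 0 => 𝟙 _
  | n + 1 => elemPow x n ≫ (λ_ _).inv ≫ x ▷ tensorPow X n

lemma funPow_succ {X : D} (y : X ⟶ 𝟙_ D) (n : ℕ) :
    funPow y (n + 1) = y ▷ tensorPow X n ≫ (λ_ _).hom ≫ funPow y n := rfl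

lemma elemPow_succ {X : D} (x : 𝟙_ D ⟶ X) (n : ℕ) :
    elemPow x (n + 1) = elemPow x n ≫ (λ_ _).inv ≫ x ▷ tensorPow X n := rfl

lemma powMap_funPow {X Y : D} (f : X ⟶ Y) (y : Y ⟶ 𝟙_ D) (n : ℕ) :
    powMap f n ≫ funPow y n = funPow (f ≫ y) n := by
  induction n with
  | zero => exact Category.id_comp _
  | succ n ih =>
    rw [powMap_succ, funPow_succ, funPow_succ, ← ih, Category.assoc, whisker_exchange_assoc]
    simp

lemma elemPow_powMap {X Y : D} (x : 𝟙_ D ⟶ X) (f : X ⟶ Y) (n : ℕ) :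
    elemPow x n ≫ powMap f n = elemPow (x ≫ f) n := by
  induction n with
  | zero => exact Category.id_comp _
  | succ n ih =>
    rw [powMap_succ, elemPow_succ, elemPow_succ, ← ih]
    simp only [comp_whiskerRight, Category.assoc]
    rw [← whisker_exchange, ← whisker_exchange_assoc, ← leftUnitor_inv_naturality_assoc]

lemma elemPow_funPow {X : D} (x : 𝟙_ D ⟶ X) (y : X ⟶ 𝟙_ D) (d : End (𝟙_ D)) (h : x ≫ y = d)
    (n : ℕ) : elemPow x n ≫ funPow y n = (d ^ n : End (𝟙_ D)) := by
  induction n with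
  | zero => exact Category.id_comp _
  | succ n ih =>
    rw [pow_succ', ← ih, End.mul_def, ← h, elemPow_succ, funPow_succ]
    have : ∀ (T : D) (a : 𝟙_ D ⟶ T) (b : T ⟶ 𝟙_ D),
        (a ≫ (λ_ _).inv ≫ x ▷ T) ≫ y ▷ T ≫ (λ_ _).hom ≫ b = (a ≫ b) ≫ x ≫ y := by
      intro T a b
      simp only [Category.assoc, ← comp_whiskerRight_assoc]
      rw [← leftUnitor_naturality, ← whisker_exchange_assoc, ← leftUnitor_inv_naturality_assoc,
        unitors_equal, rightUnitor_naturality, unitors_inv_equal, Iso.inv_hom_id_assoc]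
    exact this _ _ _

variable [SymmetricCategory D]

/-- A power of a functional is symmetric: the unit has the trivial commutativity constraint. -/
lemma permMap_funPow {X : D} (y : X ⟶ 𝟙_ D) (n : ℕ) (g : Equiv.Perm (Fin n)) :
    permMap X n g ≫ funPow y n = funPow y n := by
  have key : ∀ m i, adjSwap X m i ≫ funPow y m = funPow y m := by
    intro m
    induction m with
    | zero => exact fun i => Category.id_comp _
    | succ m ih =>
      intro i
      cases i with
      | zero =>
        cases m with
        | zero => exact Category.id_comp _
        | succ m =>
          have : ∀ (T : D), ((α_ X X T).inv ≫ (β_ X X).hom ▷ T ≫ (α_ X X T).hom) ≫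
              y ▷ (X ⊗ T) ≫ (λ_ _).hom ≫ y ▷ T ≫ (λ_ _).hom =
              y ▷ (X ⊗ T) ≫ (λ_ _).hom ≫ y ▷ T ≫ (λ_ _).hom := by
            intro T
            have h : (β_ X X).hom ≫ y ▷ X ≫ (λ_ _).hom ≫ y = y ▷ X ≫ (λ_ _).hom ≫ y := by
              have h1 : y ▷ X ≫ (λ_ X).hom ≫ y = y ▷ X ≫ 𝟙_ D ◁ y ≫ (λ_ _).hom := by
                rw [leftUnitor_naturality]
              have h2 : y ▷ X ≫ 𝟙_ D ◁ y ≫ (λ_ _).hom = X ◁ y ≫ y ▷ 𝟙_ D ≫ (λ_ _).hom := by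
                rw [whisker_exchange_assoc]
              rw [h1, ← BraidedCategory.braiding_naturality_right_assoc,
                ← BraidedCategory.braiding_naturality_left_assoc, braiding_leftUnitor, h2,
                unitors_equal]
            have e : y ▷ (X ⊗ T) ≫ (λ_ _).hom ≫ y ▷ T =
                (α_ X X T).inv ≫ (y ▷ X ≫ (λ_ _).hom ≫ y) ▷ T := by
              simp
            have h' := congrArg (fun f => (α_ X X T).inv ≫ f ▷ T ≫ (λ_ _).hom) h
            simp only [comp_whiskerRight, Category.assoc] at h'
            simp only [Category.assoc]
            simpa using h'
          have h2 := this (tensorPow X m) =≫ funPow y m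
          simp only [Category.assoc] at h2
          simpa [adjSwap_zero, swapTop, funPow_succ] using h2
      | succ i =>
        rw [adjSwap_succ]
        change X ◁ adjSwap X m i ≫ y ▷ _ ≫ (λ_ _).hom ≫ funPow y m = _
        rw [whisker_exchange_assoc, leftUnitor_naturality_assoc, ih]
        rfl
  induction g using perm_induction with
  | one => rw [permMap_one, Category.id_comp]
  | mul g h hg hh => rw [permMap_mul, Category.assoc, hg, hh]
  | swap i hi => rw [permMap_swap X i hi, key]

/-- A power of a point is symmetric, because permutations act trivially on powers of the unit. -/
lemma elemPow_permMap {X : D} (x : 𝟙_ D ⟶ X) (n : ℕ) (g : Equiv.Perm (Fin n)) :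
    elemPow x n ≫ permMap X n g = elemPow x n := by
  have h : permMap (𝟙_ D) n g = 𝟙 _ := by
    have hi : ∀ m, IsIso (funPow (𝟙 (𝟙_ D)) m) := by
      intro m
      induction m with
      | zero => exact inferInstanceAs (IsIso (𝟙 _))
      | succ m ih => rw [funPow_succ]; infer_instance
    have := hi n
    rw [← cancel_mono (funPow (𝟙 (𝟙_ D)) n), permMap_funPow, Category.id_comp]
  rw [← Category.id_comp x, ← elemPow_powMap, Category.assoc, permMap_powMap, h,
    Category.id_comp]

/-- A power of a point of a dual determines the power of the corresponding functional. -/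
lemma funPow_eq_elemPow_comp {Y Y' : D} (p : Y ⊗ Y' ⟶ 𝟙_ D) (w : 𝟙_ D ⟶ Y') (n : ℕ) :
    ∃ K : tensorPow Y n ⊗ tensorPow Y' n ⟶ 𝟙_ D,
      funPow ((ρ_ Y).inv ≫ Y ◁ w ≫ p) n =
        (ρ_ _).inv ≫ tensorPow Y n ◁ elemPow w n ≫ K := by
  induction n with
  | zero =>
    refine ⟨(λ_ (𝟙_ D)).hom, ?_⟩
    change 𝟙 (𝟙_ D) = (ρ_ (𝟙_ D)).inv ≫ 𝟙_ D ◁ 𝟙 (𝟙_ D) ≫ (λ_ (𝟙_ D)).hom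
    simp [unitors_equal]
  | succ n ih =>
    obtain ⟨K, hK⟩ := ih
    have : ∀ {T T' : D} (a : 𝟙_ D ⟶ T') (K : T ⊗ T' ⟶ 𝟙_ D),
        ((ρ_ Y).inv ≫ Y ◁ w ≫ p) ▷ T ≫ (λ_ _).hom ≫ (ρ_ _).inv ≫ T ◁ a ≫ K =
        (ρ_ _).inv ≫ (Y ⊗ T) ◁ (a ≫ (λ_ _).inv ≫ w ▷ T') ≫ (α_ Y T (Y' ⊗ T')).hom ≫
          Y ◁ ((α_ T Y' T').inv ≫ (β_ T Y').hom ▷ T' ≫ (α_ Y' T T').hom ≫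
            Y' ◁ K ≫ (ρ_ Y').hom) ≫ p := by
      intro T T' a K
      have e1 : T ◁ (a ≫ (λ_ _).inv ≫ w ▷ T') ≫ (α_ T Y' T').inv ≫ (β_ T Y').hom ▷ T' ≫
          (α_ Y' T T').hom ≫ Y' ◁ K ≫ (ρ_ Y').hom =
          T ◁ a ≫ K ≫ w := by
        have e2 : T ◁ w ▷ T' ≫ (α_ T Y' T').inv ≫ (β_ T Y').hom ▷ T' ≫ (α_ Y' T T').hom =
            (α_ T _ T').inv ≫ (β_ T (𝟙_ D)).hom ▷ T' ≫ (α_ _ T T').hom ≫ w ▷ (T ⊗ T') := by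
          rw [associator_inv_naturality_middle_assoc, ← comp_whiskerRight_assoc,
            BraidedCategory.braiding_naturality_right, comp_whiskerRight_assoc,
            associator_naturality_left]
        rw [whiskerLeft_comp, whiskerLeft_comp]
        simp only [Category.assoc]
        rw [reassoc_of% e2, ← whisker_exchange_assoc, rightUnitor_naturality]
        simp [← unitors_equal]
      rw [associator_naturality_right_assoc, ← whiskerLeft_comp_assoc, e1, ← leftUnitor_naturality,
        ← whisker_exchange_assoc]
      simp [unitors_equal]
    exact ⟨_, by rw [funPow_succ, hK, elemPow_succ]; exact this _ _⟩

end FunPow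

/-! ### Tensor powers and braided functors -/

section Functors

universe v₁ u₁ v₂ u₂

variable {D : Type u₁} [Category.{v₁} D] [MonoidalCategory D]
  {E : Type u₂} [Category.{v₂} E] [MonoidalCategory E] (F : D ⥤ E) [F.Monoidal]

open Functor.LaxMonoidal Functor.OplaxMonoidal

/-- The comparison of tensor powers under a monoidal functor. -/
def powCmp (X : D) : (n : ℕ) → (tensorPow (F.obj X) n ≅ F.obj (tensorPow X n))
  | 0 => Functor.Monoidal.εIso F
  | n + 1 => whiskerLeftIso (F.obj X) (powCmp X n) ≪≫ Functor.Monoidal.μIso F X (tensorPow X n)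

lemma powCmp_succ_hom (X : D) (n : ℕ) : (powCmp F X (n + 1)).hom =
    F.obj X ◁ (powCmp F X n).hom ≫ μ F X (tensorPow X n) := rfl

lemma powMap_powCmp {X Y : D} (f : X ⟶ Y) (n : ℕ) :
    powMap (F.map f) n ≫ (powCmp F Y n).hom = (powCmp F X n).hom ≫ F.map (powMap f n) := by
  induction n with
  | zero =>
    exact (Category.id_comp _).trans ((Category.comp_id _).symm.trans
      (congrArg _ (F.map_id (𝟙_ D)).symm))
  | succ n ih =>
    rw [powMap_succ, powMap_succ, powCmp_succ_hom, powCmp_succ_hom, F.map_comp]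
    simp only [Category.assoc, ← μ_natural_left_assoc, ← μ_natural_right]
    rw [← whiskerLeft_comp_assoc, ih, whiskerLeft_comp_assoc, whisker_exchange_assoc]

lemma elemPow_powCmp {X : D} (x : 𝟙_ D ⟶ X) (n : ℕ) :
    elemPow (ε F ≫ F.map x) n ≫ (powCmp F X n).hom = ε F ≫ F.map (elemPow x n) := by
  induction n with
  | zero => simp [elemPow, powCmp]
  | succ n ih =>
    rw [powCmp_succ_hom, elemPow_succ, elemPow_succ, F.map_comp, F.map_comp]
    rw [← reassoc_of% ih, Functor.Monoidal.map_leftUnitor_inv]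
    simp only [Category.assoc, comp_whiskerRight, ← μ_natural_left]
    rw [← whisker_exchange_assoc, ← whisker_exchange_assoc, ← leftUnitor_inv_naturality_assoc]

variable [SymmetricCategory D] [SymmetricCategory E]

/-- The comparison of tensor powers under a braided functor is equivariant; it suffices to check
this for the simple transpositions. -/
lemma permMap_powCmp {F : D ⥤ E} [F.Braided] (X : D) (n : ℕ) (g : Equiv.Perm (Fin n)) :
    permMap (F.obj X) n g ≫ (powCmp F X n).hom =
      (powCmp F X n).hom ≫ F.map (permMap X n g) := by
  have key : ∀ m i, adjSwap (F.obj X) m i ≫ (powCmp F X m).hom =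
      (powCmp F X m).hom ≫ F.map (adjSwap X m i) := by
    intro m
    induction m with
    | zero => intro i; simp [adjSwap]
    | succ m ih =>
      intro i
      cases i with
      | zero =>
        cases m with
        | zero => simp [adjSwap]
        | succ m =>
          have : ∀ {T : D} {U : E} (f : U ⟶ F.obj T),
              ((α_ (F.obj X) (F.obj X) U).inv ≫ (β_ (F.obj X) (F.obj X)).hom ▷ U ≫
                (α_ (F.obj X) (F.obj X) U).hom) ≫ F.obj X ◁ (F.obj X ◁ f ≫ μ F X T) ≫
                μ F X (X ⊗ T) = (F.obj X ◁ (F.obj X ◁ f ≫ μ F X T) ≫ μ F X (X ⊗ T)) ≫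
                F.map ((α_ X X T).inv ≫ (β_ X X).hom ▷ T ≫ (α_ X X T).hom) := by
            intro T U f
            have h1 : (α_ (F.obj X) (F.obj X) (F.obj T)).hom ≫ F.obj X ◁ μ F X T ≫
                μ F X (X ⊗ T) = μ F X X ▷ F.obj T ≫ μ F (X ⊗ X) T ≫ F.map (α_ X X T).hom :=
              (Functor.LaxMonoidal.associativity F X X T).symm
            have h2 : (β_ (F.obj X) (F.obj X)).hom ≫ μ F X X = μ F X X ≫ F.map (β_ X X).hom :=
              (Functor.LaxBraided.braided X X).symm
            have h3 : F.obj X ◁ F.obj X ◁ f = (α_ (F.obj X) (F.obj X) U).inv ≫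
                (F.obj X ⊗ F.obj X) ◁ f ≫ (α_ (F.obj X) (F.obj X) (F.obj T)).hom := by simp
            simp only [whiskerLeft_comp, Category.assoc]
            rw [h3]
            simp only [Category.assoc, Iso.hom_inv_id_assoc]
            rw [h1, ← whisker_exchange_assoc, ← comp_whiskerRight_assoc, h2,
              comp_whiskerRight_assoc, μ_natural_left_assoc, ← F.map_comp,
              reassoc_of% h1, ← F.map_comp, Iso.hom_inv_id_assoc]
          exact this _
      | succ i =>
        rw [adjSwap_succ, adjSwap_succ]
        change F.obj X ◁ adjSwap (F.obj X) m i ≫ F.obj X ◁ (powCmp F X m).hom ≫ μ F _ _ =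
          (F.obj X ◁ (powCmp F X m).hom ≫ μ F _ _) ≫ F.map (X ◁ adjSwap X m i)
        rw [Category.assoc, ← μ_natural_right, ← whiskerLeft_comp_assoc, ih,
          whiskerLeft_comp_assoc]
  induction g using perm_induction with
  | one => simp [permMap_one]
  | mul g h hg hh => rw [permMap_mul, permMap_mul, Category.assoc, hg, reassoc_of% hh, F.map_comp]
  | swap i hi => rw [permMap_swap _ i hi, permMap_swap _ i hi, key]

end Functors

/-! ### Divisible units and exactness -/

/-- Positive integers act invertibly on all morphisms of a preadditive monoidal category, because
they are invertible in the ring of endomorphisms of the unit. -/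
class DivisibleUnit (D : Type*) [Category* D] [MonoidalCategory D] [Preadditive D] : Prop where
  exists_nsmul_eq_id : ∀ n : ℕ, n ≠ 0 → ∃ c : 𝟙_ D ⟶ 𝟙_ D, n • c = 𝟙 _

section Divisible

variable {D : Type*} [Category* D] [MonoidalCategory D] [Preadditive D] [MonoidalPreadditive D]

lemma nsmul_whiskerRight (n : ℕ) {V W : D} (f : V ⟶ W) (Z : D) :
    (n • f) ▷ Z = n • f ▷ Z :=
  (tensoringRight D |>.obj Z).map_nsmul

variable [DivisibleUnit D]

lemma exists_nsmul_eq {n : ℕ} (hn : n ≠ 0) {V W : D} (f : V ⟶ W) : ∃ g : V ⟶ W, n • g = f := by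
  obtain ⟨c, hc⟩ := DivisibleUnit.exists_nsmul_eq_id (D := D) n hn
  refine ⟨(λ_ V).inv ≫ c ▷ V ≫ (λ_ V).hom ≫ f, ?_⟩
  rw [← Preadditive.comp_nsmul, ← Preadditive.nsmul_comp, ← nsmul_whiskerRight, hc,
    id_whiskerRight, Category.id_comp, Iso.inv_hom_id_assoc]

lemma eq_zero_of_nsmul_eq_zero {n : ℕ} (hn : n ≠ 0) {V W : D} {f : V ⟶ W} (h : n • f = 0) :
    f = 0 := by
  obtain ⟨c, hc⟩ := exists_nsmul_eq hn (𝟙 V)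
  rw [← Category.id_comp f, ← hc, Preadditive.nsmul_comp, ← Preadditive.comp_nsmul, h,
    Limits.comp_zero]

end Divisible

/-- A functor from an abelian category to a preadditive monoidal category sends cokernels to
cokernels, and so do its compositions with tensoring by an object, as far as morphisms to the
unit can tell. -/
structure PreservesCokernels {C : Type*} [Category* C] [Abelian C] {D : Type*} [Category* D]
    [MonoidalCategory D] [Preadditive D] (F : C ⥤ D) : Prop where
  exists_desc : ∀ {P Q : C} (p : P ⟶ Q) (T : D) (g : F.obj Q ⊗ T ⟶ 𝟙_ D),
    F.map p ▷ T ≫ g = 0 → ∃ h, F.map (cokernel.π p) ▷ T ≫ h = g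
  eq_zero : ∀ {P Q : C} (p : P ⟶ Q) (T : D) (h : F.obj (cokernel p) ⊗ T ⟶ 𝟙_ D),
    F.map (cokernel.π p) ▷ T ≫ h = 0 → h = 0

namespace PreservesCokernels

variable {C : Type*} [Category* C] [Abelian C] {D : Type*} [Category* D]
    [MonoidalCategory D] [Preadditive D] [MonoidalPreadditive D]

omit [Preadditive D] [MonoidalPreadditive D] in
lemma tensorRightHomEquiv_whiskerRight {X X' Y Y' Z : D} [ExactPairing Y Y'] (f : X ⟶ X')
    (g : X' ⊗ Y ⟶ Z) : tensorRightHomEquiv X Y Y' Z (f ▷ Y ≫ g) =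
      f ≫ tensorRightHomEquiv X' Y Y' Z g := by
  rw [← Equiv.eq_symm_apply, tensorRightHomEquiv_symm_naturality,
    Equiv.symm_apply_apply]

lemma tensorRightHomEquiv_symm_zero {X Y Y' Z : D} [ExactPairing Y Y'] :
    (tensorRightHomEquiv X Y Y' Z).symm 0 = 0 := by
  simp [tensorRightHomEquiv]

lemma tensorRightHomEquiv_zero {X Y Y' Z : D} [ExactPairing Y Y'] :
    tensorRightHomEquiv X Y Y' Z 0 = 0 := by
  simp [tensorRightHomEquiv]

/-- An abelian rigid category has this property itself, as tensoring by an object has a right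
adjoint. -/
lemma id {C : Type*} [Category* C] [Abelian C] [MonoidalCategory C] [MonoidalPreadditive C]
    [RightRigidCategory C] : PreservesCokernels (𝟭 C) where
  exists_desc {P Q} p T g h := by
    have : ∀ (g : Q ⊗ T ⟶ 𝟙_ C), p ▷ T ≫ g = 0 → ∃ h, cokernel.π p ▷ T ≫ h = g := by
      intro g h
      let e := fun X => tensorRightHomEquiv X T (Tᘁ) (𝟙_ C)
      have h' : p ≫ e Q g = 0 := by
        rw [← tensorRightHomEquiv_whiskerRight, h, tensorRightHomEquiv_zero]
      refine ⟨(e _).symm (cokernel.desc p (e Q g) h'), ?_⟩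
      rw [← tensorRightHomEquiv_symm_naturality, cokernel.π_desc, Equiv.symm_apply_apply]
    exact this g h
  eq_zero {P Q} p T h hh := by
    have : ∀ (h : cokernel p ⊗ T ⟶ 𝟙_ C), cokernel.π p ▷ T ≫ h = 0 → h = 0 := by
      intro h hh
      let e := fun X => tensorRightHomEquiv X T (Tᘁ) (𝟙_ C)
      apply (e (cokernel p)).injective
      rw [← cancel_epi (cokernel.π p), ← tensorRightHomEquiv_whiskerRight, hh]
      simp only [e, tensorRightHomEquiv_zero, Limits.comp_zero]
    exact this h hh

variable [RightRigidCategory D] [SymmetricCategory D] {F : C ⥤ D} (hF : PreservesCokernels F)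
include hF

/-- Duality moves the target into the second factor, so what holds for morphisms to the unit holds
for morphisms to all objects. -/
lemma exists_desc' {P Q : C} (p : P ⟶ Q) {T W : D} (g : F.obj Q ⊗ T ⟶ W)
    (hg : F.map p ▷ T ≫ g = 0) : ∃ h, F.map (cokernel.π p) ▷ T ≫ h = g := by
  let _ := BraidedCategory.exactPairing_swap W Wᘁ
  let e := fun X => tensorRightHomEquiv X (Wᘁ) W (𝟙_ D)
  obtain ⟨h, hh⟩ := hF.exists_desc p (T ⊗ Wᘁ)
    ((α_ _ _ _).inv ≫ (e (F.obj Q ⊗ T)).symm (g ≫ (λ_ W).inv)) (by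
      rw [associator_inv_naturality_left_assoc, ← tensorRightHomEquiv_symm_naturality,
        reassoc_of% hg, Limits.zero_comp, tensorRightHomEquiv_symm_zero, Limits.comp_zero])
  refine ⟨e _ ((α_ _ _ _).hom ≫ h) ≫ (λ_ W).hom, ?_⟩
  rw [← Category.assoc, ← tensorRightHomEquiv_whiskerRight, associator_naturality_left_assoc, hh,
    Iso.hom_inv_id_assoc, Equiv.apply_symm_apply, Category.assoc, Iso.inv_hom_id,
    Category.comp_id]

lemma eq_zero' {P Q : C} (p : P ⟶ Q) {T W : D} (h : F.obj (cokernel p) ⊗ T ⟶ W)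
    (hh : F.map (cokernel.π p) ▷ T ≫ h = 0) : h = 0 := by
  let _ := BraidedCategory.exactPairing_swap W Wᘁ
  let e := fun X => tensorRightHomEquiv X (Wᘁ) W (𝟙_ D)
  have := hF.eq_zero p (T ⊗ Wᘁ) ((α_ _ _ _).inv ≫ (e _).symm (h ≫ (λ_ W).inv)) (by
      rw [associator_inv_naturality_left_assoc, ← tensorRightHomEquiv_symm_naturality,
        reassoc_of% hh, Limits.zero_comp, tensorRightHomEquiv_symm_zero, Limits.comp_zero])
  rw [Iso.inv_comp_eq, Limits.comp_zero, ← tensorRightHomEquiv_symm_zero (Z := 𝟙_ D) (Y' := W),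
    (e _).symm.apply_eq_iff_eq, Iso.comp_inv_eq, Limits.zero_comp] at this
  exact this

end PreservesCokernels

namespace LaxAlg

variable {D : Type u} [SmallCategory D] [MonoidalCategory D] [SymmetricCategory D]
    [Preadditive D]

/-- A presheaf-algebra `A` that sends the cokernels that come from an abelian category to
kernels. -/
structure LeftExactOn (A : LaxAlg D) {C : Type*} [Category* C] [Abelian C] (F : C ⥤ D) : Prop where
  exists_desc : ∀ {P Q : C} (p : P ⟶ Q) (T : D) (a : A.obj (F.obj Q ⊗ T)),
    A.map (F.map p ▷ T) a = 0 → ∃ b, A.map (F.map (cokernel.π p) ▷ T) b = a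
  eq_zero : ∀ {P Q : C} (p : P ⟶ Q) (T : D) (b : A.obj (F.obj (cokernel p) ⊗ T)),
    A.map (F.map (cokernel.π p) ▷ T) b = 0 → b = 0

variable [RightRigidCategory D]

instance [MonoidalPreadditive D] (A : LaxAlg D) [DivisibleUnit D] : DivisibleUnit A.Free where
  exists_nsmul_eq_id n hn := by
    obtain ⟨c, hc⟩ := DivisibleUnit.exists_nsmul_eq_id (D := D) n hn
    exact ⟨(Free.free A).map c, ((Free.free A).map_nsmul (f := c) (n := n)).symm.trans
      ((congrArg (Free.free A).map hc).trans ((Free.free A).map_id _))⟩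

open Free in
/-- The morphisms from a free module on `V` to the unit are the `V`-points of `A`. -/
lemma LeftExactOn.preservesCokernels {A : LaxAlg D} {C : Type*} [Category* C] [Abelian C]
    {F : C ⥤ D} (hA : A.LeftExactOn F) : PreservesCokernels (F ⋙ free A) where
  exists_desc {P Q} p T g hg := by
    obtain ⟨T⟩ := T
    have : ∀ (V V' : D) (u : V ⟶ V') (g : (⟨V'⟩ : A.Free) ⟶ ⟨𝟙_ D⟩),
        fr A u ≫ g = ofPoint (A.map u (toPoint g)) := by
      intro V V' u g
      rw [← fr_ofPoint, ofPoint_toPoint]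
    have e : ∀ {Q' : C} (f : Q' ⟶ Q), (F ⋙ free A).map f ▷ (⟨T⟩ : A.Free) ≫ g =
        ofPoint (A.map (F.map f ▷ T) (toPoint (V := F.obj Q ⊗ T) g)) := by
      intro Q' f
      exact (congrArg (· ≫ g) (wr_fr (F.map f) T)).trans (this _ _ _ _)
    rw [e, ← ofPoint_zero] at hg
    obtain ⟨b, hb⟩ := hA.exists_desc p T _ (ofPoint_injective hg)
    refine ⟨ofPoint b, ?_⟩
    refine (congrArg (· ≫ ofPoint b) (wr_fr (F.map (cokernel.π p)) T)).trans ?_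
    refine (fr_ofPoint _ _).trans ?_
    rw [hb]
    exact ofPoint_toPoint _
  eq_zero {P Q} p T h hh := by
    obtain ⟨T⟩ := T
    have : ∀ (V V' : D) (u : V ⟶ V') (g : (⟨V'⟩ : A.Free) ⟶ ⟨𝟙_ D⟩),
        fr A u ≫ g = 0 → A.map u (toPoint g) = 0 := by
      intro V V' u g h
      rw [← ofPoint_toPoint g, fr_ofPoint, ← ofPoint_zero] at h
      exact ofPoint_injective h
    have := hA.eq_zero p T _ (this _ _ (F.map (cokernel.π p) ▷ T) h
      ((congrArg (· ≫ h) (wr_fr (F.map (cokernel.π p)) T)).symm.trans hh))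
    refine (ofPoint_toPoint (V := F.obj (cokernel p) ⊗ T) h).symm.trans ?_
    rw [this, ofPoint_zero]

end LaxAlg

/-! ### The symmetric algebra of an object -/

section PowMul

universe v₁ u₁

variable {D : Type u₁} [Category.{v₁} D] [MonoidalCategory D] [Preadditive D] (X : D)

/-- The canonical morphism `X^{⊗ a} ⊗ X^{⊗ b} ⟶ X^{⊗ n}`, for `a + b = n`
(and zero for other exponents). -/
def powMul (a b n : ℕ) : tensorPow X a ⊗ tensorPow X b ⟶ tensorPow X n :=
  if h : b + a = n then powJoin X a b ≫ powCast X h else 0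

lemma powMul_eq (a b : ℕ) : powMul X a b (b + a) = powJoin X a b := by simp [powMul]

lemma powMul_zero (n : ℕ) : powMul X 0 n n = (λ_ (tensorPow X n)).hom := powMul_eq X 0 n

lemma powMul_assoc {a b c s t n : ℕ} (h₁ : a + b = s) (h₂ : s + c = n) (h₃ : b + c = t) :
    powMul X a b s ▷ tensorPow X c ≫ powMul X s c n =
      (α_ _ _ _).hom ≫ tensorPow X a ◁ powMul X b c t ≫ powMul X a t n := by
  obtain rfl : s = b + a := by omega
  obtain rfl : n = c + (b + a) := by omega
  obtain rfl : t = c + b := by omega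
  rw [powMul_eq, powMul_eq, powMul_eq, powJoin_assoc, powMul, dif_pos (by omega)]

variable {X}

/-- The product of two families of tensors. -/
def rawMul {V W : D} (f : ∀ n, V ⟶ tensorPow X n) (g : ∀ n, W ⟶ tensorPow X n) (n : ℕ) :
    V ⊗ W ⟶ tensorPow X n :=
  ∑ p ∈ Finset.HasAntidiagonal.antidiagonal n, (f p.1 ⊗ₘ g p.2) ≫ powMul X p.1 p.2 n

variable [MonoidalPreadditive D]

lemma rawMul_add_left {V W : D} (f f' : ∀ n, V ⟶ tensorPow X n) (g : ∀ n, W ⟶ tensorPow X n) :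
    rawMul (f + f') g = rawMul f g + rawMul f' g := by
  funext n
  simp [rawMul, MonoidalPreadditive.add_tensor, Finset.sum_add_distrib]

lemma rawMul_add_right {V W : D} (f : ∀ n, V ⟶ tensorPow X n) (g g' : ∀ n, W ⟶ tensorPow X n) :
    rawMul f (g + g') = rawMul f g + rawMul f g' := by
  funext n
  simp [rawMul, MonoidalPreadditive.tensor_add, Finset.sum_add_distrib]

omit [MonoidalPreadditive D] in
lemma rawMul_comp {V V' W W' : D} (u : V' ⟶ V) (v : W' ⟶ W) (f : ∀ n, V ⟶ tensorPow X n)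
    (g : ∀ n, W ⟶ tensorPow X n) (n : ℕ) :
    rawMul (fun n => u ≫ f n) (fun n => v ≫ g n) n = (u ⊗ₘ v) ≫ rawMul f g n := by
  simp only [rawMul, Preadditive.comp_sum, tensorHom_comp_tensorHom_assoc]

lemma rawMul_assoc {V W Z : D} (f : ∀ n, V ⟶ tensorPow X n) (g : ∀ n, W ⟶ tensorPow X n)
    (h : ∀ n, Z ⟶ tensorPow X n) (n : ℕ) :
    rawMul (rawMul f g) h n = (α_ V W Z).hom ≫ rawMul f (rawMul g h) n := by
  have e1 : rawMul (rawMul f g) h n = ∑ p ∈ Finset.HasAntidiagonal.antidiagonal n,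
      ∑ q ∈ Finset.HasAntidiagonal.antidiagonal p.1, ((f q.1 ⊗ₘ g q.2) ⊗ₘ h p.2) ≫
        powMul X q.1 q.2 p.1 ▷ tensorPow X p.2 ≫ powMul X p.1 p.2 n := by
    refine Finset.sum_congr rfl fun p _ => ?_
    rw [rawMul, sum_tensor, Preadditive.sum_comp]
    refine Finset.sum_congr rfl fun q _ => ?_
    rw [← tensorHom_id, tensorHom_comp_tensorHom_assoc, Category.comp_id]
  have e2 : rawMul f (rawMul g h) n = ∑ p ∈ Finset.HasAntidiagonal.antidiagonal n,
      ∑ q ∈ Finset.HasAntidiagonal.antidiagonal p.2, (f p.1 ⊗ₘ (g q.1 ⊗ₘ h q.2)) ≫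
        tensorPow X p.1 ◁ powMul X q.1 q.2 p.2 ≫ powMul X p.1 p.2 n := by
    refine Finset.sum_congr rfl fun p _ => ?_
    rw [rawMul, tensor_sum, Preadditive.sum_comp]
    refine Finset.sum_congr rfl fun q _ => ?_
    rw [← id_tensorHom, tensorHom_comp_tensorHom_assoc, Category.comp_id]
  rw [e1, e2, Preadditive.comp_sum]
  simp only [Preadditive.comp_sum]
  rw [Finset.sum_sigma', Finset.sum_sigma']
  refine Finset.sum_nbij' (fun x => ⟨(x.2.1, x.2.2 + x.1.2), (x.2.2, x.1.2)⟩)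
    (fun x => ⟨(x.1.1 + x.2.1, x.2.2), (x.1.1, x.2.1)⟩) ?_ ?_ ?_ ?_ ?_
  · rintro ⟨⟨s, c⟩, ⟨a, b⟩⟩ hx
    simp at hx ⊢
    omega
  · rintro ⟨⟨s, c⟩, ⟨a, b⟩⟩ hx
    simp at hx ⊢
    omega
  · rintro ⟨⟨s, c⟩, ⟨a, b⟩⟩ hx
    simp at hx ⊢
    omega
  · rintro ⟨⟨s, c⟩, ⟨a, b⟩⟩ hx
    simp at hx ⊢
    omega
  · rintro ⟨⟨s, c⟩, ⟨a, b⟩⟩ hx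
    simp only [Finset.mem_sigma, Finset.HasAntidiagonal.mem_antidiagonal] at hx
    dsimp only
    rw [powMul_assoc X hx.2 hx.1 rfl, associator_naturality_assoc]

variable [SymmetricCategory D]

omit [MonoidalPreadditive D] in
lemma powMul_symSum (a b n : ℕ) :
    powMul X a b n ≫ symSum X n = (β_ _ _).hom ≫ powMul X b a n ≫ symSum X n := by
  by_cases h : b + a = n
  · subst h
    rw [powMul_eq, powJoin_comm, powMul, dif_pos (by omega), Category.assoc]
  · rw [powMul, dif_neg h, powMul, dif_neg (by omega)]
    simp

omit [MonoidalPreadditive D] in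
lemma rawMul_symSum_comm {V W : D} (f : ∀ n, V ⟶ tensorPow X n) (g : ∀ n, W ⟶ tensorPow X n)
    (n : ℕ) : rawMul f g n ≫ symSum X n = (β_ V W).hom ≫ rawMul g f n ≫ symSum X n := by
  rw [rawMul, rawMul, Preadditive.sum_comp, Preadditive.sum_comp, Preadditive.comp_sum,
    ← Finset.Nat.sum_antidiagonal_swap]
  refine Finset.sum_congr rfl fun p _ => ?_
  simp only [Category.assoc, Prod.fst_swap, Prod.snd_swap]
  rw [powMul_symSum, BraidedCategory.braiding_naturality_assoc]

variable [DivisibleUnit D]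

lemma comp_powMul_symSum_eq_zero {V W : D} (a b n : ℕ) (f : V ⟶ tensorPow X a)
    (g : W ⟶ tensorPow X b) (hf : f ≫ symSum X a = 0) :
    (f ⊗ₘ g) ≫ powMul X a b n ≫ symSum X n = 0 := by
  by_cases h : b + a = n
  · subst h
    refine eq_zero_of_nsmul_eq_zero a.factorial_ne_zero ?_
    rw [powMul_eq, ← Preadditive.comp_nsmul, ← symSum_powJoin_left, MonoidalCategory.tensorHom_def']
    simp only [Category.assoc]
    rw [← comp_whiskerRight_assoc, hf]
    simp
  · simp [powMul, dif_neg h]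

lemma rawMul_symSum_eq_zero {V W : D} (f : ∀ n, V ⟶ tensorPow X n) (g : ∀ n, W ⟶ tensorPow X n)
    (hf : ∀ n, f n ≫ symSum X n = 0) (n : ℕ) : rawMul f g n ≫ symSum X n = 0 := by
  rw [rawMul, Preadditive.sum_comp]
  refine Finset.sum_eq_zero fun p _ => ?_
  rw [Category.assoc, comp_powMul_symSum_eq_zero _ _ _ _ _ (hf _)]

lemma rawMul_symSum_eq_zero' {V W : D} (f : ∀ n, V ⟶ tensorPow X n) (g : ∀ n, W ⟶ tensorPow X n)
    (hg : ∀ n, g n ≫ symSum X n = 0) (n : ℕ) : rawMul f g n ≫ symSum X n = 0 := by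
  rw [rawMul_symSum_comm, rawMul_symSum_eq_zero g f hg, Limits.comp_zero]

end PowMul

section SymAlg

variable {D : Type u} [SmallCategory D] [MonoidalCategory D] [SymmetricCategory D]
    [Preadditive D]

/-- The families of tensors whose symmetrizations vanish. -/
def symRel (X V : D) : AddSubgroup (∀ n, V ⟶ tensorPow X n) where
  carrier := {f | ∀ n, f n ≫ symSum X n = 0}
  add_mem' hf hg n := by
    rw [Pi.add_apply, Preadditive.add_comp, hf n, hg n, add_zero]
  zero_mem' n := Limits.zero_comp
  neg_mem' hf n := by rw [Pi.neg_apply, Preadditive.neg_comp, hf n, neg_zero]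

lemma mem_symRel {X V : D} {f : ∀ n, V ⟶ tensorPow X n} :
    f ∈ symRel X V ↔ ∀ n, f n ≫ symSum X n = 0 := Iff.rfl

/-- The points of the completed symmetric algebra of `X`: families of tensors modulo
the families that become zero under symmetrization. -/
abbrev SymPts (X V : D) : Type u := (∀ n, V ⟶ tensorPow X n) ⧸ symRel X V

/-- The class of a family of tensors. -/
abbrev symMk {X V : D} (f : ∀ n, V ⟶ tensorPow X n) : SymPts X V :=
  QuotientAddGroup.mk f

lemma symMk_eq_iff {X V : D} {f g : ∀ n, V ⟶ tensorPow X n} :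
    (symMk f : SymPts X V) = symMk g ↔ ∀ n, f n ≫ symSum X n = g n ≫ symSum X n := by
  rw [QuotientAddGroup.eq, mem_symRel]
  refine forall_congr' fun n => ?_
  rw [Pi.add_apply, Pi.neg_apply, Preadditive.add_comp, Preadditive.neg_comp,
    neg_add_eq_zero]

/-- Pullback of points of the symmetric algebra. -/
def symPull {X V W : D} (u : V ⟶ W) : SymPts X W →+ SymPts X V :=
  QuotientAddGroup.map _ _
    (AddMonoidHom.mk' (fun f n => u ≫ f n) fun f g =>
      funext fun n => Preadditive.comp_add _ _ _ _ _ _)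
    fun f hf n => by
      change (u ≫ f n) ≫ _ = 0
      rw [Category.assoc, hf n, Limits.comp_zero]

variable [MonoidalPreadditive D] [DivisibleUnit D]

/-- The multiplication of the symmetric algebra. -/
def symMulHom {X V W : D} : SymPts X V →+ SymPts X W →+ SymPts X (V ⊗ W) :=
  QuotientAddGroup.lift _
    (AddMonoidHom.mk' (fun f => QuotientAddGroup.map _ _
      (AddMonoidHom.mk' (fun g => rawMul f g) fun g g' => rawMul_add_right f g g')
      fun g hg n => rawMul_symSum_eq_zero' f g hg n)
      fun f f' => by
        ext g
        exact congrArg symMk (rawMul_add_left f f' g))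
    fun f hf => by
      ext g
      exact symMk_eq_iff.mpr fun n => (rawMul_symSum_eq_zero f g hf n).trans Limits.zero_comp.symm

/-- The completed symmetric algebra of an object. -/
def symAlg (X : D) : LaxAlg D where
  obj := SymPts X
  grp _ := inferInstance
  map := symPull
  map_id := by
    rintro V ⟨a⟩
    exact congrArg symMk (funext fun n => Category.id_comp _)
  map_map := by
    rintro V W Z f g ⟨a⟩
    exact congrArg symMk (funext fun n => (Category.assoc _ _ _).symm)
  map_add' := by
    rintro V W f g ⟨a⟩
    exact congrArg symMk (funext fun n => Preadditive.add_comp _ _ _ _ _ _)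
  one := symMk (Pi.single 0 (𝟙 (𝟙_ D)))
  mul := symMulHom
  mul_map_left := by
    rintro V V' W f ⟨a⟩ ⟨b⟩
    refine congrArg symMk (funext fun n => ?_)
    have := rawMul_comp f (𝟙 W) a b n
    simpa using this
  mul_map_right := by
    rintro V W W' f ⟨a⟩ ⟨b⟩
    refine congrArg symMk (funext fun n => ?_)
    have := rawMul_comp (𝟙 V) f a b n
    simpa using this
  one_mul := by
    rintro V ⟨a⟩
    refine congrArg symMk (funext fun n => ?_)
    change rawMul (Pi.single 0 (𝟙 (𝟙_ D))) a n = (λ_ V).hom ≫ a n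
    rw [rawMul, Finset.sum_eq_single (0, n)]
    · change (𝟙 (𝟙_ D) ⊗ₘ a n) ≫ powMul X 0 n n = _
      rw [powMul_zero, id_tensorHom, leftUnitor_naturality]
    · rintro ⟨i, j⟩ hij hne
      have : i ≠ 0 := by
        rintro rfl
        simp at hij
        exact hne (by simp [hij])
      simp [Pi.single_eq_of_ne this, MonoidalPreadditive.zero_tensor]
    · intro h
      simp at h
  mul_assoc := by
    rintro V W Z ⟨a⟩ ⟨b⟩ ⟨c⟩
    exact congrArg symMk (funext fun n => rawMul_assoc a b c n)
  mul_comm := by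
    rintro V W ⟨a⟩ ⟨b⟩
    refine symMk_eq_iff.mpr fun n => ?_
    exact (rawMul_symSum_comm a b n).trans (Category.assoc _ _ _).symm

/-- The tautological point of degree `n` of the symmetric algebra. -/
def symPt (X : D) (n : ℕ) : (symAlg X).obj (tensorPow X n) :=
  symMk (Pi.single n (𝟙 (tensorPow X n)))

lemma map_symPt_eq_zero_iff {X V : D} {n : ℕ} (f : V ⟶ tensorPow X n) :
    (symAlg X).map f (symPt X n) = 0 ↔ f ≫ symSum X n = 0 := by
  refine (symMk_eq_iff (g := 0)).trans ⟨fun h => ?_, fun h m => ?_⟩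
  · have := h n
    simpa using this
  · by_cases hm : m = n
    · subst hm; simpa using h
    · simp [Pi.single_eq_of_ne hm]

/-- The product of the tautological points of degrees `a` and `b` is the tautological point of
degree `a + b`. -/
lemma mul_symPt (X : D) (a b : ℕ) : (symAlg X).mul (symPt X a) (symPt X b) =
    (symAlg X).map (powJoin X a b) (symPt X (b + a)) := by
  refine congrArg symMk (funext fun n => ?_)
  change rawMul (Pi.single a (𝟙 _)) (Pi.single b (𝟙 _)) n =
    powJoin X a b ≫ (Pi.single (b + a) (𝟙 _) : ∀ n, tensorPow X (b + a) ⟶ tensorPow X n) n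
  rw [rawMul]
  by_cases h : b + a = n
  · subst h
    rw [Finset.sum_eq_single (a, b)]
    · simp [powMul_eq]
    · rintro ⟨i, j⟩ hij hne
      by_cases hi : i = a
      · have hj : j ≠ b := fun hj => hne (by rw [hi, hj])
        simp [Pi.single_eq_of_ne hj, MonoidalPreadditive.tensor_zero]
      · simp [Pi.single_eq_of_ne hi, MonoidalPreadditive.zero_tensor]
    · intro h
      simp at h
      omega
  · rw [Pi.single_eq_of_ne (Ne.symm h), Limits.comp_zero]
    refine Finset.sum_eq_zero ?_
    rintro ⟨i, j⟩ hij
    simp only [Finset.HasAntidiagonal.mem_antidiagonal] at hij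
    by_cases hi : i = a
    · have hj : j ≠ b := by rintro rfl; omega
      simp [Pi.single_eq_of_ne hj, MonoidalPreadditive.tensor_zero]
    · simp [Pi.single_eq_of_ne hi, MonoidalPreadditive.zero_tensor]

variable [RightRigidCategory D]

open LaxAlg.Free

/-- The tautological functional on `X` after extension of scalars to its symmetric algebra. -/
def symFun (X : D) : (free (symAlg X)).obj X ⟶ 𝟙_ (symAlg X).Free :=
  ofPoint ((symAlg X).map (ρ_ X).inv (symPt X 1))

/-- The powers of the tautological functional are the tautological points of higher degree. -/
lemma funPow_symFun (X : D) (n : ℕ) : funPow (symFun X) n =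
    (powCmp (free (symAlg X)) X n).hom ≫ ofPoint (symPt X n) := by
  induction n with
  | zero =>
    refine (ofPoint_one (A := symAlg X)).symm.trans ?_
    exact (Category.id_comp _).symm
  | succ n ih =>
    rw [funPow_succ, ih, ← leftUnitor_naturality_assoc, ← whisker_exchange_assoc]
    refine Eq.trans ?_ (Category.assoc _ _ _).symm
    refine congrArg _ ?_
    refine (wr_ofPoint ((symAlg X).map (ρ_ X).inv (symPt X 1)) (symPt X n)).trans ?_
    rw [(symAlg X).mul_map_left]
    refine (congrArg _ (congrArg _ (mul_symPt X 1 n))).trans ?_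
    rw [(symAlg X).map_map]
    have : ∀ T : D, (ρ_ X).inv ▷ T ≫ (α_ X (𝟙_ D) T).hom ≫ X ◁ (λ_ T).hom = 𝟙 _ := by simp
    have h2 : (ρ_ X).inv ▷ tensorPow X n ≫ powJoin X 1 n = 𝟙 _ := this _
    rw [h2, (symAlg X).map_id]
    exact (Category.id_comp _).symm

/-- A tensor is killed by the power of the tautological functional only if its symmetrization
vanishes. -/
lemma symSum_eq_zero_of_comp_funPow {X V : D} {n : ℕ} (f : V ⟶ tensorPow X n)
    (h : (free (symAlg X)).map f ≫ (powCmp (free (symAlg X)) X n).inv ≫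
      funPow (symFun X) n = 0) : f ≫ symSum X n = 0 := by
  rw [← map_symPt_eq_zero_iff]
  rw [funPow_symFun, Iso.inv_hom_id_assoc] at h
  refine ofPoint_injective ?_
  rw [← fr_ofPoint, ofPoint_zero]
  exact h

/-- The points of the symmetric algebra are, up to division by factorials, families of symmetric
tensors, and these form a left exact functor. -/
lemma leftExactOn_symAlg {C : Type*} [Category* C] [Abelian C] {F : C ⥤ D}
    (hF : PreservesCokernels F) (X : D) : (symAlg X).LeftExactOn F where
  exists_desc := by
    rintro P Q p T ⟨f⟩ hf
    have hf' : ∀ n, (F.map p ▷ T ≫ f n) ≫ symSum X n = 0 := fun n =>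
      (symMk_eq_iff.mp (hf : symMk _ = symMk 0) n).trans Limits.zero_comp
    -- the symmetrized tensors descend to the cokernel; `symSum` is idempotent up to the factor `n!`
    choose h hh using fun n => hF.exists_desc' p (f n ≫ symSum X n)
      ((Category.assoc _ _ _).symm.trans (hf' n))
    choose h' hh' using fun n => exists_nsmul_eq n.factorial_ne_zero (h n)
    refine ⟨symMk h', symMk_eq_iff.mpr fun n => ?_⟩
    change (F.map (cokernel.π p) ▷ T ≫ h' n) ≫ symSum X n = f n ≫ symSum X n
    rw [← sub_eq_zero]
    refine eq_zero_of_nsmul_eq_zero n.factorial_ne_zero ?_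
    rw [smul_sub, ← Preadditive.comp_nsmul (f n), ← symSum_symSum, Category.assoc,
      ← Preadditive.comp_nsmul, ← Preadditive.nsmul_comp, hh', ← Category.assoc, hh,
      Category.assoc, sub_self]
  eq_zero := by
    rintro P Q p T ⟨f⟩ hf
    have hf' : ∀ n, (F.map (cokernel.π p) ▷ T ≫ f n) ≫ symSum X n = 0 := fun n =>
      (symMk_eq_iff.mp (hf : symMk _ = symMk 0) n).trans Limits.zero_comp
    refine symMk_eq_iff.mpr fun n => ?_
    rw [hF.eq_zero' p (f n ≫ symSum X n) ((Category.assoc _ _ _).symm.trans (hf' n))]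
    exact Limits.zero_comp.symm

end SymAlg

/-! ### Inverting an endomorphism of the unit -/

section Loc

variable {D : Type u} [SmallCategory D] [MonoidalCategory D]

lemma unit_end_comm (f g : 𝟙_ D ⟶ 𝟙_ D) : f ≫ g = g ≫ f := by
  have h1 : f ▷ 𝟙_ D = (λ_ _).hom ≫ f ≫ (λ_ _).inv := by
    rw [unitors_equal, unitors_inv_equal, ← rightUnitor_naturality_assoc, Iso.hom_inv_id,
      Category.comp_id]
  have h2 : 𝟙_ D ◁ g = (λ_ _).hom ≫ g ≫ (λ_ _).inv := by
    rw [← leftUnitor_naturality_assoc, Iso.hom_inv_id, Category.comp_id]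
  have h := whisker_exchange f g
  rw [h1, h2] at h
  simpa using h.symm

variable [Preadditive D]

/-- The endomorphisms of the unit form a commutative ring. -/
instance unitEndCommRing : CommRing (End (𝟙_ D)) :=
  { (inferInstance : Ring (End (𝟙_ D))) with
    mul_comm := fun f g => unit_end_comm g f }

variable [MonoidalPreadditive D]

/-- The product of functionals. -/
def funMul (V W : D) : (V ⟶ 𝟙_ D) →ₗ[End (𝟙_ D)] (W ⟶ 𝟙_ D) →ₗ[End (𝟙_ D)] (V ⊗ W ⟶ 𝟙_ D) :=
  LinearMap.mk₂ (End (𝟙_ D)) (fun f g => (f ⊗ₘ g) ≫ (λ_ (𝟙_ D)).hom)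
    (fun f f' g => by rw [MonoidalPreadditive.add_tensor, Preadditive.add_comp])
    (fun c f g => by
      change ((f ≫ c) ⊗ₘ g) ≫ _ = ((f ⊗ₘ g) ≫ (λ_ (𝟙_ D)).hom) ≫ c
      rw [Category.assoc, unitors_equal, ← rightUnitor_naturality, ← tensorHom_id,
        tensorHom_comp_tensorHom_assoc, Category.comp_id])
    (fun f g g' => by rw [MonoidalPreadditive.tensor_add, Preadditive.add_comp])
    (fun c f g => by
      change (f ⊗ₘ (g ≫ c)) ≫ _ = ((f ⊗ₘ g) ≫ (λ_ (𝟙_ D)).hom) ≫ c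
      rw [Category.assoc, ← leftUnitor_naturality, ← id_tensorHom,
        tensorHom_comp_tensorHom_assoc, Category.comp_id])

lemma funMul_apply {V W : D} (f : V ⟶ 𝟙_ D) (g : W ⟶ 𝟙_ D) :
    funMul V W f g = (f ⊗ₘ g) ≫ (λ_ (𝟙_ D)).hom := rfl

/-- Precomposition of functionals. -/
def funPull {V W : D} (u : V ⟶ W) : (W ⟶ 𝟙_ D) →ₗ[End (𝟙_ D)] (V ⟶ 𝟙_ D) where
  toFun f := u ≫ f
  map_add' _ _ := Preadditive.comp_add _ _ _ _ _ _
  map_smul' _ _ := (Category.assoc _ _ _).symm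

variable (s : End (𝟙_ D))

/-- The functionals on `V` with powers of `s` as denominators. -/
abbrev LocPts (V : D) : Type u := LocalizedModule (Submonoid.powers s) (V ⟶ 𝟙_ D)

variable {s}

open LocalizedModule

omit [MonoidalPreadditive D] in
lemma locPts_eq_mk {V : D} (x : LocPts s V) : ∃ f a, x = LocalizedModule.mk f a :=
  LocalizedModule.induction_on (fun f a => ⟨f, a, rfl⟩) x

/-- The product of fractions. -/
def locMul {V W : D} (x : LocPts s V) (y : LocPts s W) : LocPts s (V ⊗ W) :=
  OreLocalization.liftExpand (fun f a => OreLocalization.liftExpand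
    (fun g b => (mk (funMul V W f g) (a * b) : LocPts s (V ⊗ W)))
    (fun g t b ht => mk_eq.mpr ⟨1, by
      simp only [map_smul, Submonoid.smul_def, Submonoid.coe_mul, Submonoid.coe_one]
      module⟩) y)
    (fun f t a ht => by
      obtain ⟨g, b, rfl⟩ := locPts_eq_mk y
      refine mk_eq.mpr ⟨1, ?_⟩
      simp only [map_smul, LinearMap.smul_apply, Submonoid.smul_def, Submonoid.coe_mul,
        Submonoid.coe_one]
      module) x

lemma locMul_mk {V W : D} (f : V ⟶ 𝟙_ D) (g : W ⟶ 𝟙_ D) (a b : Submonoid.powers s) :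
    locMul (mk f a) (mk g b) = mk (funMul V W f g) (a * b) := rfl

/-- The product of fractions, as a bilinear map. -/
def locMulHom {V W : D} : LocPts s V →+ LocPts s W →+ LocPts s (V ⊗ W) :=
  AddMonoidHom.mk' (fun x => AddMonoidHom.mk' (locMul x) (by
    intro y y'
    obtain ⟨f, a, rfl⟩ := locPts_eq_mk x
    obtain ⟨g, b, rfl⟩ := locPts_eq_mk y
    obtain ⟨g', b', rfl⟩ := locPts_eq_mk y'
    rw [mk_add_mk, locMul_mk, locMul_mk, locMul_mk, mk_add_mk, mk_eq]
    refine ⟨1, ?_⟩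
    simp only [map_add, map_smul, Submonoid.smul_def, Submonoid.coe_mul, Submonoid.coe_one]
    module)) (by
    intro x x'
    ext y
    obtain ⟨f, a, rfl⟩ := locPts_eq_mk x
    obtain ⟨f', a', rfl⟩ := locPts_eq_mk x'
    obtain ⟨g, b, rfl⟩ := locPts_eq_mk y
    change locMul (mk f a + mk f' a') (mk g b) =
      locMul (mk f a) (mk g b) + locMul (mk f' a') (mk g b)
    rw [mk_add_mk, locMul_mk, locMul_mk, locMul_mk, mk_add_mk, mk_eq]
    refine ⟨1, ?_⟩
    simp only [map_add, map_smul, LinearMap.add_apply, LinearMap.smul_apply, Submonoid.smul_def,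
      Submonoid.coe_mul, Submonoid.coe_one]
    module)

lemma locMulHom_mk {V W : D} (f : V ⟶ 𝟙_ D) (g : W ⟶ 𝟙_ D) (a b : Submonoid.powers s) :
    locMulHom (mk f a) (mk g b) = mk (funMul V W f g) (a * b) := rfl

/-- Pullback of fractions. -/
def locPull {V W : D} (u : V ⟶ W) : LocPts s W →+ LocPts s V :=
  (LocalizedModule.map (Submonoid.powers s) (funPull u)).toAddMonoidHom

omit [MonoidalPreadditive D] in
lemma locPull_mk {V W : D} (u : V ⟶ W) (f : W ⟶ 𝟙_ D) (a : Submonoid.powers s) :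
    locPull u (mk f a) = mk (u ≫ f) a :=
  LocalizedModule.map_mk _ _ _ _

variable [SymmetricCategory D]

variable (s) in
/-- The commutative algebra obtained from the unit by inverting an endomorphism `s`. -/
def locAlg : LaxAlg D where
  obj := LocPts s
  grp _ := inferInstance
  map := locPull
  map_id x := by
    obtain ⟨f, a, rfl⟩ := locPts_eq_mk x
    rw [locPull_mk, Category.id_comp]
  map_map u v x := by
    obtain ⟨f, a, rfl⟩ := locPts_eq_mk x
    rw [locPull_mk, locPull_mk, locPull_mk, Category.assoc]
  map_add' u v x := by
    obtain ⟨f, a, rfl⟩ := locPts_eq_mk x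
    rw [locPull_mk, locPull_mk, locPull_mk, mk_add_mk, mk_eq, Preadditive.add_comp]
    refine ⟨1, ?_⟩
    simp only [Submonoid.smul_def, Submonoid.coe_mul, Submonoid.coe_one]
    module
  one := mk (𝟙 _) 1
  mul := locMulHom
  mul_map_left u x y := by
    obtain ⟨f, a, rfl⟩ := locPts_eq_mk x
    obtain ⟨g, b, rfl⟩ := locPts_eq_mk y
    rw [locPull_mk, locMulHom_mk, locMulHom_mk, locPull_mk, funMul_apply, funMul_apply,
      ← tensorHom_id, tensorHom_comp_tensorHom_assoc, Category.id_comp]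
  mul_map_right u x y := by
    obtain ⟨f, a, rfl⟩ := locPts_eq_mk x
    obtain ⟨g, b, rfl⟩ := locPts_eq_mk y
    rw [locPull_mk, locMulHom_mk, locMulHom_mk, locPull_mk, funMul_apply, funMul_apply,
      ← id_tensorHom, tensorHom_comp_tensorHom_assoc, Category.id_comp]
  one_mul x := by
    obtain ⟨f, a, rfl⟩ := locPts_eq_mk x
    rw [locPull_mk, locMulHom_mk, one_mul, funMul_apply, id_tensorHom, leftUnitor_naturality]
  mul_assoc x y z := by
    obtain ⟨f, a, rfl⟩ := locPts_eq_mk x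
    obtain ⟨g, b, rfl⟩ := locPts_eq_mk y
    obtain ⟨h, c, rfl⟩ := locPts_eq_mk z
    rw [locMulHom_mk, locMulHom_mk, locMulHom_mk, locMulHom_mk, locPull_mk, mul_assoc]
    congr 1
    simp only [funMul_apply, MonoidalCategory.tensorHom_def, comp_whiskerRight, whiskerLeft_comp,
      Category.assoc]
    monoidal
  mul_comm x y := by
    obtain ⟨f, a, rfl⟩ := locPts_eq_mk x
    obtain ⟨g, b, rfl⟩ := locPts_eq_mk y
    rw [locMulHom_mk, locMulHom_mk, locPull_mk, mul_comm b, funMul_apply, funMul_apply,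
      ← BraidedCategory.braiding_naturality_assoc, braiding_leftUnitor, unitors_equal]

variable [RightRigidCategory D]

open LaxAlg.Free

/-- The endomorphism `s` is invertible after extension of scalars to `𝟙[s⁻¹]`. -/
lemma exists_inv_locAlg (s : End (𝟙_ D)) :
    ∃ t : 𝟙_ (locAlg s).Free ⟶ 𝟙_ (locAlg s).Free, (free (locAlg s)).map s ≫ t = 𝟙 _ := by
  refine ⟨ofPoint (A := locAlg s) (V := 𝟙_ D)
    (mk (𝟙 (𝟙_ D)) (⟨s, 1, pow_one s⟩ : Submonoid.powers s) : LocPts s (𝟙_ D)), ?_⟩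
  refine (fr_ofPoint _ _).trans ?_
  refine Eq.trans (congrArg ofPoint ?_) ofPoint_one
  refine (locPull_mk _ _ _).trans (mk_eq.mpr ⟨1, ?_⟩)
  rw [Submonoid.smul_def, Submonoid.smul_def, Submonoid.smul_def, Submonoid.smul_def]
  change (((s : 𝟙_ D ⟶ 𝟙_ D) ≫ 𝟙 _) ≫ 𝟙 _) ≫ 𝟙 _ = (𝟙 _ ≫ s) ≫ 𝟙 _
  simp

/-- The localization at an endomorphism that is not nilpotent is not zero. -/
lemma locAlg_free_nontrivial {s : End (𝟙_ D)} (hs : ∀ n : ℕ, s ^ n ≠ 0) :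
    𝟙 (𝟙_ (locAlg s).Free) ≠ 0 := by
  intro h
  have h1 : ofPoint (locAlg s).one = ofPoint 0 := by
    rw [ofPoint_one, ofPoint_zero]
    exact h
  have h2 : (mk (𝟙 (𝟙_ D)) 1 : LocPts s (𝟙_ D)) = mk 0 1 :=
    Eq.trans (ofPoint_injective h1) (zero_mk 1).symm
  obtain ⟨⟨_, n, rfl⟩, hu⟩ := mk_eq.mp h2
  refine hs n ?_
  rw [one_smul, smul_zero, smul_zero] at hu
  exact (Category.id_comp _).symm.trans hu

omit [RightRigidCategory D] in
/-- Localization is exact: after multiplication by a power of `s`, the condition on a fraction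
becomes one on its numerator. -/
lemma leftExactOn_locAlg {C : Type*} [Category* C] [Abelian C] {F : C ⥤ D}
    (hF : PreservesCokernels F) (s : End (𝟙_ D)) : (locAlg s).LeftExactOn F where
  exists_desc {P Q} p T a ha := by
    obtain ⟨f, a, rfl⟩ := locPts_eq_mk a
    have ha' : (mk (F.map p ▷ T ≫ f) a : LocPts s _) = mk 0 1 :=
      (locPull_mk _ _ _).symm.trans (Eq.trans ha (zero_mk 1).symm)
    obtain ⟨u, hu⟩ := mk_eq.mp ha'
    rw [one_smul, smul_zero, smul_zero] at hu
    obtain ⟨h, hh⟩ := hF.exists_desc p T (f ≫ u.1) ((Category.assoc _ _ _).symm.trans hu)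
    refine ⟨(mk h (u * a) : LocPts s _), (locPull_mk _ _ _).trans ?_⟩
    rw [hh]
    exact mk_cancel_common_left u a f
  eq_zero {P Q} p T b hb := by
    obtain ⟨f, a, rfl⟩ := locPts_eq_mk b
    have hb' : (mk (F.map (cokernel.π p) ▷ T ≫ f) a : LocPts s _) = mk 0 1 :=
      (locPull_mk _ _ _).symm.trans (Eq.trans hb (zero_mk 1).symm)
    obtain ⟨u, hu⟩ := mk_eq.mp hb'
    rw [one_smul, smul_zero, smul_zero] at hu
    have := hF.eq_zero p T (f ≫ u.1) ((Category.assoc _ _ _).symm.trans hu)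
    refine Eq.trans (mk_eq.mpr ⟨u, ?_⟩) (zero_mk 1)
    rw [one_smul, smul_zero, smul_zero]
    exact this

end Loc

/-! ### Partial traces of symmetrizers -/

section Trace

universe v₁ u₁

variable {D : Type u₁} [Category.{v₁} D] [MonoidalCategory D]

/-- Multiplication by an endomorphism of the unit. -/
def scal (V : D) (c : 𝟙_ D ⟶ 𝟙_ D) : V ⟶ V := (λ_ V).inv ≫ c ▷ V ≫ (λ_ V).hom

lemma scal_naturality {V W : D} (f : V ⟶ W) (c : 𝟙_ D ⟶ 𝟙_ D) :
    f ≫ scal W c = scal V c ≫ f := by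
  simp only [scal, Category.assoc]
  rw [leftUnitor_inv_naturality_assoc, whisker_exchange_assoc, leftUnitor_naturality]

lemma scal_comp (V : D) (c d : 𝟙_ D ⟶ 𝟙_ D) : scal V (c ≫ d) = scal V c ≫ scal V d := by
  simp [scal]

lemma scal_id (V : D) : scal V (𝟙 _) = 𝟙 V := by simp [scal]

lemma scal_unit (c : 𝟙_ D ⟶ 𝟙_ D) : scal (𝟙_ D) c = c := by
  rw [scal, unitors_equal, rightUnitor_naturality, unitors_inv_equal, Iso.inv_hom_id_assoc]

lemma scal_tensor [SymmetricCategory D] (V W : D) (c : 𝟙_ D ⟶ 𝟙_ D) :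
    scal (V ⊗ W) c = V ◁ scal W c := by
  have h : V ◁ c = (β_ V (𝟙_ D)).hom ≫ c ▷ V ≫ (β_ (𝟙_ D) V).hom := by
    rw [BraidedCategory.braiding_naturality_left, SymmetricCategory.symmetry_assoc]
  have h2 : V ◁ c ▷ W = (α_ _ _ _).inv ≫ (V ◁ c) ▷ W ≫ (α_ _ _ _).hom := by simp
  rw [scal, scal, whiskerLeft_comp, whiskerLeft_comp, h2, h]
  simp

section Partial

variable [SymmetricCategory D] {X X' : D} [ExactPairing X X']

/-- The partial trace of a morphism `X ⊗ T ⟶ X ⊗ W` over `X`. -/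
def ptr (X X' : D) [ExactPairing X X'] {T W : D} (f : X ⊗ T ⟶ X ⊗ W) : T ⟶ W :=
  (λ_ T).inv ≫ (η_ X X' ≫ (β_ X X').hom) ▷ T ≫ (α_ _ _ _).hom ≫ X' ◁ f ≫ (α_ _ _ _).inv ≫
    ε_ X X' ▷ W ≫ (λ_ W).hom

lemma ptr_comp_left {T T' W : D} (a : T' ⟶ T) (f : X ⊗ T ⟶ X ⊗ W) :
    ptr X X' (X ◁ a ≫ f) = a ≫ ptr X X' f := by
  simp only [ptr, whiskerLeft_comp, Category.assoc]
  rw [← associator_naturality_right_assoc, ← whisker_exchange_assoc,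
    leftUnitor_inv_naturality_assoc]

lemma ptr_comp_right {T W W' : D} (f : X ⊗ T ⟶ X ⊗ W) (b : W ⟶ W') :
    ptr X X' (f ≫ X ◁ b) = ptr X X' f ≫ b := by
  simp only [ptr, whiskerLeft_comp, Category.assoc]
  rw [associator_inv_naturality_right_assoc, whisker_exchange_assoc, leftUnitor_naturality]

/-- The trace of an endomorphism of an object with a dual. -/
def tr (X X' : D) [ExactPairing X X'] (e : X ⟶ X) : End (𝟙_ D) :=
  η_ X X' ≫ (β_ X X').hom ≫ X' ◁ e ≫ ε_ X X'

lemma ptr_whiskerRight (e : X ⟶ X) (T : D) : ptr X X' (e ▷ T) = scal T (tr X X' e) := by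
  simp [ptr, scal, tr]

/-- The partial trace of the exchange of two factors is the identity. -/
lemma ptr_swap (T : D) :
    ptr X X' ((α_ X X T).inv ≫ (β_ X X).hom ▷ T ≫ (α_ X X T).hom) = 𝟙 _ := by
  have key : (λ_ X).inv ≫ (η_ X X' ≫ (β_ X X').hom) ▷ X ≫ (α_ _ _ _).hom ≫ X' ◁ (β_ X X).hom ≫
      (α_ _ _ _).inv ≫ ε_ X X' ▷ X ≫ (λ_ X).hom = 𝟙 _ := by
    have h : (β_ X X').hom ▷ X ≫ (α_ _ _ _).hom ≫ X' ◁ (β_ X X).hom ≫ (α_ _ _ _).inv =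
        (α_ _ _ _).hom ≫ (β_ X (X' ⊗ X)).hom := by
      simp
    rw [comp_whiskerRight, Category.assoc, reassoc_of% h,
      ← BraidedCategory.braiding_naturality_right_assoc,
      ExactPairing.evaluation_coevaluation_assoc]
    simp
  have h := congrArg (fun f => f ▷ T) key
  simp only [id_whiskerRight] at h
  rw [← h, ptr]
  simp only [comp_whiskerRight, whiskerLeft_comp, Category.assoc]
  monoidal

variable [Preadditive D] [MonoidalPreadditive D]

lemma ptr_add {T W : D} (f g : X ⊗ T ⟶ X ⊗ W) : ptr X X' (f + g) = ptr X X' f + ptr X X' g := by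
  simp [ptr, MonoidalPreadditive.whiskerLeft_add]

omit [SymmetricCategory D] in
lemma whiskerLeft_zsmul (V : D) {T W : D} (n : ℤ) (f : T ⟶ W) : V ◁ (n • f) = n • V ◁ f :=
  ((tensoringLeft D).obj V).map_zsmul

omit [SymmetricCategory D] in
lemma zsmul_whiskerRight (V : D) {T W : D} (n : ℤ) (f : T ⟶ W) : (n • f) ▷ V = n • f ▷ V :=
  ((tensoringRight D).obj V).map_zsmul

/-- The partial trace over `X` of a morphism `(X ⊗ M) ⊗ T ⟶ (X ⊗ M) ⊗ W`. -/
def ptrTensor (X X' M : D) [ExactPairing X X'] (T W : D) :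
    ((X ⊗ M) ⊗ T ⟶ (X ⊗ M) ⊗ W) →+ (M ⊗ T ⟶ M ⊗ W) :=
  AddMonoidHom.mk' (fun f => ptr X X' ((α_ X M T).inv ≫ f ≫ (α_ X M W).hom))
    (fun f g => by rw [Preadditive.add_comp, Preadditive.comp_add, ptr_add])

variable {M : D}

lemma ptrTensor_apply {T W : D} (f : (X ⊗ M) ⊗ T ⟶ (X ⊗ M) ⊗ W) : ptrTensor X X' M T W f =
    ptr X X' ((α_ X M T).inv ≫ f ≫ (α_ X M W).hom) := rfl

lemma ptrTensor_comp_left {T T' W : D} (a : T' ⟶ T) (f : (X ⊗ M) ⊗ T ⟶ (X ⊗ M) ⊗ W) :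
    ptrTensor X X' M T' W ((X ⊗ M) ◁ a ≫ f) = M ◁ a ≫ ptrTensor X X' M T W f := by
  rw [ptrTensor_apply, ptrTensor_apply, ← ptr_comp_left]
  simp

lemma ptrTensor_comp_right {T W W' : D} (f : (X ⊗ M) ⊗ T ⟶ (X ⊗ M) ⊗ W) (b : W ⟶ W') :
    ptrTensor X X' M T W' (f ≫ (X ⊗ M) ◁ b) = ptrTensor X X' M T W f ≫ M ◁ b := by
  rw [ptrTensor_apply, ptrTensor_apply, ← ptr_comp_right]
  simp

lemma ptrTensor_whiskerRight (e : X ⟶ X) (T : D) :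
    ptrTensor X X' M T T ((e ▷ M) ▷ T) = M ◁ scal T (tr X X' e) := by
  rw [ptrTensor_apply, ← scal_tensor, ← ptr_whiskerRight]
  simp

/-- The partial trace of the exchange of two factors `X ⊗ M` is the sign of the exchange of two
factors `M`. -/
lemma ptrTensor_swap {σ : ℤ} (hσ : (β_ M M).hom = σ • 𝟙 (M ⊗ M)) (T : D) :
    ptrTensor X X' M _ _ ((α_ (X ⊗ M) (X ⊗ M) T).inv ≫ (β_ (X ⊗ M) (X ⊗ M)).hom ▷ T ≫
      (α_ (X ⊗ M) (X ⊗ M) T).hom) = σ • 𝟙 (M ⊗ ((X ⊗ M) ⊗ T)) := by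
  have h1 : (β_ (X ⊗ M) (X ⊗ M)).hom = σ • ((α_ X M (X ⊗ M)).hom ≫
      X ◁ ((α_ M X M).inv ≫ (β_ M X).hom ▷ M) ≫ (α_ X (X ⊗ M) M).inv ≫
      ((α_ X X M).inv ≫ (β_ X X).hom ▷ M ≫ (α_ X X M).hom ≫ X ◁ (β_ X M).hom ≫
        (α_ X M X).inv) ▷ M ≫ (α_ (X ⊗ M) X M).hom) := by
    rw [BraidedCategory.braiding_tensor_left_hom, BraidedCategory.braiding_tensor_right_hom M X M,
      hσ, BraidedCategory.braiding_tensor_right_hom X X M]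
    simp [whiskerLeft_zsmul]
  rw [h1, zsmul_whiskerRight, Preadditive.zsmul_comp, Preadditive.comp_zsmul, map_zsmul,
    ptrTensor_apply]
  congr 1
  let A : M ⊗ ((X ⊗ M) ⊗ T) ⟶ X ⊗ (M ⊗ (M ⊗ T)) :=
    M ◁ (α_ X M T).hom ≫ (α_ M X (M ⊗ T)).inv ≫ (β_ M X).hom ▷ (M ⊗ T) ≫ (α_ X M (M ⊗ T)).hom
  let B : X ⊗ (M ⊗ (M ⊗ T)) ⟶ M ⊗ ((X ⊗ M) ⊗ T) :=
    (α_ X M (M ⊗ T)).inv ≫ (β_ X M).hom ▷ (M ⊗ T) ≫ (α_ M X (M ⊗ T)).hom ≫ M ◁ (α_ X M T).inv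
  have hAB : A ≫ B = 𝟙 _ := by
    simp only [A, B, Category.assoc, Iso.hom_inv_id_assoc]
    rw [← comp_whiskerRight_assoc, SymmetricCategory.symmetry]
    simp
  rw [← hAB]
  have h3 : A ≫ B = ptr X X' (X ◁ A ≫ ((α_ X X (M ⊗ (M ⊗ T))).inv ≫
      (β_ X X).hom ▷ (M ⊗ (M ⊗ T)) ≫ (α_ X X (M ⊗ (M ⊗ T))).hom) ≫ X ◁ B) := by
    rw [ptr_comp_left, ptr_comp_right, ptr_swap, Category.id_comp]
  rw [h3]
  congr 1
  simp only [A, B, comp_whiskerRight, whiskerLeft_comp, Category.assoc]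
  monoidal

omit [MonoidalPreadditive D] in
/-- The symmetrized power of an idempotent absorbs the idempotent and permutations. -/
lemma powMap_symSum_moveTop {Y : D} {e : Y ⟶ Y} (he : e ≫ e = e) (n : ℕ) (p : Fin (n + 1)) :
    (powMap e (n + 1) ≫ symSum Y (n + 1)) ≫ e ▷ tensorPow Y n ≫ moveTop Y (n + 1) p =
      powMap e (n + 1) ≫ symSum Y (n + 1) := by
  have h : powMap e (n + 1) ≫ e ▷ tensorPow Y n = powMap e (n + 1) := by
    rw [powMap_succ, Category.assoc, whisker_exchange, ← comp_whiskerRight_assoc, he]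
  rw [powMap_symSum, Category.assoc, reassoc_of% h, moveTop_eq_permMap, permMap_powMap,
    ← Category.assoc, symSum_permMap]

/-- The recursion for partial traces of symmetrized powers of an idempotent. -/
lemma ptrTensor_powMap_symSum {σ : ℤ} (hσ : (β_ M M).hom = σ • 𝟙 (M ⊗ M)) {e : X ⟶ X}
    (he : e ≫ e = e) (n : ℕ) :
    ptrTensor X X' M _ _ (powMap (e ▷ M) (n + 1) ≫ symSum (X ⊗ M) (n + 1)) =
      M ◁ ((scal _ (tr X X' e) + (n * σ) • 𝟙 _) ≫ powMap (e ▷ M) n ≫ symSum (X ⊗ M) n) := by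
  have comm : powMap (e ▷ M) (n + 1) ≫ symSum (X ⊗ M) (n + 1) =
      (X ⊗ M) ◁ (powMap (e ▷ M) n ≫ symSum (X ⊗ M) n) ≫ ∑ p : Fin (n + 1),
        (e ▷ M) ▷ tensorPow (X ⊗ M) n ≫ moveTop (X ⊗ M) (n + 1) p := by
    rw [symSum_succ, powMap_succ, ← Preadditive.comp_sum, whiskerLeft_comp, Category.assoc,
      Category.assoc, ← whisker_exchange_assoc, ← whisker_exchange_assoc]
  rw [comm, ptrTensor_comp_left, map_sum, Fin.sum_univ_succ]
  have h0 : ptrTensor X X' M _ _ ((e ▷ M) ▷ tensorPow (X ⊗ M) n ≫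
      moveTop (X ⊗ M) (n + 1) (0 : Fin (n + 1))) = M ◁ scal _ (tr X X' e) := by
    rw [← ptrTensor_whiskerRight, Fin.val_zero, moveTop_zero, Category.comp_id]
  rw [h0, Preadditive.comp_add, Preadditive.comp_sum, Preadditive.add_comp,
    MonoidalPreadditive.whiskerLeft_add,
    ← whiskerLeft_comp, scal_naturality]
  congr 1
  cases n with
  | zero => simp
  | succ m =>
    have hp : ∀ p : Fin (m + 1), ptrTensor X X' M _ _ ((e ▷ M) ▷ tensorPow (X ⊗ M) (m + 1) ≫
        moveTop (X ⊗ M) (m + 1 + 1) p.succ) =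
        σ • M ◁ ((e ▷ M) ▷ tensorPow (X ⊗ M) m ≫ moveTop (X ⊗ M) (m + 1) p) := by
      intro p
      have hs : (e ▷ M) ▷ ((X ⊗ M) ⊗ tensorPow (X ⊗ M) m) ≫ swapTop (X ⊗ M) m =
          swapTop (X ⊗ M) m ≫ (X ⊗ M) ◁ (e ▷ M) ▷ tensorPow (X ⊗ M) m := by
        simp only [swapTop]
        rw [associator_inv_naturality_left_assoc, ← comp_whiskerRight_assoc,
          BraidedCategory.braiding_naturality_left, comp_whiskerRight_assoc]
        simp
      have h1 : (e ▷ M) ▷ ((X ⊗ M) ⊗ tensorPow (X ⊗ M) m) ≫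
          moveTop (X ⊗ M) (m + 1 + 1) p.succ = swapTop (X ⊗ M) m ≫
            (X ⊗ M) ◁ ((e ▷ M) ▷ tensorPow (X ⊗ M) m ≫ moveTop (X ⊗ M) (m + 1) p) := by
        rw [Fin.val_succ, moveTop_succ, reassoc_of% hs, whiskerLeft_comp]
        rfl
      refine (congrArg _ h1).trans ?_
      refine (ptrTensor_comp_right _ _).trans ?_
      refine (congrArg (· ≫ _) (ptrTensor_swap hσ _)).trans ?_
      rw [Preadditive.zsmul_comp, Category.id_comp]
    have hq : ∀ p : Fin (m + 1), M ◁ (powMap (e ▷ M) (m + 1) ≫ symSum (X ⊗ M) (m + 1)) ≫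
        ptrTensor X X' M _ _ ((e ▷ M) ▷ tensorPow (X ⊗ M) (m + 1) ≫
        moveTop (X ⊗ M) (m + 1 + 1) p.succ) =
        σ • M ◁ (powMap (e ▷ M) (m + 1) ≫ symSum (X ⊗ M) (m + 1)) := by
      intro p
      rw [hp, Preadditive.comp_zsmul, ← whiskerLeft_comp, powMap_symSum_moveTop]
      rw [← comp_whiskerRight, he]
    simp_rw [hq]
    rw [Finset.sum_const, Finset.card_univ, Fintype.card_fin, Preadditive.zsmul_comp,
      Category.id_comp, whiskerLeft_zsmul, mul_smul, natCast_zsmul]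

end Partial

section Nonvanishing

variable {D : Type u} [SmallCategory D] [MonoidalCategory D] [SymmetricCategory D]
  [Preadditive D] [MonoidalPreadditive D] {X X' : D} [ExactPairing X X']

omit [SymmetricCategory D] in
lemma scal_add (V : D) (c d : 𝟙_ D ⟶ 𝟙_ D) : scal V (c + d) = scal V c + scal V d := by
  simp [scal]

omit [SymmetricCategory D] in
lemma scal_zsmul (V : D) (n : ℤ) (c : 𝟙_ D ⟶ 𝟙_ D) : scal V (n • c) = n • scal V c := by
  simp [scal, zsmul_whiskerRight]

open Finset in
/-- If a symmetrized power of an idempotent vanishes, then its trace is a zero of an explicit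
polynomial. -/
lemma prod_eq_zero_of_powMap_symSum {M : D} (hM : ∀ {V W : D} (f : V ⟶ W), M ◁ f = 0 → f = 0)
    {σ : ℤ} (hσ : (β_ M M).hom = σ • 𝟙 (M ⊗ M)) {e : X ⟶ X} (he : e ≫ e = e) (n : ℕ)
    (Q : End (𝟙_ D)) (h : scal _ Q ≫ powMap (e ▷ M) n ≫ symSum (X ⊗ M) n = 0) :
    (∏ i ∈ range n, (tr X X' e + (i * σ : ℤ))) * Q = 0 := by
  induction n generalizing Q with
  | zero =>
    simp only [range_zero, prod_empty, one_mul]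
    have h0 : powMap (e ▷ M) 0 ≫ symSum (X ⊗ M) 0 = 𝟙 _ := by
      simp [powMap, symSum, permMap, tensorPow]
    rw [h0, Category.comp_id] at h
    exact (scal_unit Q).symm.trans h
  | succ n ih =>
    rw [prod_range_succ, mul_assoc]
    apply ih
    apply hM
    have h1 := congrArg (ptrTensor X X' M _ _) h
    rw [map_zero, scal_tensor, ptrTensor_comp_left, ptrTensor_powMap_symSum hσ he,
      ← whiskerLeft_comp] at h1
    rw [← h1]
    have h2 : scal (tensorPow (X ⊗ M) n) ((tr X X' e + ((n * σ : ℤ) : End (𝟙_ D))) * Q) =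
        scal _ Q ≫ (scal _ (tr X X' e) + (n * σ : ℤ) • 𝟙 _) := by
      rw [← scal_id, ← scal_zsmul, ← scal_add, ← scal_comp, ← zsmul_one]
      rfl
    rw [h2, Category.assoc]

variable [DivisibleUnit D]

omit [SymmetricCategory D] [MonoidalPreadditive D] in
lemma isUnit_intCast {n : ℤ} (hn : n ≠ 0) : IsUnit (n : End (𝟙_ D)) := by
  have h : IsUnit ((n.natAbs : ℕ) : End (𝟙_ D)) := by
    obtain ⟨c, hc⟩ := DivisibleUnit.exists_nsmul_eq_id (D := D) n.natAbs (Int.natAbs_ne_zero.2 hn)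
    refine IsUnit.of_mul_eq_one (c : End (𝟙_ D)) ?_
    rw [← nsmul_eq_mul]
    exact hc
  rcases Int.natAbs_eq n with h' | h' <;> rw [h'] <;> simpa using h

omit [SymmetricCategory D] [MonoidalPreadditive D] in
open Finset in
/-- A trace that is both a non-positive and a non-negative integer, in the sense of being a zero of
the corresponding polynomials, is zero. -/
lemma eq_zero_of_prod_eq_zero {d : End (𝟙_ D)} {a b : ℕ}
    (ha : ∏ i ∈ range a, (d + (i : ℤ)) = 0) (hb : ∏ i ∈ range b, (d - (i : ℤ)) = 0) : d = 0 := by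
  cases a with
  | zero => rw [← one_mul d, ← prod_range_zero fun i : ℕ => d + (i : ℤ), ha, zero_mul]
  | succ a =>
    cases b with
    | zero => rw [← one_mul d, ← prod_range_zero fun i : ℕ => d - (i : ℤ), hb, zero_mul]
    | succ b =>
      rw [prod_range_succ'] at ha hb
      -- without the common root `0` the two polynomials have no common root, and the differences of
      -- their roots are invertible
      have hc : IsCoprime (∏ i ∈ range a, (d + ((i + 1 : ℕ) : ℤ)))
          (∏ i ∈ range b, (d - ((i + 1 : ℕ) : ℤ))) := by
        refine IsCoprime.prod_left fun i _ => IsCoprime.prod_right fun j _ => ?_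
        obtain ⟨c, hc⟩ :=
          (isUnit_intCast (D := D) (n := (i + 1) + (j + 1)) (by omega)).exists_left_inv
        refine ⟨c, -c, ?_⟩
        rw [← hc]
        push_cast
        ring
      obtain ⟨u, v, huv⟩ := hc
      simp only [Nat.cast_zero, Int.cast_zero, add_zero, sub_zero] at ha hb
      rw [← one_mul d, ← huv, add_mul, mul_assoc, mul_assoc, ha, hb, mul_zero, mul_zero, add_zero]

omit [SymmetricCategory D] [DivisibleUnit D] in
/-- Tensoring with an invertible object is faithful. -/
lemma eq_zero_of_whiskerLeft_eq_zero {M : D} (hM : Nonempty (M ⊗ M ≅ 𝟙_ D)) {V W : D} {f : V ⟶ W}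
    (hf : M ◁ f = 0) : f = 0 := by
  have h1 : (M ⊗ M) ◁ f = 0 := by simp [hf]
  have h2 : 𝟙_ D ◁ f = hM.some.inv ▷ _ ≫ (M ⊗ M) ◁ f ≫ hM.some.hom ▷ _ := by
    rw [whisker_exchange, ← comp_whiskerRight_assoc, Iso.inv_hom_id, id_whiskerRight,
      Category.id_comp]
  rw [h1, Limits.zero_comp, Limits.comp_zero, id_whiskerLeft] at h2
  simpa using congrArg (fun g => (λ_ _).inv ≫ g ≫ (λ_ _).hom) h2

/-- All symmetrized powers of a non-zero idempotent, or all of its symmetrized powers after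
tensoring with the odd unit, are non-zero. -/
lemma powMap_symSum_ne_zero {L : D} (hL : Nonempty (L ⊗ L ≅ 𝟙_ D))
    (hβ : (β_ L L).hom = -𝟙 (L ⊗ L)) (X' : D) [ExactPairing X X'] {e : X ⟶ X} (he : e ≫ e = e)
    (h0 : e ≠ 0) : (∀ n, powMap (e ▷ 𝟙_ D) n ≫ symSum (X ⊗ 𝟙_ D) n ≠ 0) ∨
      ∀ n, powMap (e ▷ L) n ≫ symSum (X ⊗ L) n ≠ 0 := by
  by_contra! hcon
  obtain ⟨⟨a, ha⟩, b, hb⟩ := hcon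
  have faith1 : ∀ {V W : D} (f : V ⟶ W), 𝟙_ D ◁ f = 0 → f = 0 := fun f hf => by
    rw [id_whiskerLeft] at hf
    simpa using congrArg (fun g => (λ_ _).inv ≫ g ≫ (λ_ _).hom) hf
  have faithL : ∀ {V W : D} (f : V ⟶ W), L ◁ f = 0 → f = 0 := fun f hf =>
    eq_zero_of_whiskerLeft_eq_zero hL hf
  have hσ1 : (β_ (𝟙_ D) (𝟙_ D)).hom = (1 : ℤ) • 𝟙 _ := by
    rw [one_smul, braiding_tensorUnit_left, unitors_equal, Iso.hom_inv_id]
  have hσL : (β_ L L).hom = (-1 : ℤ) • 𝟙 _ := by rw [hβ, neg_smul, one_smul]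
  -- the symmetrized powers of `e` detect the trace `d` in `{0, -1, -2, …}`, those of `e ⊗ L` detect
  -- it in `{0, 1, 2, …}`, as the odd unit reverses the sign of the commutativity constraint
  have hd : tr X X' e = 0 := by
    refine eq_zero_of_prod_eq_zero (a := a) (b := b) ?_ ?_
    · simpa using prod_eq_zero_of_powMap_symSum (X' := X') faith1 hσ1 he a 1
        (by rw [ha, Limits.comp_zero])
    · simpa [sub_eq_add_neg] using prod_eq_zero_of_powMap_symSum (X' := X') faithL hσL he b 1
        (by rw [hb, Limits.comp_zero])
  -- for trace zero, the partial trace lowers the degree in which a symmetrized power vanishes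
  have down : ∀ n, powMap (e ▷ 𝟙_ D) (n + 1 + 1) ≫ symSum (X ⊗ 𝟙_ D) (n + 1 + 1) = 0 →
      powMap (e ▷ 𝟙_ D) (n + 1) ≫ symSum (X ⊗ 𝟙_ D) (n + 1) = 0 := fun n h => by
    have h1 := ptrTensor_powMap_symSum (X' := X') hσ1 he (n + 1)
    rw [h, map_zero] at h1
    have h2 := faith1 _ h1.symm
    have h3 : scal (tensorPow (X ⊗ 𝟙_ D) (n + 1)) (tr X X' e) = 0 := by
      rw [show tr X X' e = 0 from hd]
      simp [scal]
    rw [h3, zero_add, mul_one, Preadditive.zsmul_comp, Category.id_comp, natCast_zsmul] at h2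
    exact eq_zero_of_nsmul_eq_zero (Nat.succ_ne_zero n) h2
  have h1 : powMap (e ▷ 𝟙_ D) 1 ≫ symSum (X ⊗ 𝟙_ D) 1 = 0 := by
    cases a with
    | zero =>
      have : 𝟙 (𝟙_ D) = 0 := by simpa [powMap, symSum, permMap, tensorPow] using ha
      have h2 : ∀ {V W : D} (f : V ⟶ W), f = 0 := fun {V W} f => by
        have : 𝟙_ D ◁ f = 0 := by
          rw [← Category.id_comp (𝟙_ D ◁ f), ← id_whiskerRight, this]
          simp
        exact faith1 f this
      exact h2 _
    | succ a =>
      induction a with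
      | zero => exact ha
      | succ a ih => exact ih (down a ha)
  have h2 : symSum (X ⊗ 𝟙_ D) 1 = 𝟙 _ := by
    simp [symSum, permMap, tailMap, moveTop, tensorPow]
  rw [h2, Category.comp_id, powMap_succ] at h1
  apply h0
  have h3 : (e ▷ 𝟙_ D) ▷ 𝟙_ D = 0 := by
    simpa [powMap] using h1
  simpa using congrArg (fun g => (ρ_ _).inv ≫ (ρ_ _).inv ≫ g ≫ (ρ_ _).hom ≫ (ρ_ _).hom) h3

end Nonvanishing

end Trace

/-! ### Splitting off an invertible summand after an extension of scalars -/

section Splitting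

open LaxAlg Free

variable {D : Type u} [SmallCategory D] [MonoidalCategory D] [SymmetricCategory D]
  [Preadditive D] [MonoidalPreadditive D] [RightRigidCategory D] [DivisibleUnit D]
  {C : Type*} [Category* C] [Abelian C]

/-- The value of a functional at a point. -/
def evalPoint (B : LaxAlg D) {Y : D} (x : 𝟙_ D ⟶ Y) (z : (free B).obj Y ⟶ 𝟙_ B.Free) :
    End (𝟙_ B.Free) :=
  (free B).map x ≫ z

omit [Preadditive D] [MonoidalPreadditive D] [DivisibleUnit D] in
/-- The point of the dual that corresponds to a functional. -/
lemma exists_mate {Y : D} (y : Y ⟶ 𝟙_ D) : ∃ y' : 𝟙_ D ⟶ Yᘁ,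
    (ρ_ Y).inv ≫ Y ◁ y' ≫ (β_ Y (Yᘁ)).hom ≫ ε_ Y (Yᘁ) = y ∧
      y' = η_ Y (Yᘁ) ≫ y ▷ (Yᘁ) ≫ (λ_ (Yᘁ)).hom := by
  refine ⟨_, ?_, rfl⟩
  rw [BraidedCategory.braiding_naturality_right_assoc]
  simp only [comp_whiskerRight, Category.assoc]
  have h1 : (y ▷ (Yᘁ)) ▷ Y ≫ (λ_ (Yᘁ)).hom ▷ Y ≫ ε_ Y (Yᘁ) =
      (α_ _ _ _).hom ≫ Y ◁ ε_ Y (Yᘁ) ≫ (ρ_ Y).hom ≫ y := by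
    have h2 : (λ_ (Yᘁ)).hom ▷ Y = (α_ (𝟙_ D) (Yᘁ) Y).hom ≫ (λ_ ((Yᘁ) ⊗ Y)).hom := by simp
    rw [h2, Category.assoc, associator_naturality_left_assoc, ← leftUnitor_naturality,
      ← whisker_exchange_assoc, unitors_equal, rightUnitor_naturality]
  rw [h1, ExactPairing.evaluation_coevaluation_assoc]
  simp

/-- The value of a functional at the universal point of the symmetric algebra of the dual is not
nilpotent if no power of the functional vanishes. -/
lemma symFun_pow_ne_zero {Y : D} {y : Y ⟶ 𝟙_ D} (hy : ∀ n, funPow y n ≠ 0) {y' : 𝟙_ D ⟶ Yᘁ}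
    (hyy : (ρ_ Y).inv ≫ Y ◁ y' ≫ (β_ Y (Yᘁ)).hom ≫ ε_ Y (Yᘁ) = y) (n : ℕ) :
    evalPoint (symAlg (Yᘁ)) y' (symFun (Yᘁ)) ^ n ≠ 0 := by
  intro hn
  have h1 : elemPow ((free (symAlg (Yᘁ))).map y') n ≫ funPow (symFun (Yᘁ)) n = 0 :=
    (elemPow_funPow ((free (symAlg (Yᘁ))).map y') (symFun (Yᘁ)) _ rfl n).trans hn
  have h2 : elemPow ((free (symAlg (Yᘁ))).map y') n ≫ (powCmp (free (symAlg (Yᘁ))) (Yᘁ) n).hom =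
      (free (symAlg (Yᘁ))).map (elemPow y' n) := by
    have := elemPow_powCmp (free (symAlg (Yᘁ))) y' n
    change elemPow (𝟙 _ ≫ _) n ≫ _ = 𝟙 _ ≫ _ at this
    rwa [Category.id_comp, Category.id_comp] at this
  have h3 := symSum_eq_zero_of_comp_funPow (elemPow y' n) (by
    rw [← h2, Category.assoc, Iso.hom_inv_id_assoc]
    exact h1)
  have h4 : elemPow y' n = 0 := by
    refine eq_zero_of_nsmul_eq_zero n.factorial_ne_zero ?_
    rw [← h3, symSum, Preadditive.comp_sum]
    simp [elemPow_permMap, Fintype.card_perm]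
  obtain ⟨K, hK⟩ := funPow_eq_elemPow_comp ((β_ Y (Yᘁ)).hom ≫ ε_ Y (Yᘁ)) y' n
  apply hy n
  rw [← hyy, hK, h4]
  simp

omit [MonoidalPreadditive D] [DivisibleUnit D] in
/-- A functional `z` on the free module on the dual `Y'` gives a point of the free module on `Y`.
The value of a functional `y` at this point is the value of `z` at the point of `Y'` that
corresponds to `y` by duality. -/
lemma free_coevaluation_comp (B : LaxAlg D) {Y Y' : D} (c : 𝟙_ D ⟶ Y ⊗ Y') (y : Y ⟶ 𝟙_ D)
    (z : (free B).obj Y' ⟶ 𝟙_ B.Free) :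
    ∃ x : 𝟙_ B.Free ⟶ (free B).obj Y,
      x ≫ (free B).map y = (free B).map (c ≫ y ▷ Y' ≫ (λ_ Y').hom) ≫ z := by
  refine ⟨(free B).map c ≫ (free B).obj Y ◁ z ≫ (ρ_ ((free B).obj Y)).hom, ?_⟩
  have h1 : (free B).map (c ≫ y ▷ Y' ≫ (λ_ Y').hom) =
      (free B).map c ≫ (free B).map y ▷ (free B).obj Y' ≫ (λ_ ((free B).obj Y')).hom := by
    rw [Functor.map_comp, Functor.map_comp]
    exact congrArg (fun g => _ ≫ g ≫ _) (wr_fr y Y').symm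
  have h2 : (free B).obj Y ◁ z ≫ (ρ_ ((free B).obj Y)).hom ≫ (free B).map y =
      (free B).map y ▷ (free B).obj Y' ≫ (λ_ ((free B).obj Y')).hom ≫ z := by
    have h3 : (ρ_ ((free B).obj Y)).hom ≫ (free B).map y =
      (free B).map y ▷ _ ≫ (ρ_ (𝟙_ B.Free)).hom := (rightUnitor_naturality _).symm
    rw [h3, whisker_exchange_assoc, ← unitors_equal]
    exact congrArg _ (leftUnitor_naturality z)
  rw [h1]
  change ((free B).map c ≫ _ ≫ _) ≫ _ = ((free B).map c ≫ _ ≫ _) ≫ _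
  rw [Category.assoc, Category.assoc, Category.assoc, Category.assoc]
  exact congrArg _ h2

/-- A functional none of whose powers vanishes becomes split after an extension of scalars: over the
symmetric algebra of the dual there is a universal point, and the value of the functional at this
point is not nilpotent, hence can be inverted. -/
lemma exists_point_of_funPow_ne_zero {F : C ⥤ D} (hF : PreservesCokernels F) {Y : D}
    (y : Y ⟶ 𝟙_ D) (hy : ∀ n, funPow y n ≠ 0) :
    ∃ (B : LaxAlg D) (E : LaxAlg B.Free), 𝟙 (𝟙_ E.Free) ≠ 0 ∧
      PreservesCokernels (F ⋙ free B ⋙ free E) ∧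
      ∃ (x : 𝟙_ E.Free ⟶ (free E).obj ((free B).obj Y)) (t : 𝟙_ E.Free ⟶ 𝟙_ E.Free),
        x ≫ (free E).map ((free B).map y) ≫ t = 𝟙 _ := by
  obtain ⟨y', hyy, hy'⟩ := exists_mate y
  obtain ⟨B, hB, z, hz⟩ : ∃ B : LaxAlg D, B.LeftExactOn F ∧
      ∃ z : (free B).obj (Yᘁ) ⟶ 𝟙_ B.Free,
        ∀ n, evalPoint B y' z ^ n ≠ 0 :=
    ⟨_, leftExactOn_symAlg hF (Yᘁ), _, symFun_pow_ne_zero hy hyy⟩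
  obtain ⟨x, hx⟩ := free_coevaluation_comp B (η_ Y (Yᘁ)) y z
  rw [← hy'] at hx
  obtain ⟨t, ht⟩ := exists_inv_locAlg (evalPoint B y' z)
  refine ⟨B, locAlg (evalPoint B y' z),
    locAlg_free_nontrivial hz, ?_, (free _).map x, t, ?_⟩
  · exact (leftExactOn_locAlg hB.preservesCokernels _).preservesCokernels
  · refine Eq.trans ?_ ht
    refine (Category.assoc _ _ _).symm.trans (congrArg (· ≫ t) ?_)
    exact ((free _).map_comp _ _).symm.trans (congrArg _ hx)

/-- An idempotent none of whose symmetrized powers vanishes becomes, after an extension of scalars,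
the identity on a direct summand isomorphic to the unit. -/
lemma exists_splitting_of_powMap_symSum_ne_zero {F : C ⥤ D} (hF : PreservesCokernels F) {Y : D}
    (e : Y ⟶ Y) (he : ∀ n, powMap e n ≫ symSum Y n ≠ 0) :
    ∃ (A : LaxAlg D) (B : LaxAlg A.Free) (E : LaxAlg B.Free), 𝟙 (𝟙_ E.Free) ≠ 0 ∧
      PreservesCokernels (F ⋙ free A ⋙ free B ⋙ free E) ∧
      ∃ (x : 𝟙_ E.Free ⟶ (free E).obj ((free B).obj ((free A).obj Y)))
        (y : (free E).obj ((free B).obj ((free A).obj Y)) ⟶ 𝟙_ E.Free),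
        x ≫ (free E).map ((free B).map ((free A).map e)) ≫ y = 𝟙 _ := by
  let A := symAlg Y
  have h : ∀ n, funPow ((free A).map e ≫ symFun Y) n ≠ 0 := by
    intro n hn
    apply he n
    apply symSum_eq_zero_of_comp_funPow
    have h1 := powMap_powCmp (free A) e n
    rw [← powMap_funPow] at hn
    rw [← cancel_epi (powCmp (free (symAlg Y)) Y n).hom, ← Category.assoc, ← h1, Category.assoc,
      Iso.hom_inv_id_assoc, Limits.comp_zero]
    exact hn
  obtain ⟨B, E, h0, hE, x, t, hx⟩ := exists_point_of_funPow_ne_zero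
    (leftExactOn_symAlg hF Y).preservesCokernels _ h
  refine ⟨A, B, E, h0, hE, x, (free E).map ((free B).map (symFun Y)) ≫ t, ?_⟩
  rw [← hx, Functor.map_comp, Functor.map_comp, Category.assoc]

end Splitting

/-! ### Splitting off all invertible summands -/

section UnitSums

attribute [local instance] Abelian.hasFiniteBiproducts

variable {C : Type*} [Category* C] [Abelian C]

/-- A constant biproduct over `Fin (p + 1)` splits off its last summand. -/
def biproductFinSucc (X : C) (p : ℕ) :
    (⨁ fun _ : Fin p => X) ⊞ X ≅ ⨁ fun _ : Fin (p + 1) => X where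
  hom := biprod.desc (biproduct.desc fun i => biproduct.ι (fun _ : Fin (p + 1) => X) i.castSucc)
    (biproduct.ι (fun _ : Fin (p + 1) => X) (Fin.last p))
  inv := biprod.lift (biproduct.lift fun i => biproduct.π (fun _ : Fin (p + 1) => X) i.castSucc)
    (biproduct.π (fun _ : Fin (p + 1) => X) (Fin.last p))
  hom_inv_id := by
    ext i j
    · by_cases h : i = j
      · subst h; simp
      · simp [h]
    · simp
    · simp [biproduct.ι_π_ne _ (Fin.castSucc_lt_last _).ne']
    · simp
  inv_hom_id := by
    rw [biprod.lift_desc, biproduct.lift_desc, ← biproduct.total, Fin.sum_univ_castSucc]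

variable [MonoidalCategory C]

/-- The object `U` is isomorphic to some `𝟙^p ⊕ L^q`. -/
def IsUnitSum (L U : C) : Prop := ∃ p q : ℕ, Nonempty (U ≅ unitSum L p q)

lemma isUnitSum_zero (L : C) : IsUnitSum L (unitSum L 0 0) := ⟨0, 0, ⟨Iso.refl _⟩⟩

lemma IsUnitSum.add_unit {L U : C} (h : IsUnitSum L U) : IsUnitSum L (U ⊞ 𝟙_ C) := by
  obtain ⟨p, q, ⟨f⟩⟩ := h
  refine ⟨p + 1, q, ⟨biprod.mapIso f (Iso.refl _) ≪≫ biprod.braiding _ _ ≪≫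
    (biprod.associator _ _ _).symm ≪≫
    biprod.mapIso (biprod.braiding _ _ ≪≫ biproductFinSucc _ p) (Iso.refl _)⟩⟩

lemma IsUnitSum.add_odd {L U : C} (h : IsUnitSum L U) : IsUnitSum L (U ⊞ L) := by
  obtain ⟨p, q, ⟨f⟩⟩ := h
  exact ⟨p, q + 1, ⟨biprod.mapIso f (Iso.refl _) ≪≫ biprod.associator _ _ _ ≪≫
    biprod.mapIso (Iso.refl _) (biproductFinSucc _ q)⟩⟩

end UnitSums

section Splitting

variable {C : Type u} [SmallCategory C] [Abelian C] [MonoidalCategory C]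
  {D : Type u} [SmallCategory D] [MonoidalCategory D] [SymmetricCategory D] [Preadditive D]
  {D' : Type u} [SmallCategory D'] [MonoidalCategory D'] [SymmetricCategory D'] [Preadditive D']

/-- A decomposition of `F(X)` into an object `F(U)` with `U ≅ 𝟙^p ⊕ L^q` and the image of an
idempotent `e`, together with an integral relation between the permutations of the factors of the
`n`-th tensor power of this image, in which the identity has the coefficient `1`. -/
structure PartialSplitting (F : C ⥤ D) (L X : C) (n : ℕ) where
  /-- The object that is already split off. -/
  U : C
  isUnitSum : IsUnitSum L U
  /-- The inclusion of `F(U)`. -/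
  i : F.obj U ⟶ F.obj X
  /-- The projection to `F(U)`. -/
  r : F.obj X ⟶ F.obj U
  /-- The complementary idempotent. -/
  e : F.obj X ⟶ F.obj X
  i_r : i ≫ r = 𝟙 _
  r_i : r ≫ i + e = 𝟙 _
  /-- The coefficients of the relation. -/
  z : Equiv.Perm (Fin n) → ℤ
  z_one : z 1 = 1
  rel : powMap e n ≫ ∑ g, z g • permMap (F.obj X) n g = 0

namespace PartialSplitting

variable {F : C ⥤ D} {L X : C} {n : ℕ}

lemma i_e (s : PartialSplitting F L X n) : s.i ≫ s.e = 0 := by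
  have := s.i ≫= s.r_i
  rw [Preadditive.comp_add, ← Category.assoc, s.i_r, Category.id_comp, Category.comp_id] at this
  simpa using this

lemma e_r (s : PartialSplitting F L X n) : s.e ≫ s.r = 0 := by
  have := s.r_i =≫ s.r
  rw [Preadditive.add_comp, Category.assoc, s.i_r, Category.id_comp, Category.comp_id] at this
  simpa using this

lemma e_e (s : PartialSplitting F L X n) : s.e ≫ s.e = s.e := by
  have := s.r_i =≫ s.e
  rwa [Preadditive.add_comp, Category.assoc, s.i_e, Limits.comp_zero, zero_add,
    Category.id_comp] at this

/-- The image of a partial splitting under a functor. -/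
def map (s : PartialSplitting F L X n) (G : D ⥤ D') [G.Braided] [G.Additive] :
    PartialSplitting (F ⋙ G) L X n where
  U := s.U
  isUnitSum := s.isUnitSum
  i := G.map s.i
  r := G.map s.r
  e := G.map s.e
  i_r := by rw [← G.map_comp, s.i_r]; exact G.map_id _
  r_i := by rw [← G.map_comp, ← G.map_add, s.r_i]; exact G.map_id _
  z := s.z
  z_one := s.z_one
  rel := by
    have h : (∑ g, s.z g • permMap (G.obj (F.obj X)) n g) ≫ (powCmp G (F.obj X) n).hom =
        (powCmp G (F.obj X) n).hom ≫ G.map (∑ g, s.z g • permMap (F.obj X) n g) := by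
      rw [G.map_sum, Preadditive.sum_comp, Preadditive.comp_sum]
      refine Finset.sum_congr rfl fun g _ => ?_
      rw [G.map_zsmul, Preadditive.zsmul_comp, Preadditive.comp_zsmul, permMap_powCmp]
    rw [← cancel_mono (powCmp G (F.obj X) n).hom, Limits.zero_comp, Category.assoc]
    refine (congrArg _ h).trans ?_
    rw [← Category.assoc]
    refine (congrArg (· ≫ _) (powMap_powCmp G s.e n)).trans ?_
    rw [Category.assoc, ← G.map_comp, s.rel, G.map_zero, Limits.comp_zero]

/-- A complementary direct summand is killed in all terms of the relation that move it. -/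
lemma whiskerRight_moveTop_comp {Y N : D} [MonoidalPreadditive D] {e' : Y ⟶ Y} {y : Y ⟶ N}
    (h : e' ≫ y = 0) (m : ℕ) (p : Fin (m + 1)) :
    Y ◁ powMap e' (m + 1) ≫ moveTop Y (m + 2) (p.succ : Fin (m + 2)) ≫
      y ▷ tensorPow Y (m + 1) = 0 := by
  have h1 : swapTop Y m ≫ y ▷ (Y ⊗ tensorPow Y m) = Y ◁ (y ▷ tensorPow Y m) ≫
      (α_ _ _ _).inv ≫ (β_ Y N).hom ▷ _ ≫ (α_ _ _ _).hom := by
    simp only [swapTop, Category.assoc]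
    rw [associator_inv_naturality_middle_assoc, ← comp_whiskerRight_assoc,
      BraidedCategory.braiding_naturality_right, comp_whiskerRight_assoc,
      associator_naturality_left]
  have h2 : powMap e' (m + 1) ≫ y ▷ tensorPow Y m = 0 := by
    rw [powMap_succ, Category.assoc, whisker_exchange, ← comp_whiskerRight_assoc, h]
    simp
  rw [Fin.val_succ, moveTop_succ, Category.assoc]
  change _ ≫ _ ≫ Y ◁ _ ≫ _ = 0
  rw [whisker_exchange, reassoc_of% h1, ← whiskerLeft_comp_assoc, h2]
  simp

variable [MonoidalPreadditive D] [F.Additive]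

/-- A direct summand `F(N)` of the image of the idempotent of a partial splitting can be split
off. This lowers the degree of the relation. -/
def step (s : PartialSplitting F L X (n + 1)) {N : C} (hN : IsUnitSum L (s.U ⊞ N))
    (hNN : Nonempty (F.obj N ⊗ F.obj N ≅ 𝟙_ D)) (x : F.obj N ⟶ F.obj X) (y : F.obj X ⟶ F.obj N)
    (h : x ≫ s.e ≫ y = 𝟙 _) : PartialSplitting F L X n where
  U := s.U ⊞ N
  isUnitSum := hN
  i := F.map biprod.fst ≫ s.i + F.map biprod.snd ≫ x ≫ s.e
  r := s.r ≫ F.map biprod.inl + s.e ≫ y ≫ F.map biprod.inr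
  e := s.e - s.e ≫ y ≫ x ≫ s.e
  i_r := by
    have h1 : ∀ {Z : D} (f : F.obj X ⟶ Z), s.i ≫ s.e ≫ f = 0 := fun f => by
      rw [← Category.assoc, s.i_e, Limits.zero_comp]
    have h2 : ∀ {Z : D} (f : F.obj s.U ⟶ Z), s.e ≫ s.r ≫ f = 0 := fun f => by
      rw [← Category.assoc, s.e_r, Limits.zero_comp]
    have h3 : ∀ {Z : D} (f : F.obj X ⟶ Z), s.e ≫ s.e ≫ f = s.e ≫ f := fun f => by
      rw [← Category.assoc, s.e_e]
    have h4 : ∀ {Z : D} (f : F.obj N ⟶ Z), x ≫ s.e ≫ y ≫ f = f := fun f => by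
      rw [reassoc_of% h]
    have h5 : ∀ {Z : D} (f : F.obj s.U ⟶ Z), s.i ≫ s.r ≫ f = f := fun f => by
      rw [← Category.assoc, s.i_r, Category.id_comp]
    simp only [Preadditive.add_comp, Preadditive.comp_add, Category.assoc, h1, h2, h3, h4, h5,
      Limits.comp_zero, add_zero, zero_add]
    rw [← F.map_comp, ← F.map_comp, ← F.map_add, biprod.total, F.map_id]
  r_i := by
    have h1 : ∀ {Z : D} (f : F.obj s.U ⟶ Z), F.map biprod.inl ≫ F.map (biprod.fst (Y := N)) ≫ f =
        f := fun f => by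
      rw [← F.map_comp_assoc, biprod.inl_fst, F.map_id, Category.id_comp]
    have h2 : ∀ {Z : D} (f : F.obj N ⟶ Z), F.map biprod.inr ≫ F.map (biprod.snd (X := s.U)) ≫ f =
        f := fun f => by
      rw [← F.map_comp_assoc, biprod.inr_snd, F.map_id, Category.id_comp]
    have h3 : ∀ {Z : D} (f : F.obj N ⟶ Z), F.map biprod.inl ≫ F.map (biprod.snd (X := s.U)) ≫ f =
        0 := fun f => by
      rw [← F.map_comp_assoc, biprod.inl_snd, F.map_zero, Limits.zero_comp]
    have h4 : ∀ {Z : D} (f : F.obj s.U ⟶ Z), F.map biprod.inr ≫ F.map (biprod.fst (Y := N)) ≫ f =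
        0 := fun f => by
      rw [← F.map_comp_assoc, biprod.inr_fst, F.map_zero, Limits.zero_comp]
    simp only [Preadditive.add_comp, Preadditive.comp_add, Category.assoc, h1, h2, h3, h4,
      Limits.comp_zero, add_zero, zero_add]
    rw [← s.r_i]
    abel
  z := fun h => s.z ((0 : Fin (n + 1)).cycleRange.symm * Equiv.Perm.decomposeFin.symm (0, h))
  z_one := by
    rw [Equiv.Perm.decomposeFin_symm_of_one, ← s.z_one]
    congr 1
    ext a
    simp [Equiv.Perm.one_def]
  rel := by
    have hee : (s.e - s.e ≫ y ≫ x ≫ s.e) ≫ s.e = s.e - s.e ≫ y ≫ x ≫ s.e := by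
      simp only [Preadditive.sub_comp, Category.assoc, s.e_e]
    have hey : (s.e - s.e ≫ y ≫ x ≫ s.e) ≫ s.e ≫ y = 0 := by
      rw [← Category.assoc, hee, Preadditive.sub_comp, Category.assoc, Category.assoc,
        Category.assoc, h, Category.comp_id, sub_self]
    generalize s.e - s.e ≫ y ≫ x ≫ s.e = e' at hee hey
    -- it suffices to prove the relation after tensoring with the invertible object `F(N)`, where it
    -- follows from the given one by composing the first factor with the inclusion of `F(N)` and the
    -- projection to it, and the other factors with the new idempotent
    apply eq_zero_of_whiskerLeft_eq_zero hNN
    have h0 : (x ≫ s.e) ▷ tensorPow (F.obj X) n ≫ F.obj X ◁ powMap e' n ≫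
        powMap s.e (n + 1) = (x ≫ s.e) ▷ tensorPow (F.obj X) n ≫ F.obj X ◁ powMap e' n := by
      rw [powMap_succ, whisker_exchange_assoc, ← whiskerLeft_comp, ← powMap_comp, hee,
        ← comp_whiskerRight_assoc, Category.assoc, s.e_e]
    have h1 := (x ≫ s.e) ▷ tensorPow (F.obj X) n ≫= F.obj X ◁ powMap e' n ≫= s.rel =≫
      (s.e ≫ y) ▷ tensorPow (F.obj X) n
    simp only [Category.assoc, Limits.comp_zero, Limits.zero_comp] at h1
    rw [reassoc_of% h0] at h1
    have h6 : (x ≫ s.e) ≫ s.e ≫ y = 𝟙 _ := by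
      rw [Category.assoc, ← Category.assoc s.e, s.e_e, h]
    -- a permutation that moves the first factor brings the new idempotent in front of the
    -- projection, which kills it
    have h2 : ∀ (p : Fin n) (g : Equiv.Perm (Fin n)), F.obj X ◁ powMap e' n ≫
        permMap (F.obj X) (n + 1) (headTail n (p.succ, g)) ≫
          (s.e ≫ y) ▷ tensorPow (F.obj X) n = 0 := by
      intro p g
      obtain ⟨m, rfl⟩ : ∃ m, n = m + 1 := ⟨n - 1, by have := p.isLt; omega⟩
      have h3 := permMap_mul_eq (F.obj X) p.succ g
      have h4 : F.obj X ◁ powMap e' (m + 1) ≫ tailMap (F.obj X) (permMap (F.obj X) (m + 1) g) =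
          F.obj X ◁ permMap (F.obj X) (m + 1) g ≫ F.obj X ◁ powMap e' (m + 1) := by
        rw [tailMap, ← whiskerLeft_comp, ← whiskerLeft_comp, permMap_powMap]
      refine (congrArg (fun f => _ ≫ f ≫ _) h3).trans ?_
      rw [Category.assoc, reassoc_of% h4, whiskerRight_moveTop_comp hey, Limits.comp_zero]
    -- a permutation that fixes the first factor contributes a permutation of the others
    have h5 : ∀ g : Equiv.Perm (Fin n), (x ≫ s.e) ▷ tensorPow (F.obj X) n ≫
        F.obj X ◁ powMap e' n ≫ permMap (F.obj X) (n + 1) (headTail n (0, g)) ≫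
          (s.e ≫ y) ▷ tensorPow (F.obj X) n =
        F.obj N ◁ (powMap e' n ≫ permMap (F.obj X) n g) := by
      intro g
      have h3 := permMap_mul_eq (F.obj X) 0 g
      refine (congrArg (fun f => _ ≫ _ ≫ f ≫ _) h3).trans ?_
      rw [Fin.val_zero, moveTop_zero, Category.comp_id, tailMap, whisker_exchange,
        whisker_exchange_assoc, ← comp_whiskerRight_assoc, h6, id_whiskerRight, Category.id_comp,
        whiskerLeft_comp]
    rw [← h1, ← Equiv.sum_comp (headTail n), Fintype.sum_prod_type, Fin.sum_univ_succ]
    simp only [Preadditive.add_comp, Preadditive.comp_add, Preadditive.sum_comp,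
      Preadditive.comp_sum, Preadditive.zsmul_comp, Preadditive.comp_zsmul, h2, h5,
      smul_zero, Finset.sum_const_zero, add_zero, whiskerLeft_sum,
      whiskerLeft_zsmul]
    rfl

end PartialSplitting

omit [SymmetricCategory D] [Preadditive D] in
/-- A unit summand of a power of an idempotent, tensored with an invertible object, gives an
invertible summand of the idempotent. -/
lemma exists_splitting_of_whiskerRight {X M : D} (hM : Nonempty (M ⊗ M ≅ 𝟙_ D)) (e : X ⟶ X)
    (x : 𝟙_ D ⟶ X ⊗ M) (y : X ⊗ M ⟶ 𝟙_ D) (h : x ≫ e ▷ M ≫ y = 𝟙 _) :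
    ∃ (x' : M ⟶ X) (y' : X ⟶ M), x' ≫ e ≫ y' = 𝟙 _ := by
  obtain ⟨j⟩ := hM
  refine ⟨(λ_ M).inv ≫ x ▷ M ≫ (α_ _ _ _).hom ≫ X ◁ j.hom ≫ (ρ_ X).hom,
    (ρ_ X).inv ≫ X ◁ j.inv ≫ (α_ _ _ _).inv ≫ y ▷ M ≫ (λ_ M).hom, ?_⟩
  have h1 : X ◁ j.hom ≫ (ρ_ X).hom ≫ e ≫ (ρ_ X).inv ≫ X ◁ j.inv = e ▷ (M ⊗ M) := by
    rw [← rightUnitor_naturality_assoc, Iso.hom_inv_id_assoc, whisker_exchange_assoc,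
      ← whiskerLeft_comp, Iso.hom_inv_id, whiskerLeft_id, Category.comp_id]
  simp only [Category.assoc]
  rw [reassoc_of% h1, ← associator_naturality_left_assoc, Iso.hom_inv_id_assoc,
    ← comp_whiskerRight_assoc, ← comp_whiskerRight_assoc, Category.assoc, h]
  simp

omit [SymmetricCategory D] [Preadditive D] [SymmetricCategory D'] [Preadditive D'] in
/-- If `e ⊗ M`, for an invertible object `M`, has a unit summand after application of a tensor
functor, then `e` has the image of `M` as a summand there. -/
lemma exists_map_splitting {X M : D} (hM : Nonempty (M ⊗ M ≅ 𝟙_ D)) (e : X ⟶ X) (G : D ⥤ D')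
    [G.Monoidal] (x : 𝟙_ D' ⟶ G.obj (X ⊗ M)) (y : G.obj (X ⊗ M) ⟶ 𝟙_ D')
    (h : x ≫ G.map (e ▷ M) ≫ y = 𝟙 _) :
    ∃ (x' : G.obj M ⟶ G.obj X) (y' : G.obj X ⟶ G.obj M), x' ≫ G.map e ≫ y' = 𝟙 _ := by
  obtain ⟨j⟩ := hM
  refine exists_splitting_of_whiskerRight
    ⟨Functor.Monoidal.μIso G M M ≪≫ G.mapIso j ≪≫ (Functor.Monoidal.εIso G).symm⟩ (G.map e)
    (x ≫ Functor.OplaxMonoidal.δ G X M) (Functor.LaxMonoidal.μ G X M ≫ y) ?_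
  rw [← h, Functor.Monoidal.map_whiskerRight]
  simp

end Splitting

/-! ### Presheaves with Day convolution, in terms of elements -/

namespace Day

open LawfulDayConvolutionMonoidalCategoryStruct

variable {C : Type u} [SmallCategory C] [MonoidalCategory C]

/-- The elements of a presheaf over an object. -/
abbrev Pts (F : DayFunctor Cᵒᵖ (Type u)) (U : C) : Type u := F.functor.obj (op U)

lemma congr_pt {S T : Type u} {f g : S ⟶ T} (h : f = g) (x : S) : f x = g x := by rw [h]

/-- A pair of elements. -/
abbrev prod {S T : Type u} (a : S) (b : T) : S × T := (a, b)

variable {F G H K : DayFunctor Cᵒᵖ (Type u)} {U V W : C}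

/-- The restriction of elements along a morphism. -/
def res (F : DayFunctor Cᵒᵖ (Type u)) (f : U ⟶ V) (a : Pts F V) : Pts F U := F.functor.map f.op a

/-- The action of a morphism of presheaves on elements. -/
def ev (α : F ⟶ G) (a : Pts F U) : Pts G U := α.natTrans.app (op U) a

lemma res_id (a : Pts F U) : res F (𝟙 U) a = a := by
  rw [res, op_id, F.functor.map_id]; rfl

lemma res_res (f : U ⟶ V) (g : V ⟶ W) (a : Pts F W) : res F f (res F g a) = res F (f ≫ g) a := by
  rw [res, res, res, op_comp, F.functor.map_comp]; rfl

lemma ev_comp (α : F ⟶ G) (β : G ⟶ H) (a : Pts F U) : ev (α ≫ β) a = ev β (ev α a) := rfl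

lemma ev_res (α : F ⟶ G) (f : U ⟶ V) (a : Pts F V) : ev α (res F f a) = res G f (ev α a) :=
  congr_pt (α.natTrans.naturality f.op) a

lemma hom_ext {α β : F ⟶ G} (h : ∀ (U : C) (a : Pts F U), ev α a = ev β a) : α = β := by
  apply DayFunctor.hom_ext
  ext U a
  exact h U.unop a

/-- A morphism of presheaves, from its action on elements. -/
def mkHom (φ : ∀ U : C, Pts F U → Pts G U)
    (h : ∀ {U V : C} (f : U ⟶ V) (a : Pts F V), φ U (res F f a) = res G f (φ V a)) : F ⟶ G :=
  ⟨{ app := fun U => ↾(φ U.unop)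
     naturality := fun U V f => by ext a; exact h f.unop a }⟩

/-- The external product of elements. -/
def pair (a : Pts F U) (b : Pts G V) : Pts (F ⊗ G) (U ⊗ V) :=
  (DayFunctor.η F G).app (op U, op V) (prod a b)

lemma pair_res_left (f : U ⟶ V) (a : Pts F V) (b : Pts G W) :
    pair (res F f a) b = res (F ⊗ G) (f ▷ W) (pair a b) := by
  have := congr_pt ((DayFunctor.η F G).naturality
    (X := (op V, op W)) (Y := (op U, op W)) (f.op, 𝟙 _)) (prod a b)
  refine Eq.trans ?_ (this.trans ?_)
  · change pair _ _ = pair _ (res G (𝟙 W) b)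
    rw [res_id]; rfl
  · change res (F ⊗ G) (f ⊗ₘ 𝟙 W) (pair a b) = _
    rw [tensorHom_id]

lemma pair_res_right (f : U ⟶ V) (a : Pts F W) (b : Pts G V) :
    pair a (res G f b) = res (F ⊗ G) (W ◁ f) (pair a b) := by
  have := congr_pt ((DayFunctor.η F G).naturality
    (X := (op W, op V)) (Y := (op W, op U)) (𝟙 _, f.op)) (prod a b)
  refine Eq.trans ?_ (this.trans ?_)
  · change pair _ _ = pair (res F (𝟙 W) a) _
    rw [res_id]; rfl
  · change res (F ⊗ G) (𝟙 W ⊗ₘ f) (pair a b) = _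
    rw [id_tensorHom]

lemma ev_whiskerRight (α : F ⟶ G) (a : Pts F U) (b : Pts H V) :
    ev (α ▷ H) (pair a b) = pair (ev α a) b :=
  congr_pt (convolutionExtensionUnit_comp_ι_map_whiskerRight_app Cᵒᵖ (Type u) α H
    (op U) (op V)) (prod a b)

lemma ev_whiskerLeft (α : F ⟶ G) (a : Pts H U) (b : Pts F V) :
    ev (H ◁ α) (pair a b) = pair a (ev α b) :=
  congr_pt (convolutionExtensionUnit_comp_ι_map_whiskerLeft_app (Type u) H α
    (op U) (op V)) (prod a b)

lemma ev_associator_hom (a : Pts F U) (b : Pts G V) (c : Pts H W) :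
    ev (α_ F G H).hom (pair (pair a b) c) = res _ (α_ U V W).hom (pair a (pair b c)) :=
  congr_pt (associator_hom_unit_unit (Type u) F G H
    (op U) (op V) (op W)) (prod (prod a b) c)

variable (C) in
/-- The universal element of the unit presheaf. -/
def one : Pts (𝟙_ (DayFunctor Cᵒᵖ (Type u))) (𝟙_ C) := DayFunctor.ν Cᵒᵖ (Type u) PUnit.unit

lemma ev_leftUnitor (a : Pts F U) : ev (λ_ F).hom (pair (one C) a) = res F (λ_ U).hom a :=
  congr_pt (leftUnitor_hom_unit_app (Type u) F (op U)) (prod PUnit.unit a)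

lemma tensor_hom_ext {α β : F ⊗ G ⟶ H}
    (h : ∀ (U V : C) (a : Pts F U) (b : Pts G V), ev α (pair a b) = ev β (pair a b)) : α = β :=
  DayFunctor.tensor_hom_ext fun U V => by
    ext ⟨a, b⟩
    exact h U.unop V.unop a b

/-- The presheaf `U ↦ F(U ⊗ W)`. -/
def shift (F : DayFunctor Cᵒᵖ (Type u)) (W : C) : DayFunctor Cᵒᵖ (Type u) :=
  ⟨(tensorRight W).op ⋙ F.functor⟩

/-- Morphisms from a threefold tensor product are determined by their values on products of three
elements: for a fixed third element they are morphisms from a twofold product to a shifted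
presheaf. -/
lemma tensor_tensor_hom_ext {α β : (F ⊗ G) ⊗ H ⟶ K}
    (h : ∀ (U V W : C) (a : Pts F U) (b : Pts G V) (c : Pts H W),
      ev α (pair (pair a b) c) = ev β (pair (pair a b) c)) : α = β := by
  refine tensor_hom_ext fun U W x c => ?_
  let φ (γ : (F ⊗ G) ⊗ H ⟶ K) : F ⊗ G ⟶ shift K W :=
    mkHom (fun U x => (ev γ (pair x c) : Pts K (U ⊗ W))) (fun f x => by
      rw [pair_res_left, ev_res]; rfl)
  have : φ α = φ β := tensor_hom_ext fun U V a b => h U V W a b c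
  exact congrArg (fun γ => ev γ x) this

/-- The morphism from a tensor product given by a natural family of pairings. -/
def desc (φ : ∀ U V : C, Pts F U → Pts G V → Pts H (U ⊗ V))
    (h : ∀ {U U' V V' : C} (f : U ⟶ U') (g : V ⟶ V') (a : Pts F U') (b : Pts G V'),
      φ U V (res F f a) (res G g b) = res H (f ⊗ₘ g) (φ U' V' a b)) : F ⊗ G ⟶ H :=
  DayFunctor.tensorDesc
    { app := fun X => ↾fun x => φ X.1.unop X.2.unop x.1 x.2
      naturality := fun X Y f => by
        ext ⟨a, b⟩
        exact h f.1.unop f.2.unop a b }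

lemma ev_desc (φ : ∀ U V : C, Pts F U → Pts G V → Pts H (U ⊗ V))
    (h : ∀ {U U' V V' : C} (f : U ⟶ U') (g : V ⟶ V') (a : Pts F U') (b : Pts G V'),
      φ U V (res F f a) (res G g b) = res H (f ⊗ₘ g) (φ U' V' a b)) (a : Pts F U) (b : Pts G V) :
    ev (desc φ h) (pair a b) = φ U V a b :=
  congr_pt (DayFunctor.η_comp_tensorDesc_app _ (op U) (op V)) (prod a b)

/-- The morphism from the unit given by an element. -/
def unitDesc (x : Pts F (𝟙_ C)) : 𝟙_ _ ⟶ F := DayFunctor.unitDesc (↾fun _ => x)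

lemma ev_unitDesc (x : Pts F (𝟙_ C)) : ev (unitDesc x) (one C) = x :=
  congr_pt (DayFunctor.ν_comp_unitDesc (F := F) (↾fun _ => x)) PUnit.unit

/-- Elements of the unit presheaf and of a presheaf `F` are pulled back from pairs with the
universal element. -/
lemma unit_tensor_hom_ext {α β : 𝟙_ _ ⊗ F ⟶ G}
    (h : ∀ (U : C) (a : Pts F U), ev α (pair (one C) a) = ev β (pair (one C) a)) : α = β := by
  rw [← cancel_epi (λ_ F).inv]
  refine hom_ext fun U a => ?_
  have h1 : ev (λ_ F).inv a = res _ (λ_ U).inv (pair (one C) a) := by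
    have h := congrArg (fun x => ev (λ_ F).inv (res _ (λ_ U).inv x)) (ev_leftUnitor a)
    simp only [← ev_res, ← ev_comp, Iso.hom_inv_id, res_res, Iso.inv_hom_id, res_id] at h
    exact h.symm
  rw [ev_comp, ev_comp, h1, ev_res, ev_res, h]

/-- The commutativity constraint exchanges the elements of a pair. -/
lemma ev_braiding [BraidedCategory C] (a : Pts F U) (b : Pts G V) :
    ev (β_ F G).hom (pair a b) = res _ (β_ U V).hom (pair b a) := by
  let inst (F G : DayFunctor Cᵒᵖ (Type u)) :
    DayConvolution F.functor G.functor := convolution Cᵒᵖ (Type u) _ F G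
  exact congr_pt (DayConvolution.unit_app_braiding_hom_app F.functor G.functor
    (op U) (op V)) (prod a b)

end Day

/-! ### The algebra of a tensor functor -/

namespace Day

section Pre

variable {C : Type u} [SmallCategory C] [MonoidalCategory C]
  {D : Type u} [SmallCategory D]

/-- The presheaf `V ↦ Hom(F(V), Y)`. -/
def pre (F : C ⥤ D) (Y : D) : DayFunctor Cᵒᵖ (Type u) := ⟨F.op ⋙ yoneda.obj Y⟩

variable {F : C ⥤ D} {Y Z : D} {U V : C}

/-- A morphism as an element of the presheaf. -/
def el (a : F.obj V ⟶ Y) : Pts (pre F Y) V := a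

/-- An element of the presheaf as a morphism. -/
def mor (a : Pts (pre F Y) V) : F.obj V ⟶ Y := a

lemma mor_el (a : F.obj V ⟶ Y) : mor (el a) = a := rfl

lemma res_el (f : U ⟶ V) (a : F.obj V ⟶ Y) : res _ f (el a) = el (F.map f ≫ a) := rfl

variable (F) in
/-- The functoriality of `V ↦ Hom(F(V), Y)` in `Y`. -/
def preMap (f : Y ⟶ Z) : pre F Y ⟶ pre F Z :=
  mkHom (fun _ a => el (mor a ≫ f)) fun g a => congrArg el (Category.assoc (F.map g) (mor a) f)

lemma ev_preMap (f : Y ⟶ Z) (a : F.obj V ⟶ Y) : ev (preMap F f) (el a) = el (a ≫ f) := rfl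

variable (F) in
/-- The functoriality of `V ↦ Hom(F(V), Y)` in `Y`, for isomorphisms. -/
def preMapIso (f : Y ≅ Z) : pre F Y ≅ pre F Z where
  hom := preMap F f.hom
  inv := preMap F f.inv
  hom_inv_id := hom_ext fun U (a : F.obj U ⟶ Y) =>
    (by simp : (a ≫ f.hom) ≫ f.inv = a)
  inv_hom_id := hom_ext fun U (a : F.obj U ⟶ Z) =>
    (by simp : (a ≫ f.inv) ≫ f.hom = a)

variable (F) in
/-- The restriction of the functor `F` to morphisms to `X`. -/
def preYoneda (X : C) : toInd X ⟶ pre F (F.obj X) :=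
  mkHom (fun _ u => el (F.map u)) fun f u => F.map_comp f u

/-- A morphism as an element of a representable presheaf. -/
def yel {X : C} (u : V ⟶ X) : Pts (toInd X) V := u

lemma res_yel {X : C} (f : U ⟶ V) (u : V ⟶ X) : res _ f (yel u) = yel (f ≫ u) := rfl

lemma ev_preYoneda {X : C} (u : V ⟶ X) : ev (preYoneda F X) (yel u) = el (F.map u) := rfl

open Functor.OplaxMonoidal

variable [MonoidalCategory D] [F.Monoidal]

variable (F Y) in
lemma preAct_natural {U U' V V' : C} (f : U ⟶ U') (g : V ⟶ V') (a : Pts (pre F (𝟙_ D)) U')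
    (b : Pts (pre F Y) V') :
    el (δ F U V ≫ (mor (res _ f a) ⊗ₘ mor (res _ g b)) ≫ (λ_ Y).hom) =
      res (pre F Y) (f ⊗ₘ g) (el (δ F U' V' ≫ (mor a ⊗ₘ mor b) ≫ (λ_ Y).hom)) := by
  change δ F _ _ ≫ (F.map f ≫ mor a ⊗ₘ F.map g ≫ mor b) ≫ _ =
    F.map (f ⊗ₘ g) ≫ δ F _ _ ≫ (mor a ⊗ₘ mor b) ≫ _
  rw [← tensorHom_comp_tensorHom, Category.assoc, ← δ_natural_assoc]

variable (F Y) in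
/-- The action of the presheaf `V ↦ Hom(F(V), 𝟙)` on the presheaf `V ↦ Hom(F(V), Y)`. -/
def preAct : pre F (𝟙_ D) ⊗ pre F Y ⟶ pre F Y :=
  desc (fun U V a b => el (δ F U V ≫ (mor a ⊗ₘ mor b) ≫ (λ_ Y).hom)) (preAct_natural F Y)

lemma ev_preAct (a : F.obj U ⟶ 𝟙_ D) (b : F.obj V ⟶ Y) :
    ev (preAct F Y) (pair (el a) (el b)) = el (δ F U V ≫ (a ⊗ₘ b) ≫ (λ_ Y).hom) :=
  ev_desc _ (preAct_natural F Y) _ _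

variable (F) in
/-- The unit of the presheaf of algebras `V ↦ Hom(F(V), 𝟙)`. -/
def preOne : 𝟙_ _ ⟶ pre F (𝟙_ D) := unitDesc (el (η F))

lemma preOne_preAct : preOne F ▷ pre F Y ≫ preAct F Y = (λ_ _).hom := by
  refine unit_tensor_hom_ext fun U (a : F.obj U ⟶ Y) => ?_
  change ev _ (pair _ (el a)) = ev _ (pair _ (el a))
  rw [ev_comp, ev_whiskerRight, preOne, ev_unitDesc, ev_preAct, ev_leftUnitor, res_el]
  congr 1
  rw [MonoidalCategory.tensorHom_def, Category.assoc, leftUnitor_naturality]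
  simp

lemma preAct_preAct : preAct F (𝟙_ D) ▷ pre F Y ≫ preAct F Y =
    (α_ _ _ _).hom ≫ pre F (𝟙_ D) ◁ preAct F Y ≫ preAct F Y := by
  refine tensor_tensor_hom_ext fun U V W (a : F.obj U ⟶ 𝟙_ D) (b : F.obj V ⟶ 𝟙_ D)
    (c : F.obj W ⟶ Y) => ?_
  change ev _ (pair (pair (el a) (el b)) (el c)) = ev _ (pair (pair (el a) (el b)) (el c))
  rw [ev_comp, ev_comp, ev_comp, ev_whiskerRight, ev_preAct, ev_preAct, ev_associator_hom,
    ev_res, ev_whiskerLeft, ev_preAct, ev_res, ev_preAct, res_el]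
  congr 1
  simp only [MonoidalCategory.tensorHom_def, comp_whiskerRight, Category.assoc,
    MonoidalCategory.whiskerLeft_comp]
  rw [← whisker_exchange_assoc a (δ F V W), ← Functor.OplaxMonoidal.associativity_assoc]
  congr 2
  simp only [whiskerRight_tensor, Category.assoc]
  monoidal

lemma preMap_preAct (f : Y ⟶ Z) :
    preAct F Y ≫ preMap F f = pre F (𝟙_ D) ◁ preMap F f ≫ preAct F Z := by
  refine tensor_hom_ext fun U V (a : F.obj U ⟶ 𝟙_ D) (b : F.obj V ⟶ Y) => ?_
  change ev _ (pair (el a) (el b)) = ev _ (pair (el a) (el b))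
  rw [ev_comp, ev_comp, ev_preAct, ev_whiskerLeft, ev_preMap, ev_preMap, ev_preAct]
  congr 1
  simp [MonoidalCategory.tensorHom_def]

end Pre

section Braided

variable {C : Type u} [SmallCategory C] [MonoidalCategory C] [SymmetricCategory C]
  {D : Type u} [SmallCategory D] [MonoidalCategory D] [SymmetricCategory D]
  {F : C ⥤ D} [F.Braided]

lemma braiding_preAct : (β_ _ _).hom ≫ preAct F (𝟙_ D) = preAct F (𝟙_ D) := by
  refine tensor_hom_ext fun U V (a : F.obj U ⟶ 𝟙_ D) (b : F.obj V ⟶ 𝟙_ D) => ?_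
  change ev _ (pair (el a) (el b)) = ev _ (pair (el a) (el b))
  rw [ev_comp, ev_braiding, ev_res, ev_preAct, ev_preAct, res_el]
  congr 1
  have h : F.map (β_ U V).hom ≫ Functor.OplaxMonoidal.δ F V U =
      Functor.OplaxMonoidal.δ F U V ≫ (β_ (F.obj U) (F.obj V)).hom := by
    rw [Functor.map_braiding]; simp
  rw [reassoc_of% h, ← BraidedCategory.braiding_naturality_assoc]
  congr 2
  rw [braiding_leftUnitor, unitors_equal]

/-- The commutative algebra `V ↦ Hom(F(V), 𝟙)` in the category of presheaves. -/
@[reducible] def preMon (F : C ⥤ D) [F.Braided] : MonObj (pre F (𝟙_ D)) where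
  one := preOne F
  mul := preAct F (𝟙_ D)
  one_mul := preOne_preAct
  mul_one := by
    rw [← braiding_preAct, BraidedCategory.braiding_naturality_right_assoc, preOne_preAct]
    simp
  mul_assoc := preAct_preAct

end Braided

end Day

namespace Day

section Theta

variable {C : Type u} [SmallCategory C] [MonoidalCategory C]
  {D : Type u} [SmallCategory D] [MonoidalCategory D]
  (F : C ⥤ D) [F.Monoidal]

open Functor.OplaxMonoidal Functor.LaxMonoidal

/-- The comparison of the free module on `X` over the algebra of `F` with the presheaf
`V ↦ Hom(F(V), F(X))`. -/
def compare (X : C) : pre F (𝟙_ D) ⊗ toInd X ⟶ pre F (F.obj X) :=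
  pre F (𝟙_ D) ◁ preYoneda F X ≫ preAct F (F.obj X)

variable {F} {V U Y X : C}

lemma ev_compare (a : F.obj U ⟶ 𝟙_ D) (u : V ⟶ X) :
    ev (compare F X) (pair (el a) (yel u)) = el (δ F U V ≫ (a ⊗ₘ F.map u) ≫ (λ_ _).hom) := by
  rw [compare, ev_comp, ev_whiskerLeft, ev_preYoneda, ev_preAct]

omit [F.Monoidal] in
lemma pair_el_yel (a : F.obj U ⟶ 𝟙_ D) (u : V ⟶ X) :
    pair (el a) (yel u) = res _ (U ◁ u) (pair (el a) (yel (𝟙 X))) := by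
  rw [← pair_res_right, res_yel, Category.comp_id]

variable [ExactPairing Y X]

variable (V Y X) in
/-- The morphism `V ⟶ V ⊗ Y ⊗ X` given by the coevaluation. -/
def insertPair : V ⟶ (V ⊗ Y) ⊗ X := (ρ_ V).inv ≫ V ◁ η_ Y X ≫ (α_ V Y X).inv

/-- The point of the algebra that corresponds by duality to a morphism to `F(X)`. -/
def dualPoint (Y : C) [ExactPairing Y X] (m : F.obj V ⟶ F.obj X) : F.obj (V ⊗ Y) ⟶ 𝟙_ D :=
  δ F V Y ≫ m ▷ F.obj Y ≫ μ F X Y ≫ F.map (ε_ Y X) ≫ η F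

/-- A morphism to `F(X)` is recovered from its dual point, by a triangle identity. -/
lemma map_insertPair_dualPoint (m : F.obj V ⟶ F.obj X) :
    F.map (insertPair V Y X) ≫ δ F (V ⊗ Y) X ≫ dualPoint Y m ▷ F.obj X ≫ (λ_ _).hom = m := by
  have key (V : C) : F.map (insertPair V Y X) ≫ δ F (V ⊗ Y) X ≫ δ F V Y ▷ F.obj X =
      (ρ_ _).inv ≫ F.obj V ◁ (ε F ≫ F.map (η_ Y X) ≫ δ F Y X) ≫ (α_ _ _ _).inv := by
    rw [insertPair, F.map_comp, F.map_comp, Category.assoc, Category.assoc,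
      ← Functor.OplaxMonoidal.associativity_inv, ← δ_natural_right_assoc,
      Functor.OplaxMonoidal.right_unitality]
    simp
  have hm : F.map (insertPair V Y X) ≫ δ F (V ⊗ Y) X ≫ dualPoint Y m ▷ F.obj X =
      m ≫ F.map (insertPair X Y X) ≫ δ F (X ⊗ Y) X ≫ (F.map (ε_ Y X) ≫ η F) ▷ F.obj X := by
    have h2 : (F.map (ε_ Y X) ≫ η F) = δ F X Y ≫ μ F X Y ≫ F.map (ε_ Y X) ≫ η F := by simp
    rw [h2, dualPoint, comp_whiskerRight, comp_whiskerRight, reassoc_of% key V,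
      comp_whiskerRight (δ F X Y), reassoc_of% key X, ← associator_inv_naturality_left_assoc,
      whisker_exchange_assoc, rightUnitor_inv_naturality_assoc]
  rw [reassoc_of% hm, comp_whiskerRight, Category.assoc, δ_natural_left_assoc,
    Functor.OplaxMonoidal.left_unitality_hom]
  simp only [← F.map_comp]
  have : insertPair X Y X ≫ ε_ Y X ▷ X ≫ (λ_ X).hom = 𝟙 X := by
    simp [insertPair]
  rw [this, F.map_id, Category.comp_id]

lemma dualPoint_map (a : F.obj U ⟶ 𝟙_ D) :
    dualPoint Y (δ F U X ≫ (a ⊗ₘ F.map (𝟙 X)) ≫ (λ_ _).hom) =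
      F.map ((α_ U X Y).hom ≫ U ◁ ε_ Y X ≫ (ρ_ U).hom) ≫ a := by
  have h : δ F (U ⊗ X) Y ≫ δ F U X ▷ F.obj Y =
      F.map (α_ U X Y).hom ≫ δ F U (X ⊗ Y) ≫ F.obj U ◁ δ F X Y ≫ (α_ _ _ _).inv := by
    rw [← Functor.OplaxMonoidal.associativity_assoc]; simp
  rw [dualPoint, F.map_id, tensorHom_id, comp_whiskerRight, comp_whiskerRight, Category.assoc,
    reassoc_of% h, Category.assoc, ← associator_inv_naturality_left_assoc]
  have e : (α_ (𝟙_ D) (F.obj X) (F.obj Y)).inv ≫ (λ_ (F.obj X)).hom ▷ F.obj Y = (λ_ _).hom := by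
    rw [leftUnitor_tensor_hom]
  rw [reassoc_of% e, whisker_exchange_assoc, leftUnitor_naturality_assoc,
    Functor.Monoidal.δ_μ_assoc, ← leftUnitor_naturality_assoc, ← leftUnitor_naturality,
    ← whisker_exchange_assoc, ← whisker_exchange_assoc, δ_natural_right_assoc, unitors_equal,
    rightUnitor_naturality, Functor.OplaxMonoidal.right_unitality_hom_assoc, F.map_comp, F.map_comp,
    Category.assoc, Category.assoc]

lemma insertPair_evaluation :
    insertPair (V ⊗ X) Y X ≫ ((α_ V X Y).hom ≫ V ◁ ε_ Y X ≫ (ρ_ V).hom) ▷ X = 𝟙 _ := by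
  have h : V ◁ ((ρ_ X).inv ≫ (X ◁ η_ Y X ≫ (α_ X Y X).inv ≫ ε_ Y X ▷ X) ≫ (λ_ X).hom) =
      V ◁ ((ρ_ X).inv ≫ ((ρ_ X).hom ≫ (λ_ X).inv) ≫ (λ_ X).hom) := by
    rw [ExactPairing.coevaluation_evaluation]
  refine Eq.trans ?_ (h.trans ?_)
  · rw [insertPair]; monoidal
  · monoidal

lemma insertPair_naturality (f : U ⟶ V) :
    insertPair U Y X ≫ (f ▷ Y) ▷ X = f ≫ insertPair V Y X := by
  rw [insertPair, insertPair]
  simp only [Category.assoc]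
  rw [← associator_inv_naturality_left, whisker_exchange_assoc,
    rightUnitor_inv_naturality_assoc]

variable (F Y X) in
/-- The inverse of the comparison morphism. -/
def compareInv : pre F (F.obj X) ⟶ pre F (𝟙_ D) ⊗ toInd X :=
  mkHom (fun V m => res _ (insertPair V Y X) (pair (el (dualPoint Y (mor m))) (yel (𝟙 X))))
    fun {U V} f m => by
      have : dualPoint Y (F.map f ≫ mor m) = F.map (f ▷ Y) ≫ dualPoint Y (mor m) := by
        simp [dualPoint]
      change res _ _ (pair (el (dualPoint Y (F.map f ≫ mor m))) _) = _
      rw [this, ← res_el, pair_res_left, res_res, res_res, insertPair_naturality]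

variable (F Y X) in
/-- The free module on `X` over the algebra of `F` is the presheaf `V ↦ Hom(F(V), F(X))`. -/
def compareIso : pre F (𝟙_ D) ⊗ toInd X ≅ pre F (F.obj X) where
  hom := compare F X
  inv := compareInv F Y X
  hom_inv_id := by
    refine tensor_hom_ext fun U V (a : F.obj U ⟶ 𝟙_ D) (u : V ⟶ X) => ?_
    change ev _ (pair (el a) (yel u)) = ev _ (pair (el a) (yel u))
    rw [pair_el_yel, ev_res, ev_res, ev_comp, ev_compare]
    change res _ _ (res _ (insertPair (U ⊗ X) Y X) (pair (el (dualPoint Y _)) _)) = _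
    rw [mor_el, dualPoint_map, ← res_el, pair_res_left, res_res, res_res, Category.assoc,
      insertPair_evaluation, Category.comp_id]
    rfl
  inv_hom_id := by
    refine hom_ext fun V (m : F.obj V ⟶ F.obj X) => ?_
    change ev (compareInv F Y X ≫ _) (el m) = el m
    rw [ev_comp]
    change ev _ (res _ _ (pair (el (dualPoint Y m)) _)) = el m
    rw [ev_res, ev_compare, res_el, F.map_id, tensorHom_id, map_insertPair_dualPoint]

variable (F) in
lemma freeModule_smul_compare (X : C) :
    ((α_ _ _ _).inv ≫ preAct F (𝟙_ D) ▷ toInd X) ≫ compare F X =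
      pre F (𝟙_ D) ◁ compare F X ≫ preAct F (F.obj X) := by
  rw [compare, Category.assoc, ← whisker_exchange_assoc, preAct_preAct]
  simp

end Theta

section Modules

variable {C : Type u} [SmallCategory C] [MonoidalCategory C] [SymmetricCategory C]
  {D : Type u} [SmallCategory D] [MonoidalCategory D] [SymmetricCategory D]
  (F : C ⥤ D) [F.Braided]

/-- An isomorphism of free modules, from a linear isomorphism of the underlying objects. -/
def freeModuleIso {M : Type*} [Category* M] [MonoidalCategory M] (A : M) [MonObj A] {X Y : M}
    (e : A ⊗ X ≅ A ⊗ Y) (h : ((α_ A A X).inv ≫ MonObj.mul ▷ X) ≫ e.hom =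
      A ◁ e.hom ≫ (α_ A A Y).inv ≫ MonObj.mul ▷ Y) : freeModule A X ≅ freeModule A Y where
  hom := Mod.Hom.mk' (M := freeModule A X) (N := freeModule A Y) e.hom h
  inv := Mod.Hom.mk' (M := freeModule A Y) (N := freeModule A X) e.inv (by
    change ((α_ A A Y).inv ≫ MonObj.mul ▷ Y) ≫ e.inv =
      A ◁ e.inv ≫ (α_ A A X).inv ≫ MonObj.mul ▷ X
    rw [Iso.comp_inv_eq, Category.assoc, h, ← whiskerLeft_comp_assoc]
    simp)
  hom_inv_id := Mod.Hom.ext e.hom_inv_id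
  inv_hom_id := Mod.Hom.ext e.inv_hom_id

/-- The isomorphism of free modules given by an isomorphism between the values of the functor. -/
def freeModulePreIso {X Y X' Y' : C} [ExactPairing X' X] [ExactPairing Y' Y]
    (f : F.obj X ≅ F.obj Y) :
    let _ := preMon F
    freeModule (pre F (𝟙_ D)) (toInd X) ≅ freeModule (pre F (𝟙_ D)) (toInd Y) :=
  let _ := preMon F
  freeModuleIso _ (compareIso F X' X ≪≫ preMapIso F f ≪≫ (compareIso F Y' Y).symm) (by
    simp only [Iso.trans_hom, Iso.symm_hom]
    rw [← cancel_mono (compareIso F Y' Y).hom]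
    simp only [Category.assoc, Iso.inv_hom_id, Category.comp_id]
    have h1 := freeModule_smul_compare F X
    have h2 := freeModule_smul_compare F Y
    have h3 := preMap_preAct (F := F) f.hom
    change _ ≫ preAct F (𝟙_ D) ▷ toInd X ≫ compare F X ≫ preMap F f.hom = _ ◁ (compare F X ≫
      preMap F f.hom ≫ (compareIso F Y' Y).inv) ≫ _ ≫ preAct F (𝟙_ D) ▷ toInd Y ≫ compare F Y
    rw [Category.assoc] at h1 h2
    rw [h2, reassoc_of% h1, h3, ← whiskerLeft_comp_assoc, ← whiskerLeft_comp_assoc]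
    congr 2
    change _ = (compare F X ≫ preMap F f.hom ≫ (compareIso F Y' Y).inv) ≫ (compareIso F Y' Y).hom
    simp)

end Modules

end Day

/-! ### From isomorphisms under a tensor functor to local isomorphisms -/

section LocalIso

variable {C : Type u} [SmallCategory C] [Abelian C] [MonoidalCategory C]
  {D : Type u} [SmallCategory D] [MonoidalCategory D]
  [Preadditive D] {F : C ⥤ D} [F.Additive]

/-- The presheaf of algebras of a functor that preserves cokernels is an ind-object. -/
lemma PreservesCokernels.isIndObject (hF : PreservesCokernels F) :
    IsIndObject (Day.pre F (𝟙_ D)).functor := by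
  rw [isIndObject_iff_preservesFiniteLimits]
  let G : Cᵒᵖ ⥤ AddCommGrpCat.{u} := F.op ⋙ preadditiveYoneda.obj (𝟙_ D)
  have : G.Additive := inferInstance
  have hG : PreservesFiniteLimits G := by
    rw [Functor.preservesFiniteLimits_iff_forall_exact_map_and_mono]
    intro S hS
    have hex := hS.exact.unop
    have := hS.mono_f
    have := hS.epi_g
    have : Epi S.unop.g := inferInstanceAs (Epi S.f.unop)
    -- `S.f` is the opposite of a cokernel of the opposite of `S.g`
    let e : cokernel S.g.unop ≅ unop S.X₁ :=
      IsColimit.coconePointUniqueUpToIso (cokernelIsCokernel _) hex.gIsCokernel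
    have he : cokernel.π S.g.unop ≫ e.hom = S.f.unop :=
      IsColimit.comp_coconePointUniqueUpToIso_hom (cokernelIsCokernel S.g.unop) hex.gIsCokernel
        WalkingParallelPair.one
    have he' : S.f.unop ≫ e.inv = cokernel.π S.g.unop := by rw [← he]; simp
    constructor
    · rw [ShortComplex.ab_exact_iff]
      intro (x : F.obj (unop S.X₂) ⟶ 𝟙_ D) (hx : F.map S.g.unop ≫ x = 0)
      obtain ⟨h, hh⟩ := hF.exists_desc S.g.unop (𝟙_ D) ((ρ_ _).hom ≫ x) (by
        rw [rightUnitor_naturality_assoc, hx, comp_zero])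
      refine ⟨(F.map e.inv ≫ (ρ_ _).inv ≫ h : F.obj (unop S.X₁) ⟶ 𝟙_ D), ?_⟩
      change F.map S.f.unop ≫ F.map e.inv ≫ (ρ_ _).inv ≫ h = x
      rw [← F.map_comp_assoc, he', rightUnitor_inv_naturality_assoc, hh, Iso.inv_hom_id_assoc]
    · rw [AddCommGrpCat.mono_iff_injective, injective_iff_map_eq_zero]
      intro (x : F.obj (unop S.X₁) ⟶ 𝟙_ D) (hx : F.map S.f.unop ≫ x = 0)
      have := hF.eq_zero S.g.unop (𝟙_ D) ((ρ_ _).hom ≫ F.map e.hom ≫ x) (by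
        rw [rightUnitor_naturality_assoc, ← F.map_comp_assoc, he, hx, comp_zero])
      change (x : F.obj (unop S.X₁) ⟶ 𝟙_ D) = 0
      rw [← cancel_epi (F.map e.hom), ← cancel_epi (ρ_ _).hom, this]
      simp
  exact inferInstanceAs (PreservesFiniteLimits (G ⋙ forget AddCommGrpCat))

end LocalIso

open ZeroObject in
/-- If two objects become isomorphic under a tensor functor `F` that preserves cokernels, then
they are locally isomorphic, over the algebra `V ↦ Hom(F(V), 𝟙)`. -/
lemma locallyIsomorphic_of_iso {C : Type u} [SmallCategory C] [Abelian C]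
    [MonoidalCategory C] [SymmetricCategory C] [RigidCategory C]
    {D : Type u} [SmallCategory D] [MonoidalCategory D] [SymmetricCategory D]
    [Preadditive D] [MonoidalPreadditive D] {F : C ⥤ D} [F.Braided] [F.Additive]
    (hF : PreservesCokernels F) (h0 : 𝟙 (𝟙_ D) ≠ 0) {X U : C} (f : F.obj X ≅ F.obj U) :
    LocallyIsomorphic X U := by
  let A : IndAlgebra C :=
    { X := Day.pre F (𝟙_ D)
      mon := Day.preMon F
      comm := let _ := Day.preMon F; ⟨Day.braiding_preAct⟩
      isIndObject := hF.isIndObject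
      nonzero := ⟨fun e => h0 (by
        have h : Subsingleton (F.obj (𝟙_ C) ⟶ 𝟙_ D) :=
          have : Subsingleton (𝟙_ C ⟶ 0) := inferInstance
          ((e.app (op (𝟙_ C))).toEquiv).subsingleton (β := 𝟙_ C ⟶ 0)
        have := Subsingleton.elim (Functor.OplaxMonoidal.η F) 0
        rw [← Functor.Monoidal.ε_η (F := F), this, comp_zero])⟩ }
  exact ⟨A, ⟨Day.freeModulePreIso (X' := ᘁX) (Y' := ᘁU) F f⟩⟩

/-! ### Completing a partial splitting -/

section MainInduction

open LaxAlg Free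

variable {C : Type u} [SmallCategory C] [Abelian C] [MonoidalCategory C]
  [SymmetricCategory C] [RigidCategory C]

/-- A partial splitting can be completed: as long as the remaining idempotent is not zero, an even
or odd unit can be split off from it after an extension of scalars. -/
lemma PartialSplitting.locallyIsomorphic {L X : C} (hL : Nonempty (L ⊗ L ≅ 𝟙_ C))
    (hβ : (β_ L L).hom = -𝟙 (L ⊗ L)) (n : ℕ) :
    ∀ {D : Type u} [SmallCategory D] [MonoidalCategory D] [SymmetricCategory D] [Preadditive D]
      [MonoidalPreadditive D] [RightRigidCategory D] [DivisibleUnit D] {F : C ⥤ D} [F.Braided]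
      [F.Additive] (_ : PreservesCokernels F) (_ : 𝟙 (𝟙_ D) ≠ 0)
      (_ : PartialSplitting F L X n), ∃ U, IsUnitSum L U ∧ LocallyIsomorphic X U := by
  induction n with
  | zero =>
    intro D _ _ _ _ _ _ _ F _ _ hF h0 s
    -- a relation of degree zero says that the unit is zero
    refine absurd ?_ h0
    have h := s.rel
    rw [Fintype.sum_unique, show (default : Equiv.Perm (Fin 0)) = 1 from Subsingleton.elim _ _,
      s.z_one, one_smul, permMap_one, Category.comp_id] at h
    exact h
  | succ n ih =>
    intro D _ _ _ _ _ _ _ F _ _ hF h0 s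
    by_cases he : s.e = 0
    · refine ⟨s.U, s.isUnitSum, locallyIsomorphic_of_iso hF h0 ⟨s.r, s.i, ?_, s.i_r⟩⟩
      rw [← s.r_i, he, add_zero]
    have hL' : Nonempty (F.obj L ⊗ F.obj L ≅ 𝟙_ D) :=
      ⟨Functor.Monoidal.μIso F L L ≪≫ F.mapIso hL.some ≪≫ (Functor.Monoidal.εIso F).symm⟩
    have hβ' : (β_ (F.obj L) (F.obj L)).hom = -𝟙 (F.obj L ⊗ F.obj L) := by
      rw [← cancel_mono (Functor.LaxMonoidal.μ F L L), ← Functor.LaxBraided.braided, hβ,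
        F.map_neg, F.map_id]
      simp
    obtain ⟨N, M, c, hM, hN, hne⟩ : ∃ (N : C) (M : D) (_ : M ≅ F.obj N),
        Nonempty (M ⊗ M ≅ 𝟙_ D) ∧ IsUnitSum L (s.U ⊞ N) ∧
          ∀ n, powMap (s.e ▷ M) n ≫ symSum (F.obj X ⊗ M) n ≠ 0 := by
      rcases powMap_symSum_ne_zero hL' hβ' ((F.obj X)ᘁ) s.e_e he with h | h
      · exact ⟨𝟙_ C, 𝟙_ D, Functor.Monoidal.εIso F, ⟨λ_ _⟩, s.isUnitSum.add_unit, h⟩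
      · exact ⟨L, F.obj L, Iso.refl _, hL', s.isUnitSum.add_odd, h⟩
    obtain ⟨A, B, E, hE, hFE, x, y, hxy⟩ := exists_splitting_of_powMap_symSum_ne_zero hF _ hne
    let G := free A ⋙ free B ⋙ free E
    obtain ⟨x', y', hxy'⟩ : ∃ (x' : G.obj M ⟶ G.obj (F.obj X)) (y' : G.obj (F.obj X) ⟶ G.obj M),
        x' ≫ G.map s.e ≫ y' = 𝟙 _ := exists_map_splitting hM s.e G x y hxy
    have hNN : Nonempty ((F ⋙ G).obj N ⊗ (F ⋙ G).obj N ≅ 𝟙_ E.Free) :=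
      ⟨(G.mapIso c.symm ⊗ᵢ G.mapIso c.symm) ≪≫ Functor.Monoidal.μIso G M M ≪≫
        G.mapIso hM.some ≪≫ (Functor.Monoidal.εIso G).symm⟩
    refine ih hFE hE ((s.map G).step hN hNN (G.map c.inv ≫ x') (y' ≫ G.map c.hom) ?_)
    change (G.map c.inv ≫ x') ≫ G.map s.e ≫ y' ≫ G.map c.hom = _
    rw [show (G.map c.inv ≫ x') ≫ G.map s.e ≫ y' ≫ G.map c.hom =
      G.map c.inv ≫ (x' ≫ G.map s.e ≫ y') ≫ G.map c.hom by simp only [Category.assoc], hxy',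
      Category.id_comp, ← G.map_comp, Iso.inv_hom_id]
    exact G.map_id _

end MainInduction

/-! ### Linear morphisms of free modules over the algebra of a tensor functor -/

namespace Day

section Linear

variable {C : Type u} [SmallCategory C] [MonoidalCategory C]
  {D : Type u} [SmallCategory D] [MonoidalCategory D]
  {F : C ⥤ D} [F.Monoidal] {B : DayFunctor Cᵒᵖ (Type u)} (θ : B ≅ pre F (𝟙_ D))

/-- The action of an algebra that is isomorphic to the algebra of the functor `F`. -/
def modAct (Y : D) : B ⊗ pre F Y ⟶ pre F Y := θ.hom ▷ pre F Y ≫ preAct F Y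

/-- The free module on `X` over an algebra that is isomorphic to the algebra of the functor `F`. -/
def modIso (Y X : C) [ExactPairing Y X] : B ⊗ toInd X ≅ pre F (F.obj X) :=
  whiskerRightIso θ (toInd X) ≪≫ compareIso F Y X

lemma modIso_hom (Y X : C) [ExactPairing Y X] :
    (modIso θ Y X).hom = θ.hom ▷ toInd X ≫ pre F (𝟙_ D) ◁ preYoneda F X ≫ preAct F (F.obj X) := rfl

lemma ev_modIso (Y : C) {U V X : C} [ExactPairing Y X] (b : Pts B U) (u : V ⟶ X) :
    ev (modIso θ Y X).hom (pair b (yel u)) = ev (modAct θ (F.obj X)) (pair b (el (F.map u))) := by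
  rw [modIso_hom, ev_comp, ev_comp, ev_whiskerRight, ev_whiskerLeft, modAct, ev_comp,
    ev_whiskerRight, ev_preYoneda]

lemma modAct_preMap {Y Z : D} (f : Y ⟶ Z) :
    modAct θ Y ≫ preMap F f = B ◁ preMap F f ≫ modAct θ Z := by
  rw [modAct, modAct, Category.assoc, preMap_preAct, whisker_exchange_assoc]

variable [MonObj B] (hθ : (MonObj.mul : B ⊗ B ⟶ B) ≫ θ.hom =
  θ.hom ▷ B ≫ pre F (𝟙_ D) ◁ θ.hom ≫ preAct F (𝟙_ D))

include hθ

lemma smul_modIso (Y X : C) [ExactPairing Y X] :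
    ((α_ _ _ _).inv ≫ (MonObj.mul : B ⊗ B ⟶ B) ▷ toInd X) ≫ (modIso θ Y X).hom =
      B ◁ (modIso θ Y X).hom ≫ modAct θ (F.obj X) := by
  have h := freeModule_smul_compare F X
  change _ ≫ θ.hom ▷ toInd X ≫ compare F X = B ◁ (θ.hom ▷ toInd X ≫ compare F X) ≫ _
  rw [modAct, whisker_exchange_assoc, Category.assoc, ← comp_whiskerRight_assoc, hθ,
    comp_whiskerRight, comp_whiskerRight, Category.assoc, Category.assoc,
    ← associator_inv_naturality_left_assoc, ← associator_inv_naturality_middle_assoc,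
    MonoidalCategory.whiskerLeft_comp, Category.assoc, ← h]
  simp only [Category.assoc]

/-- The linear morphisms between free modules are induced by morphisms between the values of the
functor. -/
lemma exists_preMap_of_linear (X' Y' : C) {X Y : C} [ExactPairing X' X] [ExactPairing Y' Y]
    (e : B ⊗ toInd X ⟶ B ⊗ toInd Y)
    (he : ((α_ _ _ _).inv ≫ (MonObj.mul : B ⊗ B ⟶ B) ▷ toInd X) ≫ e =
      B ◁ e ≫ (α_ _ _ _).inv ≫ (MonObj.mul : B ⊗ B ⟶ B) ▷ toInd Y) :
    ∃ m : F.obj X ⟶ F.obj Y,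
      preMap F m = (modIso θ X' X).inv ≫ e ≫ (modIso θ Y' Y).hom := by
  set φ := (modIso θ X' X).inv ≫ e ≫ (modIso θ Y' Y).hom with hφ
  have hlin : modAct θ (F.obj X) ≫ φ = B ◁ φ ≫ modAct θ (F.obj Y) := by
    have h1 := smul_modIso θ hθ X' X
    have h2 := smul_modIso θ hθ Y' Y
    have h3 : modAct θ (F.obj X) = B ◁ (modIso θ X' X).inv ≫
        ((α_ _ _ _).inv ≫ (MonObj.mul : B ⊗ B ⟶ B) ▷ toInd X) ≫ (modIso θ X' X).hom := by
      rw [h1, ← whiskerLeft_comp_assoc]; simp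
    rw [h3, hφ]
    simp only [MonoidalCategory.whiskerLeft_comp, Category.assoc, Iso.hom_inv_id_assoc] at h2 he ⊢
    rw [reassoc_of% he, h2]
  clear_value φ
  -- a linear morphism is determined by its value at the identity of `F(X)`
  refine ⟨mor (ev φ (el (𝟙 (F.obj X)))), ?_⟩
  rw [← cancel_epi (modIso θ X' X).hom]
  refine tensor_hom_ext fun U V b (u : V ⟶ X) => ?_
  have hu : el (F.map u) = res (pre F (F.obj X)) u (el (𝟙 (F.obj X))) := by
    rw [res_el, Category.comp_id]
  change ev _ (pair b (yel u)) = ev _ (pair b (yel u))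
  rw [ev_comp, ev_comp, ev_modIso, ← ev_comp, ← ev_comp, hlin, modAct_preMap, ev_comp, ev_comp,
    ev_whiskerLeft, ev_whiskerLeft, ev_preMap, hu, ev_res]
  rfl

/-- Objects that give isomorphic free modules become isomorphic under the functor. -/
lemma nonempty_iso_of_freeModuleIso (X' Y' : C) {X Y : C} [ExactPairing X' X] [ExactPairing Y' Y]
    (e : freeModule B (toInd X) ≅ freeModule B (toInd Y)) : Nonempty (F.obj X ≅ F.obj Y) := by
  obtain ⟨a, b, ha, hb, hab, hba⟩ : ∃ (a : B ⊗ toInd X ⟶ B ⊗ toInd Y)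
      (b : B ⊗ toInd Y ⟶ B ⊗ toInd X),
      ((α_ _ _ _).inv ≫ (MonObj.mul : B ⊗ B ⟶ B) ▷ toInd X) ≫ a =
        B ◁ a ≫ (α_ _ _ _).inv ≫ (MonObj.mul : B ⊗ B ⟶ B) ▷ toInd Y ∧
      ((α_ _ _ _).inv ≫ (MonObj.mul : B ⊗ B ⟶ B) ▷ toInd Y) ≫ b =
        B ◁ b ≫ (α_ _ _ _).inv ≫ (MonObj.mul : B ⊗ B ⟶ B) ▷ toInd X ∧
      a ≫ b = 𝟙 _ ∧ b ≫ a = 𝟙 _ :=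
    ⟨e.hom.hom, e.inv.hom, e.hom.isModHom.smul_hom, e.inv.isModHom.smul_hom,
      congrArg Mod.Hom.hom e.hom_inv_id, congrArg Mod.Hom.hom e.inv_hom_id⟩
  obtain ⟨m, hm⟩ := exists_preMap_of_linear θ hθ X' Y' a ha
  obtain ⟨n, hn⟩ := exists_preMap_of_linear θ hθ Y' X' b hb
  refine ⟨m, n, ?_, ?_⟩
  · have : preMap F m ≫ preMap F n = 𝟙 _ := by
      rw [hm, hn]
      rw [Category.assoc, Category.assoc, Iso.hom_inv_id_assoc, reassoc_of% hab, Iso.inv_hom_id]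
    have := congrArg (fun γ => mor (ev γ (el (𝟙 (F.obj X))))) this
    rw [← Category.id_comp m]
    exact this
  · have : preMap F n ≫ preMap F m = 𝟙 _ := by
      rw [hm, hn]
      rw [Category.assoc, Category.assoc, Iso.hom_inv_id_assoc, reassoc_of% hba, Iso.inv_hom_id]
    have := congrArg (fun γ => mor (ev γ (el (𝟙 (F.obj Y))))) this
    rw [← Category.id_comp n]
    exact this

end Linear

end Day

/-! ### Left exact presheaves take values in abelian groups -/

namespace Day

section Group

variable {C : Type u} [SmallCategory C] [MonoidalCategory C] (P : DayFunctor Cᵒᵖ (Type u))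
  [PreservesFiniteLimits P.functor] {U V W : C}

open ZeroObject in
lemma existsUnique_zero [HasZeroObject C] : ∃! _ : Pts P (0 : C), True := by
  have h0 : IsTerminal (op (0 : C)) := (isZero_zero C).op.isTerminal
  have h : IsTerminal (P.functor.obj (op 0)) := h0.isTerminalObj P.functor _
  refine ⟨h.from PUnit.{u + 1} PUnit.unit, trivial, fun y _ => ?_⟩
  exact congr_pt (h.hom_ext (↾fun _ : PUnit.{u + 1} => y) _) PUnit.unit

variable [Preadditive C] [HasBinaryBiproducts C]

/-- Elements of a left exact presheaf over the summands of a direct sum can be glued. -/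
lemma exists_glue (a : Pts P U) (b : Pts P V) :
    ∃ t : Pts P (U ⊞ V), res P biprod.inl t = a ∧ res P biprod.inr t = b := by
  have h := mapIsLimitOfPreservesOfIsLimit P.functor _ _
    (BinaryCofan.IsColimit.op (BinaryBiproduct.isColimit U V))
  obtain ⟨l, h1, h2⟩ := BinaryFan.IsLimit.lift' h (↾fun _ : PUnit.{u + 1} => a) (↾fun _ => b)
  exact ⟨l PUnit.unit, congr_pt h1 _, congr_pt h2 _⟩

lemma glue_ext {s t : Pts P (U ⊞ V)} (h1 : res P biprod.inl s = res P biprod.inl t)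
    (h2 : res P biprod.inr s = res P biprod.inr t) : s = t := by
  have h := mapIsLimitOfPreservesOfIsLimit P.functor _ _
    (BinaryCofan.IsColimit.op (BinaryBiproduct.isColimit U V))
  have := BinaryFan.IsLimit.hom_ext h (f := ↾fun _ : PUnit.{u + 1} => s) (g := ↾fun _ => t)
    (by ext; exact h1) (by ext; exact h2)
  exact congr_pt this PUnit.unit

/-- The sum of two elements of a left exact presheaf. -/
def add (a b : Pts P V) : Pts P V := res P (biprod.lift (𝟙 V) (𝟙 V)) (exists_glue P a b).choose

lemma res_add_hom (f g : U ⟶ V) (a : Pts P V) :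
    res P (f + g) a = add P (res P f a) (res P g a) := by
  have h := (exists_glue P (res P f a) (res P g a)).choose_spec
  have : (exists_glue P (res P f a) (res P g a)).choose = res P (biprod.desc f g) a :=
    glue_ext P (by rw [h.1, res_res, biprod.inl_desc]) (by rw [h.2, res_res, biprod.inr_desc])
  rw [add, this, res_res]
  congr 1
  simp

/-- Two elements are restrictions of one element. -/
lemma exists_common (a : Pts P U) (b : Pts P V) : ∃ (T : C) (i : U ⟶ T) (j : V ⟶ T) (t : Pts P T),
    res P i t = a ∧ res P j t = b :=
  ⟨U ⊞ V, _, _, exists_glue P a b⟩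

variable [HasZeroObject C]

open ZeroObject in
/-- The abelian group structure on the elements of a left exact presheaf over an object. -/
@[reducible] def group (V : C) : AddCommGroup (Pts P V) :=
  let z : Pts P V := res P (0 : V ⟶ 0) (existsUnique_zero P).choose
  have hz (a : Pts P V) : z = res P 0 a := by
    rw [← zero_comp (X := V) (Y := (0 : C)) (f := (0 : (0 : C) ⟶ V)), ← res_res]
    exact congrArg _ ((existsUnique_zero P).choose_spec.2 _ trivial).symm
  have hc (a b : Pts P V) : add P a b = add P b a := by
    obtain ⟨T, i, j, t, rfl, rfl⟩ := exists_common P a b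
    rw [← res_add_hom, ← res_add_hom, add_comm]
  have h0 (a : Pts P V) : add P z a = a := by
    obtain ⟨b, rfl⟩ : ∃ b, a = res P (𝟙 V) b := ⟨a, (res_id a).symm⟩
    rw [hz b, ← res_add_hom, zero_add]
  let _ : Add (Pts P V) := ⟨add P⟩
  let _ : Zero (Pts P V) := ⟨z⟩
  let _ : Neg (Pts P V) := ⟨res P (-𝟙 V)⟩
  let g : AddGroup (Pts P V) := AddGroup.ofLeftAxioms
    (fun a b c => by
      obtain ⟨T, i, j, t, rfl, rfl⟩ := exists_common P a b
      obtain ⟨T', i', j', t, rfl, rfl⟩ := exists_common P t c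
      change add P (add P _ _) _ = add P _ (add P _ _)
      rw [res_res, res_res, ← res_add_hom, ← res_add_hom, ← res_add_hom, ← res_add_hom, add_assoc])
    h0
    (fun a => by
      change add P (res P (-𝟙 V) a) a = z
      obtain ⟨b, rfl⟩ : ∃ b, a = res P (𝟙 V) b := ⟨a, (res_id a).symm⟩
      rw [res_res, Category.comp_id, ← res_add_hom, neg_add_cancel, ← hz])
  { g with add_comm := hc }

attribute [local instance] group

lemma res_hom_add (f g : U ⟶ V) (a : Pts P V) : res P (f + g) a = res P f a + res P g a :=
  res_add_hom P f g a

/-- A map that is natural in an additive way is additive. -/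
lemma map_add_of_natural {Q : DayFunctor Cᵒᵖ (Type u)} [PreservesFiniteLimits Q.functor]
    (G : C ⥤ C) [G.Additive] (φ : ∀ V, Pts P V → Pts Q (G.obj V))
    (h : ∀ {U V : C} (f : U ⟶ V) (a : Pts P V), φ U (res P f a) = res Q (G.map f) (φ V a))
    (a b : Pts P V) : φ V (a + b) = φ V a + φ V b := by
  obtain ⟨T, i, j, t, rfl, rfl⟩ := exists_common P a b
  rw [← res_hom_add, h, h, h, G.map_add, res_hom_add]

end Group

end Day

/-! ### Algebras in the category of ind-objects as presheaves of algebras -/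

open Day

namespace LaxAlg.Free

variable {D : Type u} [SmallCategory D] [MonoidalCategory D] [SymmetricCategory D] [Preadditive D]
  [RightRigidCategory D] {A : LaxAlg D}

lemma δ_ofPoint_ofPoint {V W : D} (c : A.obj V) (d : A.obj W) :
    Functor.OplaxMonoidal.δ (free A) V W ≫
      ((ofPoint c : (⟨V⟩ : A.Free) ⟶ 𝟙_ A.Free) ⊗ₘ (ofPoint d : (⟨W⟩ : A.Free) ⟶ 𝟙_ A.Free)) ≫
        (λ_ (𝟙_ A.Free)).hom = ofPoint (A.mul c d) := by
  refine (Category.id_comp (X := (⟨V ⊗ W⟩ : A.Free)) _).trans ?_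
  change (wr (ofPoint c) W ≫ wl (𝟙_ D) (ofPoint d)) ≫ fr A (λ_ (𝟙_ D)).hom = _
  rw [Category.assoc, wl_unit, wr_ofPoint]

end LaxAlg.Free

namespace IndAlgebra

variable {C : Type u} [SmallCategory C] [Abelian C] [MonoidalCategory C] [MonoidalPreadditive C]
  [SymmetricCategory C] (B : IndAlgebra C)

instance : PreservesFiniteLimits B.X.functor :=
  (isIndObject_iff_preservesFiniteLimits _).1 B.isIndObject

attribute [local instance] Day.group

/-- The external product of points of an algebra. -/
def mulPts {V W : C} (a : Pts B.X V) (b : Pts B.X W) : Pts B.X (V ⊗ W) :=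
  ev MonObj.mul (pair a b)

omit [MonoidalPreadditive C] in
lemma mulPts_res_left {U V W : C} (f : U ⟶ V) (a : Pts B.X V) (b : Pts B.X W) :
    B.mulPts (res _ f a) b = res _ (f ▷ W) (B.mulPts a b) := by
  rw [mulPts, pair_res_left, ev_res]; rfl

omit [MonoidalPreadditive C] in
lemma mulPts_res_right {U V W : C} (f : U ⟶ V) (a : Pts B.X W) (b : Pts B.X V) :
    B.mulPts a (res _ f b) = res _ (W ◁ f) (B.mulPts a b) := by
  rw [mulPts, pair_res_right, ev_res]; rfl

lemma add_mulPts {V W : C} (a b : Pts B.X V) (c : Pts B.X W) :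
    B.mulPts (a + b) c = B.mulPts a c + B.mulPts b c :=
  map_add_of_natural B.X (tensorRight W) (fun _ a => B.mulPts a c)
    (fun f a => B.mulPts_res_left f a c) a b

lemma mulPts_add {V W : C} (a : Pts B.X V) (b c : Pts B.X W) :
    B.mulPts a (b + c) = B.mulPts a b + B.mulPts a c :=
  map_add_of_natural B.X (tensorLeft V) (fun _ b => B.mulPts a b)
    (fun f b => B.mulPts_res_right f a b) b c

/-- The unit element of an algebra. -/
def onePt : Pts B.X (𝟙_ C) := ev MonObj.one (one C)

/-- The presheaf of algebras given by an algebra in the category of ind-objects. -/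
def toLaxAlg : LaxAlg C where
  obj V := Pts B.X V
  grp V := inferInstance
  map f := AddMonoidHom.mk' (res B.X f) fun a b => by
    obtain ⟨T, i, j, t, rfl, rfl⟩ := exists_common B.X a b
    rw [← res_hom_add, res_res, res_res, res_res, ← res_hom_add, Preadditive.comp_add]
  map_id := res_id
  map_map := res_res
  map_add' := res_hom_add B.X
  one := B.onePt
  mul := AddMonoidHom.mk' (fun a => AddMonoidHom.mk' (B.mulPts a) (B.mulPts_add a)) fun a b =>
    AddMonoidHom.ext fun c => B.add_mulPts a b c
  mul_map_left := B.mulPts_res_left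
  mul_map_right f a b := B.mulPts_res_right f a b
  one_mul a := by
    change B.mulPts _ _ = _
    rw [mulPts, onePt, ← ev_whiskerRight, ← ev_comp, MonObj.one_mul, ev_leftUnitor]; rfl
  mul_assoc a b c := by
    change B.mulPts (B.mulPts _ _) _ = res _ _ (B.mulPts _ (B.mulPts _ _))
    rw [mulPts, mulPts, mulPts, mulPts, ← ev_whiskerRight, ← ev_comp, MonObj.mul_assoc, ev_comp,
      ev_associator_hom, ev_res, ev_comp, ev_whiskerLeft]
  mul_comm a b := by
    change B.mulPts _ _ = res _ _ (B.mulPts _ _)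
    rw [mulPts, mulPts, ← ev_res, ← ev_braiding, ← ev_comp, IsCommMonObj.mul_comm]

open ZeroObject in
/-- If the unit element vanishes then so do all elements, and the algebra is the zero object. -/
lemma one_ne_zero : B.toLaxAlg.one ≠ 0 := fun h => B.nonzero.false (by
  have (V : C) : Subsingleton (Pts B.X V) := by
    have (a : B.toLaxAlg.obj V) : a = 0 := by
      rw [← B.toLaxAlg.map_id a, ← (λ_ V).inv_hom_id, ← B.toLaxAlg.map_map, ← B.toLaxAlg.one_mul, h,
        map_zero, AddMonoidHom.zero_apply, map_zero]
    exact ⟨fun a b => (this a).trans (this b).symm⟩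
  have (V : C) : Unique (Pts B.X V) := ⟨⟨0⟩, fun a => Subsingleton.elim a _⟩
  have (V : C) : Unique (V ⟶ 0) := ⟨⟨0⟩, fun f => (isZero_zero C).eq_of_tgt f _⟩
  exact NatIso.ofComponents
    (fun V => (Equiv.ofUnique (Pts B.X V.unop) (V.unop ⟶ 0)).toIso)
    fun f => by
      ext a
      exact Subsingleton.elim (α := _ ⟶ (0 : C)) _ _)

variable [RightRigidCategory C]

open LaxAlg Free

/-- The identification of the points of an algebra with functionals on free modules. -/
def functionalIso : B.X ≅ pre (free B.toLaxAlg) (𝟙_ B.toLaxAlg.Free) where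
  hom := mkHom (fun _ a => el (ofPoint (A := B.toLaxAlg) a)) fun f a =>
    congrArg el (fr_ofPoint (A := B.toLaxAlg) f a).symm
  inv := mkHom (fun _ a => toPoint (A := B.toLaxAlg) (mor a)) fun {U V} f a => by
    apply ofPoint_injective (A := B.toLaxAlg) (V := U)
    refine (ofPoint_toPoint _).trans (Eq.trans ?_ (fr_ofPoint (A := B.toLaxAlg) f _))
    rw [ofPoint_toPoint]
    rfl
  hom_inv_id := hom_ext fun V a => toPoint_ofPoint (A := B.toLaxAlg) a
  inv_hom_id := hom_ext fun V a => ofPoint_toPoint (A := B.toLaxAlg) (mor a)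

lemma ev_functionalIso {V : C} (a : Pts B.X V) :
    ev B.functionalIso.hom a = el (ofPoint (A := B.toLaxAlg) (V := V) a) := rfl

/-- Objects that give isomorphic free modules over an algebra in the category of ind-objects are
isomorphic in the category of free modules over the presheaf of algebras. -/
lemma nonempty_free_iso [LeftRigidCategory C] {X Y : C}
    (e : extendScalars B X ≅ extendScalars B Y) :
    Nonempty ((free B.toLaxAlg).obj X ≅ (free B.toLaxAlg).obj Y) := by
  refine nonempty_iso_of_freeModuleIso B.functionalIso ?_ (ᘁX) (ᘁY) e
  refine tensor_hom_ext fun U V a b => ?_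
  rw [ev_comp, ev_comp, ev_comp, ev_whiskerRight, ev_whiskerLeft, ev_functionalIso,
    ev_functionalIso, ev_functionalIso, ev_preAct]
  exact congrArg el (δ_ofPoint_ofPoint (A := B.toLaxAlg) a b).symm

end IndAlgebra

/-! ### The unit is simple, and extension of scalars is faithful -/

section UnitSimple

variable {C : Type*} [Category* C] [Abelian C] [MonoidalCategory C] [MonoidalPreadditive C]
  [SymmetricCategory C] [RigidCategory C]

omit [Abelian C] [MonoidalPreadditive C] [SymmetricCategory C] in
lemma mono_whiskerLeft (Z : C) {V W : C} (f : V ⟶ W) [Mono f] : Mono (Z ◁ f) := by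
  have : (tensorLeft Z).IsRightAdjoint := (tensorLeftAdjunction Z (Zᘁ)).isRightAdjoint
  exact inferInstanceAs (Mono ((tensorLeft Z).map f))

omit [Abelian C] [MonoidalPreadditive C] in
lemma mono_whiskerRight (Z : C) {V W : C} (f : V ⟶ W) [Mono f] : Mono (f ▷ Z) := by
  have := mono_whiskerLeft Z f
  have h : f ▷ Z = (β_ V Z).hom ≫ Z ◁ f ≫ (β_ W Z).inv := by simp
  rw [h]
  infer_instance

/-- A subobject of the unit is a direct summand. -/
lemma exists_retraction_of_mono {I : C} (i : I ⟶ 𝟙_ C) [Mono i] : ∃ s, i ≫ s = 𝟙 I := by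
  -- both `coker i ⊗ I` and `I ⊗ coker i` vanish, so `i ⊗ I` is an isomorphism; its inverse and the
  -- dual of `I` give the retraction
  have := mono_whiskerRight I i
  have hq : cokernel.π i ▷ I = 0 := by
    have := mono_whiskerLeft (cokernel i) i
    rw [← cancel_mono (cokernel i ◁ i), ← whisker_exchange, zero_comp]
    rw [← cancel_mono (ρ_ _).hom, Category.assoc, rightUnitor_naturality, unitors_equal.symm,
      leftUnitor_naturality_assoc, cokernel.condition, comp_zero, zero_comp]
  have : Epi (i ▷ I) := by
    refine Preadditive.epi_of_cancel_zero _ fun g hg => ?_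
    obtain ⟨h, rfl⟩ := PreservesCokernels.id.exists_desc' i g hg
    change cokernel.π i ▷ I ≫ h = 0
    rw [hq, zero_comp]
  have : IsIso (i ▷ I) := isIso_of_mono_of_epi _
  refine ⟨η_ I (Iᘁ) ≫ (λ_ I).inv ▷ (Iᘁ) ≫ inv (i ▷ I) ▷ (Iᘁ) ≫ (α_ _ _ _).hom ≫
    (β_ I (I ⊗ Iᘁ)).hom ≫ (α_ _ _ _).hom ≫ I ◁ ε_ I (Iᘁ) ≫ (ρ_ I).hom, ?_⟩
  have h1 : i ≫ η_ I (Iᘁ) ≫ (λ_ I).inv ▷ (Iᘁ) =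
      (ρ_ I).inv ≫ I ◁ η_ I (Iᘁ) ≫ (α_ _ _ _).inv ≫ (i ▷ I) ▷ (Iᘁ) := by
    rw [← associator_inv_naturality_left, whisker_exchange_assoc,
      ← rightUnitor_inv_naturality_assoc,
      ← unitors_inv_equal, leftUnitor_inv_whiskerRight, leftUnitor_inv_naturality_assoc]
  have h2 : (i ▷ I) ▷ (Iᘁ) ≫ inv (i ▷ I) ▷ (Iᘁ) = 𝟙 _ := by
    rw [← comp_whiskerRight, IsIso.hom_inv_id, id_whiskerRight]
  rw [reassoc_of% h1, reassoc_of% h2, Iso.inv_hom_id_assoc,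
    BraidedCategory.braiding_naturality_right_assoc,
    ExactPairing.evaluation_coevaluation_assoc]
  simp

/-- In a tensor category all nonzero morphisms to the unit are epimorphisms. -/
lemma epi_of_ne_zero (hend : ∀ e : 𝟙_ C ⟶ 𝟙_ C, e ≠ 0 → IsIso e) {V : C} (f : V ⟶ 𝟙_ C)
    (hf : f ≠ 0) : Epi f := by
  obtain ⟨s, hs⟩ := exists_retraction_of_mono (image.ι f)
  have h0 : s ≫ image.ι f ≠ 0 := fun h => hf (by
    rw [← image.fac f, ← Category.id_comp (image.ι f), ← hs, Category.assoc, h, comp_zero,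
      comp_zero])
  have := hend _ h0
  have : Epi (image.ι f) := epi_of_epi s _
  rw [← image.fac f]
  exact epi_comp _ _

end UnitSimple

open LaxAlg Free in
/-- Extension of scalars to a nonzero algebra is faithful. By duality a nonzero morphism gives a
nonzero morphism `g` to the unit. It is an epimorphism, hence pullback along `g` is injective on the
points of the algebra, as ind-objects are left exact; so it does not kill the unit element. -/
lemma IndAlgebra.eq_zero_of_free_map_eq_zero {C : Type u} [SmallCategory C] [Abelian C]
    [MonoidalCategory C] [MonoidalPreadditive C] [SymmetricCategory C] [RigidCategory C]
    (B : IndAlgebra C) (hend : ∀ e : 𝟙_ C ⟶ 𝟙_ C, e ≠ 0 → IsIso e) {V W : C} {f : V ⟶ W}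
    (hf : (free B.toLaxAlg).map f = 0) : f = 0 := by
  by_contra h
  let W' : C := ᘁW
  let g : V ⊗ W' ⟶ 𝟙_ C := f ▷ W' ≫ ε_ W' W
  have hg : g ≠ 0 := fun hg => h (by
    replace hg : f ▷ W' ≫ ε_ W' W = 0 := hg
    have h1 : Day.insertPair W W' W ≫ ε_ W' W ▷ W ≫ (λ_ W).hom = 𝟙 W := by
      simp [Day.insertPair]
    rw [← Category.comp_id f, ← h1, ← reassoc_of% Day.insertPair_naturality f,
      ← comp_whiskerRight_assoc, hg, MonoidalPreadditive.zero_whiskerRight, zero_comp, comp_zero])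
  have := epi_of_ne_zero hend g hg
  have hinj : Function.Injective (Day.res B.X g) :=
    (mono_iff_injective (B.X.functor.map g.op)).1 inferInstance
  refine B.one_ne_zero (hinj ?_)
  have h0 : B.toLaxAlg.map g B.toLaxAlg.one = 0 := by
    rw [← B.toLaxAlg.map_map]
    exact congrArg (fun φ : (⟨V⟩ : B.toLaxAlg.Free) ⟶ ⟨W⟩ => act φ W' _) hf
  exact h0.trans (map_zero (B.toLaxAlg.map g)).symm

/-! ### Young symmetrizers on tensor powers -/

section ColorSums

variable {D : Type*} [Category* D] [MonoidalCategory D] [SymmetricCategory D] [Preadditive D]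

open Classical in
/-- The sum of the permutations of the factors that preserve a colouring. -/
def colorSym (X : D) {n : ℕ} (c : Fin n → ℕ) : tensorPow X n ⟶ tensorPow X n :=
  ∑ g : Equiv.Perm (Fin n) with ∀ i, c (g i) = c i, permMap X n g

open Classical in
/-- The signed sum of the permutations of the factors that preserve a colouring. -/
def colorAnti (X : D) {n : ℕ} (c : Fin n → ℕ) : tensorPow X n ⟶ tensorPow X n :=
  ∑ g : Equiv.Perm (Fin n) with ∀ i, c (g i) = c i, (Equiv.Perm.sign g : ℤ) • permMap X n g

lemma swap_preserves {n : ℕ} {c : Fin n → ℕ} {i j : Fin n} (h : c i = c j) (m : Fin n) :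
    c (Equiv.swap i j m) = c m := by
  rw [Equiv.swap_apply_def]
  split_ifs with h1 h2
  · rw [h1, h]
  · rw [h2, h]
  · rfl

lemma permMap_swap_colorSym (X : D) {n : ℕ} {c : Fin n → ℕ} {i j : Fin n} (h : c i = c j) :
    permMap X n (Equiv.swap i j) ≫ colorSym X c = colorSym X c := by
  rw [colorSym, Preadditive.comp_sum]
  refine Finset.sum_equiv (Equiv.mulRight (Equiv.swap i j)) (fun g => ?_) fun g _ => ?_
  · simp only [Finset.mem_filter, Finset.mem_univ, true_and, Equiv.coe_mulRight,
      Equiv.Perm.mul_apply]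
    refine ⟨fun hg m => ?_, fun hg m => ?_⟩
    · rw [hg, swap_preserves h]
    · have := hg (Equiv.swap i j m)
      rwa [Equiv.swap_apply_self, swap_preserves h] at this
  · rw [← permMap_mul]; rfl

lemma permMap_swap_colorAnti (X : D) {n : ℕ} {c : Fin n → ℕ} {i j : Fin n} (hij : i ≠ j)
    (h : c i = c j) : permMap X n (Equiv.swap i j) ≫ colorAnti X c = -colorAnti X c := by
  rw [colorAnti, Preadditive.comp_sum, ← Finset.sum_neg_distrib]
  refine Finset.sum_equiv (Equiv.mulRight (Equiv.swap i j)) (fun g => ?_) fun g _ => ?_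
  · simp only [Finset.mem_filter, Finset.mem_univ, true_and, Equiv.coe_mulRight,
      Equiv.Perm.mul_apply]
    refine ⟨fun hg m => ?_, fun hg m => ?_⟩
    · rw [hg, swap_preserves h]
    · have := hg (Equiv.swap i j m)
      rwa [Equiv.swap_apply_self, swap_preserves h] at this
  · rw [Preadditive.comp_zsmul, ← permMap_mul, Equiv.coe_mulRight, Equiv.Perm.sign_mul,
      Equiv.Perm.sign_swap hij]
    simp

/-- The morphism `e₀ ⊗ e₁ ⊗ ⋯` of the tensor power. -/
def famMap {X : D} : (n : ℕ) → (Fin n → (X ⟶ X)) → (tensorPow X n ⟶ tensorPow X n)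
  | 0, _ => 𝟙 _
  | n + 1, e => e 0 ▷ tensorPow X n ≫ X ◁ famMap n fun i => e i.succ

omit [SymmetricCategory D] [Preadditive D] in
lemma famMap_succ {X : D} (n : ℕ) (e : Fin (n + 1) → (X ⟶ X)) :
    famMap (n + 1) e = e 0 ▷ tensorPow X n ≫ X ◁ famMap n fun i => e i.succ := rfl

omit [Preadditive D] in
/-- Simple transpositions permute the factors of `e₀ ⊗ e₁ ⊗ ⋯`. -/
lemma famMap_adjSwap {X : D} {n : ℕ} (e : Fin n → (X ⟶ X)) (i : ℕ) (hi : i + 1 < n) :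
    famMap n (fun m => e (Equiv.swap ⟨i, by omega⟩ ⟨i + 1, hi⟩ m)) ≫ adjSwap X n i =
      adjSwap X n i ≫ famMap n e := by
  induction n generalizing i with
  | zero => omega
  | succ n ih =>
    cases i with
    | zero =>
      obtain ⟨n, rfl⟩ : ∃ m, n = m + 1 := ⟨n - 1, by omega⟩
      have key : ∀ {T : D} (f f' : X ⟶ X) (g : T ⟶ T),
          (f ▷ (X ⊗ T) ≫ X ◁ (f' ▷ T ≫ X ◁ g)) ≫
            (α_ X X T).inv ≫ (β_ X X).hom ▷ T ≫ (α_ X X T).hom =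
          ((α_ X X T).inv ≫ (β_ X X).hom ▷ T ≫ (α_ X X T).hom) ≫
            (f' ▷ (X ⊗ T) ≫ X ◁ (f ▷ T ≫ X ◁ g)) := by
        intro T f f' g
        have h : (f ▷ X ≫ X ◁ f') ≫ (β_ X X).hom = (β_ X X).hom ≫ (f' ▷ X ≫ X ◁ f) := by
          rw [Category.assoc, BraidedCategory.braiding_naturality_right,
            BraidedCategory.braiding_naturality_left_assoc, whisker_exchange]
        have h1 (f f' : X ⟶ X) : f ▷ (X ⊗ T) ≫ X ◁ (f' ▷ T ≫ X ◁ g) =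
            (α_ X X T).inv ≫ (f ▷ X ≫ X ◁ f') ▷ T ≫ (X ⊗ X) ◁ g ≫ (α_ X X T).hom := by
          simp
        rw [h1, h1]
        simp only [Category.assoc, Iso.hom_inv_id_assoc]
        rw [whisker_exchange_assoc, ← comp_whiskerRight_assoc, h, comp_whiskerRight_assoc]
      rw [adjSwap_zero, famMap_succ, famMap_succ, famMap_succ, famMap_succ]
      have e2 (m : Fin n) : Equiv.swap (⟨0, by omega⟩ : Fin (n + 2)) ⟨0 + 1, hi⟩ m.succ.succ =
          m.succ.succ := by
        rw [Equiv.swap_apply_of_ne_of_ne] <;> simp [Fin.ext_iff]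
      have e0 : Equiv.swap (⟨0, by omega⟩ : Fin (n + 2)) ⟨0 + 1, hi⟩ 0 = Fin.succ 0 :=
        Equiv.swap_apply_left _ _
      have e1 : Equiv.swap (⟨0, by omega⟩ : Fin (n + 2)) ⟨0 + 1, hi⟩ (Fin.succ 0) = 0 :=
        Equiv.swap_apply_right _ _
      simp only [e2, e0, e1]
      exact key _ _ _
    | succ i =>
      rw [adjSwap_succ, famMap_succ, famMap_succ]
      have e0 : Equiv.swap (⟨i + 1, by omega⟩ : Fin (n + 1)) ⟨i + 1 + 1, hi⟩ 0 = 0 := by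
        rw [Equiv.swap_apply_of_ne_of_ne] <;> simp [Fin.ext_iff]
      have e1 (m : Fin n) : Equiv.swap (⟨i + 1, by omega⟩ : Fin (n + 1)) ⟨i + 1 + 1, hi⟩ m.succ =
          (Equiv.swap (⟨i, by omega⟩ : Fin n) ⟨i + 1, by omega⟩ m).succ :=
        (Fin.succ_injective n).swap_apply ⟨i, by omega⟩ ⟨i + 1, by omega⟩ m
      simp only [e0, e1]
      rw [tailMap, Category.assoc, ← whiskerLeft_comp, ih (fun m => e m.succ) i (by omega),
        whiskerLeft_comp, whisker_exchange_assoc]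

omit [Preadditive D] in
lemma famMap_permMap {X : D} {n : ℕ} (e : Fin n → (X ⟶ X)) (g : Equiv.Perm (Fin n)) :
    famMap n (fun m => e (g m)) ≫ permMap X n g = permMap X n g ≫ famMap n e := by
  induction g using perm_induction generalizing e with
  | one => simp [permMap_one]
  | mul g h hg hh =>
    rw [permMap_mul, Category.assoc, ← hg, ← Category.assoc, ← Category.assoc,
      ← hh fun m => e (g m)]
    rfl
  | swap i hi => rw [permMap_swap X i hi, famMap_adjSwap e i hi]

variable [MonoidalPreadditive D]

/-- If two factors of `e₀ ⊗ e₁ ⊗ ⋯` pass through the same object `M`, whose commutativity constraint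
is a sign, then the transposition of these factors acts by this sign. By conjugation it suffices to
consider the first two factors. -/
lemma famMap_swap {X M : D} (π : X ⟶ M) (ι : M ⟶ X) (s : ℤ) (hβ : (β_ M M).hom = s • 𝟙 _) {n : ℕ}
    (e : Fin n → (X ⟶ X)) {i j : Fin n} (hij : i ≠ j) (hi : e i = π ≫ ι) (hj : e j = π ≫ ι) :
    famMap n e ≫ permMap X n (Equiv.swap i j) = s • famMap n e := by
  obtain ⟨n, rfl⟩ : ∃ m, n = m + 2 := ⟨n - 2, by
    have := i.isLt; have := j.isLt; have : (i : ℕ) ≠ j := fun h => hij (Fin.ext h); omega⟩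
  have top : ∀ e : Fin (n + 2) → (X ⟶ X), e 0 = π ≫ ι → e 1 = π ≫ ι →
      famMap (n + 2) e ≫ permMap X (n + 2) (Equiv.swap 0 1) = s • famMap (n + 2) e := by
    intro e h0 h1
    have key : ∀ {T : D} (g : T ⟶ T),
        ((π ≫ ι) ▷ (X ⊗ T) ≫ X ◁ ((π ≫ ι) ▷ T ≫ X ◁ g)) ≫
          (α_ X X T).inv ≫ (β_ X X).hom ▷ T ≫ (α_ X X T).hom =
        s • ((π ≫ ι) ▷ (X ⊗ T) ≫ X ◁ ((π ≫ ι) ▷ T ≫ X ◁ g)) := by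
      intro T g
      have h : ((π ≫ ι) ▷ X ≫ X ◁ (π ≫ ι)) ≫ (β_ X X).hom = s • ((π ≫ ι) ▷ X ≫ X ◁ (π ≫ ι)) := by
        have h2 : (π ≫ ι) ▷ X ≫ X ◁ (π ≫ ι) = (π ▷ X ≫ M ◁ π) ≫ ι ▷ M ≫ X ◁ ι := by
          simp [whisker_exchange_assoc]
        have h3 : (ι ▷ M ≫ X ◁ ι) ≫ (β_ X X).hom = (β_ M M).hom ≫ (ι ▷ M ≫ X ◁ ι) := by
          rw [Category.assoc, BraidedCategory.braiding_naturality_right,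
            BraidedCategory.braiding_naturality_left_assoc, whisker_exchange]
        rw [h2, Category.assoc, h3, hβ, Preadditive.zsmul_comp, Category.id_comp,
          Preadditive.comp_zsmul]
      have h1 : (π ≫ ι) ▷ (X ⊗ T) ≫ X ◁ ((π ≫ ι) ▷ T ≫ X ◁ g) =
          (α_ X X T).inv ≫ ((π ≫ ι) ▷ X ≫ X ◁ (π ≫ ι)) ▷ T ≫ (X ⊗ X) ◁ g ≫ (α_ X X T).hom := by
        simp
      rw [h1]
      simp only [Category.assoc, Iso.hom_inv_id_assoc]
      rw [whisker_exchange_assoc, ← comp_whiskerRight_assoc, h, zsmul_whiskerRight,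
        Preadditive.zsmul_comp, Preadditive.comp_zsmul]
    have hs := permMap_swap X (n := n + 2) 0 (by omega)
    change permMap X (n + 2) (Equiv.swap 0 1) = swapTop X n at hs
    have h1' : e (Fin.succ 0) = π ≫ ι := h1
    rw [hs, famMap_succ, famMap_succ, h0, h1']
    exact key _
  obtain ⟨g, h0, h1⟩ : ∃ g : Equiv.Perm (Fin (n + 2)), g 0 = i ∧ g 1 = j := by
    have h01 : i ≠ Equiv.swap 0 i 1 := by
      conv_lhs => rw [← Equiv.swap_apply_left 0 i]
      exact (Equiv.injective _).ne (by simp)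
    refine ⟨Equiv.swap (Equiv.swap 0 i 1) j * Equiv.swap 0 i, ?_, ?_⟩
    · rw [Equiv.Perm.mul_apply, Equiv.swap_apply_left, Equiv.swap_apply_of_ne_of_ne h01 hij]
    · rw [Equiv.Perm.mul_apply, Equiv.swap_apply_left]
  have hg : Equiv.swap i j = g * Equiv.swap 0 1 * g⁻¹ := by
    rw [← h0, ← h1, Equiv.swap_apply_apply]
  have h := top (fun m => e (g m)) (by rw [h0, hi]) (by rw [h1, hj])
  have h2 := famMap_permMap (fun m => e (g m)) g⁻¹
  rw [show (fun m => e (g (g⁻¹ m))) = e from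
    funext fun m => congrArg e (g.apply_symm_apply m)] at h2
  rw [hg, permMap_mul, permMap_mul, reassoc_of% h2, reassoc_of% h, Preadditive.zsmul_comp,
    famMap_permMap, Preadditive.comp_zsmul, ← Category.assoc, ← permMap_mul, mul_inv_cancel,
    permMap_one, Category.id_comp]

omit [SymmetricCategory D] in
lemma sum_famMap {X : D} {S : Type*} [Fintype S] (e : S → (X ⟶ X)) (n : ℕ) :
    ∑ f : Fin n → S, famMap n (fun i => e (f i)) = powMap (∑ s, e s) n := by
  induction n with
  | zero => simp [famMap, powMap]
  | succ n ih =>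
    rw [← (Fin.consEquiv fun _ => S).sum_comp, Fintype.sum_prod_type, powMap_succ, ← ih]
    rw [sum_whiskerRight, whiskerLeft_sum, Preadditive.sum_comp]
    refine Finset.sum_congr rfl fun s _ => ?_
    rw [Preadditive.comp_sum]
    rfl

/-- The idempotents of a decomposition into summands that are isomorphic to even or odd invertible
objects give a decomposition of the tensor power. On each summand of the tensor power,
the row symmetrizer vanishes if two boxes of a row carry the same odd summand, and otherwise the
column antisymmetrizer vanishes, as two boxes of some column carry the same even summand. -/
lemma colorSym_colorAnti_eq_zero [DivisibleUnit D] {X L : D} (hβ : (β_ L L).hom = -𝟙 _)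
    {a b p q : ℕ} (hab : a * q + b * p < a * b)
    (π₀ : Fin p → (X ⟶ 𝟙_ D)) (ι₀ : Fin p → (𝟙_ D ⟶ X)) (π₁ : Fin q → (X ⟶ L))
    (ι₁ : Fin q → (L ⟶ X)) (hX : ∑ s, π₀ s ≫ ι₀ s + ∑ s, π₁ s ≫ ι₁ s = 𝟙 X) {n : ℕ} (hn : a * b ≤ n)
    (r c : Fin n → ℕ) (hr : ∀ i, r i < a) (hc : ∀ i, c i < b) :
    colorSym X r ≫ colorAnti X c = 0 := by
  have two {V W : D} {f : V ⟶ W} (h : f = -f) : f = 0 :=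
    eq_zero_of_nsmul_eq_zero two_ne_zero (by rw [two_nsmul]; nth_rw 2 [h]; exact add_neg_cancel f)
  let e : Fin p ⊕ Fin q → (X ⟶ X) := Sum.elim (fun s => π₀ s ≫ ι₀ s) fun s => π₁ s ≫ ι₁ s
  have he : ∑ s, e s = 𝟙 X := by rw [Fintype.sum_sum_type, ← hX]; rfl
  have hodd (f : Fin n → Fin p ⊕ Fin q) (i j : Fin n) (s : Fin q) (hij : i ≠ j)
      (hi : f i = .inr s) (hj : f j = .inr s) (hrr : r i = r j) :
      famMap n (fun m => e (f m)) ≫ colorSym X r = 0 := by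
    have h := famMap_swap (π₁ s) (ι₁ s) (-1) (by rw [hβ, neg_one_zsmul]) (fun m => e (f m)) hij
      (by rw [hi]; rfl) (by rw [hj]; rfl)
    apply two
    conv_lhs => rw [← permMap_swap_colorSym X hrr, ← Category.assoc, h]
    rw [neg_one_zsmul, Preadditive.neg_comp]
  have heven (f : Fin n → Fin p ⊕ Fin q) (i j : Fin n) (s : Fin p) (hij : i ≠ j)
      (hi : f i = .inl s) (hj : f j = .inl s) (hcc : c i = c j) :
      famMap n (fun m => e (f m)) ≫ colorAnti X c = 0 := by
    have h := famMap_swap (π₀ s) (ι₀ s) 1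
      (by rw [braiding_tensorUnit_left, unitors_equal, one_zsmul, Iso.hom_inv_id])
      (fun m => e (f m)) hij (by rw [hi]; rfl) (by rw [hj]; rfl)
    apply two
    conv_lhs => rw [← neg_neg (colorAnti X c), ← permMap_swap_colorAnti X hij hcc,
      Preadditive.comp_neg, ← Category.assoc, h, one_zsmul]
  -- there are `a * q` pairs of a row and an odd summand, `b * p` pairs of a column and an even
  -- summand, and more boxes than that
  have pigeon (f : Fin n → Fin p ⊕ Fin q) :
      (∃ i j s, i ≠ j ∧ f i = .inr s ∧ f j = .inr s ∧ r i = r j) ∨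
      ∃ i j s, i ≠ j ∧ f i = .inl s ∧ f j = .inl s ∧ c i = c j := by
    let φ : Fin n → (Fin b × Fin p) ⊕ (Fin a × Fin q) := fun i =>
      (f i).map (fun s => (⟨c i, hc i⟩, s)) fun s => (⟨r i, hr i⟩, s)
    obtain ⟨i, j, hij, h⟩ := Fintype.exists_ne_map_eq_of_card_lt φ (by
      simp only [Fintype.card_sum, Fintype.card_prod, Fintype.card_fin]; omega)
    rcases hi : f i with s | s <;> rcases hj : f j with t | t <;> simp [φ, hi, hj] at h
    · obtain ⟨h1, rfl⟩ := h
      exact .inr ⟨i, j, s, hij, hi, hj, h1⟩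
    · obtain ⟨h1, rfl⟩ := h
      exact .inl ⟨i, j, s, hij, hi, hj, h1⟩
  rw [← Category.id_comp (colorSym X r), ← powMap_id, ← he, ← sum_famMap, Preadditive.sum_comp,
    Preadditive.sum_comp]
  refine Finset.sum_eq_zero fun f _ => ?_
  by_cases h : ∃ i j s, i ≠ j ∧ f i = .inr s ∧ f j = .inr s ∧ r i = r j
  · obtain ⟨i, j, s, hij, hi, hj, hrr⟩ := h
    rw [hodd f i j s hij hi hj hrr, zero_comp]
  · rw [colorSym, Preadditive.comp_sum, Preadditive.sum_comp]
    -- a permutation that preserves the rows keeps the property that no row has two equal odd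
    -- summands
    refine Finset.sum_eq_zero fun g hg => ?_
    have hg' : ∀ i, r (g i) = r i := by simpa using hg
    have h2 := famMap_permMap (fun m => e (f (g.symm m))) g
    simp only [Equiv.symm_apply_apply] at h2
    rw [h2, Category.assoc]
    obtain ⟨i, j, s, hij, hi, hj, hrr⟩ | ⟨i, j, s, hij, hi, hj, hcc⟩ := pigeon fun m => f (g.symm m)
    · refine absurd ⟨_, _, s, (g.symm.injective.ne hij), hi, hj, ?_⟩ h
      rw [← hg', ← hg' (g.symm j)]
      simpa using hrr
    · rw [heven _ i j s hij hi hj hcc, comp_zero]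

end ColorSums

/-! ### The vanishing of a Schur functor in terms of the Young symmetrizer -/

section SchurVanishing

variable (k : Type w) [Field k] {C : Type*} [Category* C] [MonoidalCategory C]
  [SymmetricCategory C] [Preadditive C] [Linear k C]

/-- The action of the group algebra of the symmetric group on a tensor power, through the
anti-involution that inverts the permutations. -/
def antiAction (X : C) (n : ℕ) :
    MonoidAlgebra k (Equiv.Perm (Fin n)) →ₐ[k] (End (tensorPow X n))ᵐᵒᵖ :=
  MonoidAlgebra.lift k _ _
    { toFun g := MulOpposite.op (permMap X n g⁻¹)
      map_one' := congrArg MulOpposite.op ((congrArg _ inv_one).trans (permMap_one X n))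
      map_mul' g h := congrArg MulOpposite.op
        ((congrArg _ (mul_inv_rev g h)).trans (permMap_mul X n h⁻¹ g⁻¹)) }

lemma antiAction_single (X : C) {n : ℕ} (g : Equiv.Perm (Fin n)) (a : k) :
    (antiAction k X n (MonoidAlgebra.single g a)).unop = a • permMap X n g⁻¹ := by
  rw [antiAction, MonoidAlgebra.lift_single]
  rfl

lemma antiAction_mul (X : C) {n : ℕ} (x y : MonoidAlgebra k (Equiv.Perm (Fin n))) :
    (antiAction k X n (x * y)).unop =
      (antiAction k X n x).unop ≫ ((antiAction k X n y).unop : tensorPow X n ⟶ tensorPow X n) := by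
  rw [map_mul]
  rfl

/-- The substitution `g ↦ g h⁻¹` moves an element of the group algebra from the argument of a
functional to the tensor power. -/
lemma sum_functional_smul_permMap (X : C) {n : ℕ}
    (ℓ : MonoidAlgebra k (Equiv.Perm (Fin n)) →ₗ[k] k) (x : MonoidAlgebra k (Equiv.Perm (Fin n))) :
    ∑ g, ℓ (MonoidAlgebra.single g 1 * x) • permMap X n g =
      ∑ g, ℓ (MonoidAlgebra.single g 1) • ((antiAction k X n x).unop ≫ permMap X n g) := by
  induction x using MonoidAlgebra.induction_linear with
  | zero =>
    simp
  | add x y hx hy =>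
    simp only [mul_add, map_add ℓ, add_smul, Finset.sum_add_distrib, hx, hy]
    rw [← Finset.sum_add_distrib]
    refine Finset.sum_congr rfl fun g _ => ?_
    rw [← smul_add, ← Preadditive.add_comp, map_add]
    rfl
  | single h a =>
    rw [← Equiv.sum_comp (Equiv.mulRight h⁻¹)]
    refine Finset.sum_congr rfl fun g _ => ?_
    rw [antiAction_single, Linear.smul_comp, ← permMap_mul, Equiv.coe_mulRight,
      MonoidAlgebra.single_mul_single, inv_mul_cancel_right, one_mul, ← mul_one a,
      ← smul_eq_mul a 1, ← MonoidAlgebra.smul_single, map_smul, smul_eq_mul, smul_eq_mul, mul_one,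
      mul_comm, mul_smul]

open Classical in
lemma inv_mem_preserving {n : ℕ} (c : Fin n → ℕ) (g : Equiv.Perm (Fin n)) :
    (g ∈ Finset.univ.filter fun g : Equiv.Perm (Fin n) => ∀ i, c (g i) = c i) ↔
      Equiv.inv _ g ∈ Finset.univ.filter fun g : Equiv.Perm (Fin n) => ∀ i, c (g i) = c i := by
  simp only [Finset.mem_filter, Finset.mem_univ, true_and, Equiv.inv_apply]
  refine ⟨fun h i => ?_, fun h i => ?_⟩
  · rw [← h, ← Equiv.Perm.mul_apply, mul_inv_cancel, Equiv.Perm.one_apply]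
  · rw [← h, ← Equiv.Perm.mul_apply, inv_mul_cancel, Equiv.Perm.one_apply]

lemma antiAction_rowSymmetrizer (X : C) (μ : YoungDiagram) :
    (antiAction k X _ (rowSymmetrizer k μ)).unop = colorSym X (boxRow μ) := by
  classical
  have h : (antiAction k X _ (rowSymmetrizer k μ)).unop =
      ∑ g : Equiv.Perm (Fin μ.card) with ∀ i, boxRow μ (g i) = boxRow μ i,
        ((antiAction k X _ (MonoidAlgebra.single g 1)).unop : tensorPow X _ ⟶ tensorPow X _) := by
    rw [rowSymmetrizer, map_sum]
    refine (map_sum MulOpposite.opAddEquiv.symm _ _).trans ?_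
    convert! rfl
  rw [h, colorSym]
  simp only [antiAction_single, one_smul]
  exact Finset.sum_equiv (Equiv.inv _) (inv_mem_preserving _) fun g _ => rfl

lemma antiAction_colAntisymmetrizer (X : C) (μ : YoungDiagram) :
    (antiAction k X _ (colAntisymmetrizer k μ)).unop = colorAnti X (boxCol μ) := by
  classical
  have h : (antiAction k X _ (colAntisymmetrizer k μ)).unop =
      ∑ g : Equiv.Perm (Fin μ.card) with ∀ i, boxCol μ (g i) = boxCol μ i,
        ((antiAction k X _ (MonoidAlgebra.single g ((Equiv.Perm.sign g : ℤ) : k))).unop :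
          tensorPow X _ ⟶ tensorPow X _) := by
    rw [colAntisymmetrizer, map_sum]
    refine (map_sum MulOpposite.opAddEquiv.symm _ _).trans ?_
    convert! rfl
  rw [h, colorAnti]
  simp only [antiAction_single, Int.cast_smul_eq_zsmul]
  refine Finset.sum_equiv (Equiv.inv _) (inv_mem_preserving _) fun g _ => ?_
  rw [Equiv.inv_apply, Equiv.Perm.sign_inv]

lemma antiAction_youngSymmetrizer (X : C) (μ : YoungDiagram) :
    (antiAction k X _ (youngSymmetrizer k μ)).unop =
      colorSym X (boxRow μ) ≫ colorAnti X (boxCol μ) := by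
  rw [youngSymmetrizer, antiAction_mul, antiAction_rowSymmetrizer, antiAction_colAntisymmetrizer]

end SchurVanishing

section Schur

variable (k : Type w) [Field k] {C : Type*} [Category* C] [MonoidalCategory C]
  [SymmetricCategory C] [Abelian C] [Linear k C]

attribute [local instance] Abelian.hasFiniteBiproducts

omit [MonoidalCategory C] [SymmetricCategory C] in
lemma sum_matrix_eq_zero_iff {n : ℕ} {T : C} {G : Type*} [Fintype G]
    (m : G → Fin n → Fin n → (T ⟶ T)) :
    ∑ g, (biproduct.matrix (m g) : (⨁ fun _ : Fin n => T) ⟶ ⨁ fun _ : Fin n => T) = 0 ↔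
      ∀ i j, ∑ g, m g i j = 0 := by
  have h (i j : Fin n) : biproduct.ι (fun _ : Fin n => T) i ≫
      (∑ g, (biproduct.matrix (m g) : (⨁ fun _ : Fin n => T) ⟶ ⨁ fun _ : Fin n => T)) ≫
        biproduct.π (fun _ : Fin n => T) j = ∑ g, m g i j := by
    rw [Preadditive.sum_comp, Preadditive.comp_sum]
    exact Finset.sum_congr rfl fun g _ => by simp
  refine ⟨fun h0 i j => ?_, fun h0 => ?_⟩
  · rw [← h, h0, zero_comp, comp_zero]
  · refine biproduct.hom_ext' _ _ fun i => biproduct.hom_ext _ _ fun j => ?_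
    rw [Category.assoc, h, h0, comp_zero, zero_comp]

omit [MonoidalCategory C] [SymmetricCategory C] in
/-- A sum of endomorphisms `a ⊗ f` of `V ⊗ T` vanishes if and only if all its matrix coefficients in
the first factor vanish. -/
lemma sum_vecTensorMap_eq_zero_iff {V : Type w} [AddCommGroup V] [Module k V] [Module.Finite k V]
    {T : C} {G : Type*} [Fintype G] (a : G → (V →ₗ[k] V)) (f : G → (T ⟶ T)) :
    ∑ g, vecTensorMap k (a g) (f g) = 0 ↔
      ∀ (v : V) (ℓ : V →ₗ[k] k), ∑ g, ℓ (a g v) • f g = 0 := by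
  let b := Module.finBasis k V
  have h1 : ∑ g, vecTensorMap k (a g) (f g) = 0 ↔
      ∀ i j, ∑ g, b.coord j (a g (b i)) • f g = 0 := by
    refine Iff.trans (sum_matrix_eq_zero_iff fun g i j => LinearMap.toMatrix b b (a g) j i • f g) ?_
    simp only [LinearMap.toMatrix_apply, Module.Basis.coord_apply]
  rw [h1]
  refine ⟨fun h v ℓ => ?_, fun h i j => h _ _⟩
  have hv (g : G) : ℓ (a g v) = ∑ i, ∑ j, (b.coord i v * ℓ (b j)) * b.coord j (a g (b i)) := by
    conv_lhs => rw [← b.sum_repr v, map_sum, map_sum]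
    refine Finset.sum_congr rfl fun i _ => ?_
    conv_lhs => rw [map_smul, map_smul, ← b.sum_repr (a g (b i)), map_sum, smul_eq_mul,
      Finset.mul_sum]
    refine Finset.sum_congr rfl fun j _ => ?_
    rw [map_smul, smul_eq_mul, Module.Basis.coord_apply, Module.Basis.coord_apply]
    ring
  simp only [hv, Finset.sum_smul]
  rw [Finset.sum_comm]
  refine Finset.sum_eq_zero fun i _ => ?_
  rw [Finset.sum_comm]
  refine Finset.sum_eq_zero fun j _ => ?_
  simp only [mul_smul _ (b.coord j _)]
  rw [← Finset.smul_sum, h, smul_zero]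

/-- The Schur functor attached to a partition vanishes if and only if the Young symmetrizer acts
by zero on the tensor power. -/
lemma isZero_schurFunctor_iff (μ : YoungDiagram) (X : C) : IsZero (schurFunctor k μ X) ↔
    colorSym X (boxRow μ) ≫ colorAnti X (boxCol μ) = 0 := by
  have h0 : IsZero (schurFunctor k μ X) ↔ ∑ g : Equiv.Perm (Fin μ.card),
      vecTensorMap k (spechtRep k μ g) (permMap X μ.card g) = 0 := by
    refine ⟨fun h => ?_, fun h => IsZero.of_iso (isZero_zero C) (imageZero' h)⟩
    have h2 : (image.ι (∑ g : Equiv.Perm (Fin μ.card),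
      vecTensorMap k (spechtRep k μ g) (permMap X μ.card g))) = 0 := h.eq_zero_of_src _
    rw [← image.fac (∑ g : Equiv.Perm (Fin μ.card), _), h2, comp_zero]
  rw [h0, sum_vecTensorMap_eq_zero_iff, ← antiAction_youngSymmetrizer k]
  have hact (g : Equiv.Perm (Fin μ.card)) (v : SpechtModule k μ) :
      (spechtRep k μ g v : MonoidAlgebra k (Equiv.Perm (Fin μ.card))) =
        MonoidAlgebra.single g 1 * (v : MonoidAlgebra k (Equiv.Perm (Fin μ.card))) := by
    rw [spechtRep, Representation.ofModule']
    rfl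
  constructor
  · intro h
    -- the coefficient of the identity, as a functional on the Specht module
    let ε : MonoidAlgebra k (Equiv.Perm (Fin μ.card)) →ₗ[k] k :=
      { toFun x := x.coeff 1
        map_add' x y := rfl
        map_smul' x y := rfl }
    have h1 := h ⟨youngSymmetrizer k μ, Submodule.mem_span_singleton_self _⟩
      (ε ∘ₗ (Submodule.subtype _).restrictScalars k)
    have h2 := sum_functional_smul_permMap k X ε (youngSymmetrizer k μ)
    have h3 (g : Equiv.Perm (Fin μ.card)) :
        ε (MonoidAlgebra.single g 1) = if g = 1 then 1 else 0 :=
      Finsupp.single_apply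
    simp only [h3, ite_smul, one_smul, zero_smul, Finset.sum_ite_eq', Finset.mem_univ, if_true,
      permMap_one, Category.comp_id] at h2
    rw [← h2, ← h1]
    refine Finset.sum_congr rfl fun g _ => ?_
    congr 1
  · intro h v ℓ
    -- matrix coefficients of the Specht module extend to the group algebra
    obtain ⟨ℓ', hℓ'⟩ := LinearMap.exists_extend
      (p := (Submodule.span (MonoidAlgebra k (Equiv.Perm (Fin μ.card)))
        {youngSymmetrizer k μ}).restrictScalars k) ℓ
    obtain ⟨x, hx⟩ := Submodule.mem_span_singleton.1 v.2
    have h1 := sum_functional_smul_permMap k X ℓ' v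
    rw [← hx, smul_eq_mul, antiAction_mul, h] at h1
    simp only [comp_zero, zero_comp, smul_zero, Finset.sum_const_zero] at h1
    rw [← h1]
    refine Finset.sum_congr rfl fun g _ => ?_
    congr 1
    rw [← smul_eq_mul x, hx, ← hact, ← hℓ']
    rfl

end Schur

/-! ### Integral relations between permutations -/

section Relation

variable {D : Type*} [Category* D] [MonoidalCategory D] [SymmetricCategory D] [Preadditive D]

/-- The product of a row symmetrizer and a column antisymmetrizer is an integral combination of
permutations in which the identity has the coefficient `1`, as a permutation that is a product of
one preserving the rows and one preserving the columns is so in a unique way. -/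
lemma exists_coeff_colorSym_colorAnti {n : ℕ} (r c : Fin n → ℕ)
    (h : ∀ i j, r i = r j → c i = c j → i = j) : ∃ z : Equiv.Perm (Fin n) → ℤ, z 1 = 1 ∧
      ∀ X : D, ∑ g, z g • permMap X n g = colorSym X r ≫ colorAnti X c := by
  classical
  refine ⟨fun g => ∑ s : Equiv.Perm (Fin n) with ∀ i, r (s i) = r i,
    ∑ t : Equiv.Perm (Fin n) with ∀ i, c (t i) = c i,
      if g = t * s then (Equiv.Perm.sign t : ℤ) else 0, ?_, fun X => ?_⟩
  · -- only the identity preserves both colourings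
    have h1 {s t : Equiv.Perm (Fin n)} (hs : ∀ i, r (s i) = r i) (ht : ∀ i, c (t i) = c i)
        (hst : 1 = t * s) : s = 1 := by
      obtain rfl : t = s⁻¹ := eq_inv_of_mul_eq_one_left hst.symm
      ext i
      refine congrArg Fin.val (h _ _ (hs i) ?_)
      rw [← ht (s i), ← Equiv.Perm.mul_apply, inv_mul_cancel, Equiv.Perm.one_apply]
    beta_reduce
    rw [Finset.sum_eq_single 1, Finset.sum_eq_single 1]
    · simp
    · intro t _ ht
      rw [mul_one, if_neg ht.symm]
    · simp
    · intro s hs hs1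
      refine Finset.sum_eq_zero fun t ht => if_neg fun hst => hs1 ?_
      exact h1 (Finset.mem_filter.1 hs).2 (Finset.mem_filter.1 ht).2 hst
    · simp
  · simp only [Finset.sum_smul]
    rw [Finset.sum_comm, colorSym, colorAnti, Preadditive.sum_comp]
    refine Finset.sum_congr rfl fun s _ => ?_
    rw [Finset.sum_comm, Preadditive.comp_sum]
    refine Finset.sum_congr rfl fun t _ => ?_
    simp only [ite_smul, zero_smul, Finset.sum_ite_eq', Finset.mem_univ, if_true]
    rw [permMap_mul, Preadditive.comp_zsmul]

lemma powMap_sum_permMap {X Y : D} (f : X ⟶ Y) {n : ℕ} (z : Equiv.Perm (Fin n) → ℤ) :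
    powMap f n ≫ ∑ g, z g • permMap Y n g = (∑ g, z g • permMap X n g) ≫ powMap f n := by
  rw [Preadditive.comp_sum, Preadditive.sum_comp]
  simp only [Preadditive.comp_zsmul, Preadditive.zsmul_comp, permMap_powMap]

lemma sum_permMap_powCmp {E : Type*} [Category* E] [MonoidalCategory E] [SymmetricCategory E]
    [Preadditive E] {F : D ⥤ E} [F.Braided] [F.Additive] (X : D) {n : ℕ}
    (z : Equiv.Perm (Fin n) → ℤ) : (∑ g, z g • permMap (F.obj X) n g) ≫ (powCmp F X n).hom =
      (powCmp F X n).hom ≫ F.map (∑ g, z g • permMap X n g) := by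
  rw [F.map_sum, Preadditive.comp_sum, Preadditive.sum_comp]
  simp only [F.map_zsmul, Preadditive.comp_zsmul, Preadditive.zsmul_comp, permMap_powCmp]

end Relation

section Unit

variable {C : Type u} [SmallCategory C] [Abelian C] [MonoidalCategory C]
  [MonoidalPreadditive C] [SymmetricCategory C] [RigidCategory C]

/-- A relation between the permutations of the factors of the tensor powers descends along local
isomorphisms. -/
lemma LocallyIsomorphic.sum_permMap_eq_zero (hend : ∀ e : 𝟙_ C ⟶ 𝟙_ C, e ≠ 0 → IsIso e) {X U : C}
    (h : LocallyIsomorphic X U) {n : ℕ} {z : Equiv.Perm (Fin n) → ℤ}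
    (hz : ∑ g, z g • permMap U n g = 0) : ∑ g, z g • permMap X n g = 0 := by
  obtain ⟨B, ⟨e⟩⟩ := h
  obtain ⟨f⟩ := B.nonempty_free_iso e
  refine B.eq_zero_of_free_map_eq_zero hend ?_
  have h1 := sum_permMap_powCmp (F := LaxAlg.Free.free B.toLaxAlg) U z
  rw [hz, Functor.map_zero, comp_zero] at h1
  replace h1 := (cancel_mono _).1 (h1.trans zero_comp.symm)
  have h2 := powMap_sum_permMap f.hom z
  rw [h1, comp_zero] at h2
  have h3 := h2.symm =≫ powMap f.inv n
  rw [Category.assoc, ← powMap_comp, f.hom_inv_id, powMap_id, Category.comp_id, zero_comp] at h3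
  have h4 := sum_permMap_powCmp (F := LaxAlg.Free.free B.toLaxAlg) X z
  rw [h3, zero_comp] at h4
  exact (cancel_epi _).1 (h4.symm.trans comp_zero.symm)

omit [MonoidalPreadditive C] [RigidCategory C] in
lemma LocallyIsomorphic.trans_iso {X U U' : C} (h : LocallyIsomorphic X U) (e : U ≅ U') :
    LocallyIsomorphic X U' := by
  obtain ⟨A, ⟨f⟩⟩ := h
  let e' : toInd U ≅ toInd U' :=
    (DayFunctor.equiv Cᵒᵖ (Type u)).inverse.mapIso (yoneda.mapIso e)
  refine ⟨A, ⟨f ≪≫ Day.freeModuleIso A.X (whiskerLeftIso A.X e') ?_⟩⟩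
  rw [whiskerLeftIso_hom, associator_inv_naturality_right_assoc, whisker_exchange, Category.assoc]

end Unit

/-! ### Rectangular partitions -/

/-- The rectangular partition with `a` rows of length `b`. -/
def rectangle (a b : ℕ) : YoungDiagram where
  cells := Finset.range a ×ˢ Finset.range b
  isLowerSet := by
    rintro ⟨i, j⟩ ⟨i', j'⟩ ⟨hi, hj⟩ h
    simp only [Finset.coe_product, Finset.coe_range, Set.mem_prod, Set.mem_Iio] at *
    exact ⟨lt_of_le_of_lt hi h.1, lt_of_le_of_lt hj h.2⟩

lemma rectangle_card (a b : ℕ) : (rectangle a b).card = a * b := by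
  simp [YoungDiagram.card, rectangle]

lemma boxRow_rectangle_lt {a b : ℕ} (i : Fin (rectangle a b).card) :
    boxRow (rectangle a b) i < a :=
  Finset.mem_range.1 (Finset.mem_product.1 (boxNumbering (rectangle a b) i).2).1

lemma boxCol_rectangle_lt {a b : ℕ} (i : Fin (rectangle a b).card) :
    boxCol (rectangle a b) i < b :=
  Finset.mem_range.1 (Finset.mem_product.1 (boxNumbering (rectangle a b) i).2).2

lemma box_injective (μ : YoungDiagram) (i j : Fin μ.card) (hr : boxRow μ i = boxRow μ j)
    (hc : boxCol μ i = boxCol μ j) : i = j :=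
  (boxNumbering μ).injective (Subtype.ext (Prod.ext hr hc))

/-! ### Young symmetrizers and local isomorphism with sums of units -/

section Equivalence

variable {C : Type u} [SmallCategory C] [Abelian C] [MonoidalCategory C]
  [MonoidalPreadditive C] [SymmetricCategory C]

attribute [local instance] Abelian.hasFiniteBiproducts

/-- The Young symmetrizer of the rectangle with `2p + 1` rows and `2q + 1` columns acts by zero on
the tensor power of `𝟙^p ⊕ L^q`. -/
lemma colorSym_colorAnti_unitSum_eq_zero [DivisibleUnit C] {L : C} (hβ : (β_ L L).hom = -𝟙 _)
    (p q : ℕ) : colorSym (unitSum L p q) (boxRow (rectangle (2 * p + 1) (2 * q + 1))) ≫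
      colorAnti (unitSum L p q) (boxCol (rectangle (2 * p + 1) (2 * q + 1))) = 0 := by
  -- `(2p + 1) q + (2q + 1) p < (2p + 1) (2q + 1)`
  refine colorSym_colorAnti_eq_zero hβ (p := p) (q := q) (by nlinarith)
    (fun s => biprod.fst ≫ biproduct.π _ s)
    (fun s => biproduct.ι (fun _ : Fin p => 𝟙_ C) s ≫ biprod.inl)
    (fun s => biprod.snd ≫ biproduct.π _ s)
    (fun s => biproduct.ι (fun _ : Fin q => L) s ≫ biprod.inr) ?_
    (rectangle_card _ _).ge _ _ boxRow_rectangle_lt boxCol_rectangle_lt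
  simp only [Category.assoc, ← Preadditive.comp_sum]
  simp only [← Category.assoc (biproduct.π _ _), ← Preadditive.sum_comp, biproduct.total,
    Category.id_comp]
  exact biprod.total

variable [RigidCategory C]

lemma LocallyIsomorphic.exists_colorSym_colorAnti_eq_zero [DivisibleUnit C]
    (hend : ∀ e : 𝟙_ C ⟶ 𝟙_ C, e ≠ 0 → IsIso e) {L : C} (hβ : (β_ L L).hom = -𝟙 _) {X : C}
    {p q : ℕ}
    (h : LocallyIsomorphic X (unitSum L p q)) :
    ∃ μ : YoungDiagram, colorSym X (boxRow μ) ≫ colorAnti X (boxCol μ) = 0 := by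
  refine ⟨rectangle (2 * p + 1) (2 * q + 1), ?_⟩
  obtain ⟨z, -, hz⟩ := exists_coeff_colorSym_colorAnti (D := C) _ _
    (box_injective (rectangle (2 * p + 1) (2 * q + 1)))
  rw [← hz]
  exact h.sum_permMap_eq_zero hend ((hz _).trans (colorSym_colorAnti_unitSum_eq_zero hβ p q))

/-- If a Young symmetrizer acts by zero, then its coefficients give a relation from which units
can be split off, starting with `U = 0` and the idempotent `𝟙`. -/
lemma exists_locallyIsomorphic_unitSum [DivisibleUnit C] (h1 : 𝟙 (𝟙_ C) ≠ 0) {L : C}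
    (hL : Nonempty (L ⊗ L ≅ 𝟙_ C)) (hβ : (β_ L L).hom = -𝟙 _) {X : C} {μ : YoungDiagram}
    (h : colorSym X (boxRow μ) ≫ colorAnti X (boxCol μ) = 0) :
    ∃ p q : ℕ, LocallyIsomorphic X (unitSum L p q) := by
  obtain ⟨z, hz1, hz⟩ := exists_coeff_colorSym_colorAnti (D := C) _ _ (box_injective μ)
  have h0 : IsZero (unitSum L 0 0) := by
    rw [IsZero.iff_id_eq_zero]
    exact biprod.hom_ext' _ _ (biproduct.hom_ext' _ _ fun i => i.elim0)
      (biproduct.hom_ext' _ _ fun i => i.elim0)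
  obtain ⟨U, ⟨p, q, ⟨e⟩⟩, hU⟩ := PartialSplitting.locallyIsomorphic hL hβ μ.card (X := X)
    (F := 𝟭 C) PreservesCokernels.id h1
    { U := unitSum L 0 0
      isUnitSum := isUnitSum_zero L
      i := 0
      r := 0
      e := 𝟙 _
      i_r := h0.eq_of_src _ _
      r_i := by rw [zero_comp, zero_add]
      z := z
      z_one := hz1
      rel := by rw [hz]; exact (congrArg _ h).trans comp_zero }
  exact ⟨p, q, hU.trans_iso e⟩

end Equivalence

lemma divisibleUnit_of_charZero (k : Type w) [Field k] [CharZero k] (C : Type*) [Category* C]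
    [MonoidalCategory C] [Preadditive C] [Linear k C] : DivisibleUnit C where
  exists_nsmul_eq_id n hn := ⟨(n : k)⁻¹ • 𝟙 _, by
    rw [← Nat.cast_smul_eq_nsmul k, smul_smul, mul_inv_cancel₀ (Nat.cast_ne_zero.2 hn), one_smul]⟩

lemma isIso_of_ne_zero {k : Type w} [Field k] {C : Type*} [Category* C] [Preadditive C]
    [Linear k C] {Z : C} (h : Function.Surjective fun c : k => c • 𝟙 Z) (e : Z ⟶ Z) (he : e ≠ 0) :
    IsIso e := by
  obtain ⟨c, rfl⟩ := h e
  have hc : c ≠ 0 := fun hc => he (by simp [hc])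
  exact ⟨c⁻¹ • 𝟙 Z, by simp [smul_smul, hc], by simp [smul_smul, hc]⟩

end

end LocalStructure

theorem mainTheorem4 {k : Type w} [Field k] [IsAlgClosed k] [CharZero k]
    {C : Type u} [SmallCategory C] [Abelian C] [Linear k C]
    [MonoidalCategory C] [MonoidalPreadditive C] [MonoidalLinear k C]
    [SymmetricCategory C] [RigidCategory C]
    (hEnd : Function.Bijective (fun c : k => c • 𝟙 (𝟙_ C)))
    (L : C) (hL : Nonempty (L ⊗ L ≅ 𝟙_ C)) (hβ : (β_ L L).hom = -𝟙 (L ⊗ L)) (X : C) :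
    (∃ p q : ℕ, LocalStructure.LocallyIsomorphic X (LocalStructure.unitSum L p q)) ↔
      ∃ μ : YoungDiagram, IsZero (LocalStructure.schurFunctor k μ X) := by
  have := LocalStructure.divisibleUnit_of_charZero k C
  simp only [LocalStructure.isZero_schurFunctor_iff]
  constructor
  · rintro ⟨p, q, h⟩
    exact h.exists_colorSym_colorAnti_eq_zero (LocalStructure.isIso_of_ne_zero hEnd.2) hβ
  · rintro ⟨μ, h⟩
    refine LocalStructure.exists_locallyIsomorphic_unitSum (fun h1 => ?_) hL hβ h
    exact one_ne_zero (hEnd.1 (by simp [h1] : (1 : k) • 𝟙 (𝟙_ C) = (0 : k) • 𝟙 (𝟙_ C)))
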